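/- Let $E=(E^0,E^1,s,r)$ be a finite directed graph with no sinks (every vertex is the source of some edge; there may be vertices that are not the range of an edge). A path of length $k\ge 1$ is $\alpha=e_1\cdots e_k$ with $s(e_j)=r(e_{j+1})$, with $s(\alpha)=s(e_k)$, $r(\alpha)=r(e_1)$; paths of length $0$ are the vertices; $E^k$ is the set of paths of length $k$. Let $X_E^{\otimes k}$ be the Hilbert module over $A=c(E^0)$ with basis $\{\delta_\alpha:\alpha\in E^k\}$, inner product $\langle x,y\rangle(v)=\sum_{s(\alpha)=v}\overline{x(\alpha)}y(\alpha)$ and left action $\varphi_k(a)\delta_\alpha=a(r(\alpha))\delta_\alpha$. Let $\mathcal F=\bigoplus_{k\ge0}X_E^{\otimes k}$ be the Fock correspondence, $\mathcal L(\mathcal F)$ the C*-algebra of adjointable operators on $\mathcal F$, $\mathcal K$ the ideal of generalized compact operators (the closed linear span of the operators $z\mapsto x\langle y,z\rangle$), and $q:\mathcal L(\mathcal F)\to\mathcal L(\mathcal F)/\mathcal K$ the quotient map. Let $P_v\delta_\beta=\delta_\beta$ if $r(\beta)=v$ and $0$ otherwise, $S_e\delta_\beta=\delta_{e\beta}$ if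 $s(e)=r(\beta)$ and $0$ otherwise, $S_\alpha=S_{e_1}\cdots S_{e_k}$ for $\alpha=e_1\cdots e_k$, and $S_v=P_v$ for a vertex $v$. Let $\{Z_k\}_{k\ge0}$ be a weight sequence: $Z_k$ is a positive invertible adjointable operator on $X_E^{\otimes k}$ commuting with $\varphi_k(A)$, $Z_0=I$, $\sup_k\|Z_k\|<\infty$, and there is $\epsilon>0$ with $Z_k\ge\epsilon I$ for all $k\ge1$. Put $Z=\mathrm{diag}(Z_0,Z_1,\dots)$ on $\mathcal F$, let $\mathcal T$ be the C*-algebra generated by $\{ZS_e:e\in E^1\}$, and let $\mathcal D$ be the fixed point algebra in $\mathcal T$ of the gauge action $\gamma_t=\mathrm{Ad}(W_t)$, where $W_t\delta_\alpha=e^{i|\alpha|t}\delta_\alpha$ ($t\in\mathbb R$). Write $u_\alpha=q(S_\alpha)$ and $z=q(Z)$. Let $p\ge1$ and assume Condition A(p): $\lim_{k\to\infty}\|I_p\otimes Z_k-Z_{k+p}\|=0$, where $(I_p\otimes Z_k)\delta_{\beta\gamma}=\delta_\beta\otimes Z_k\delta_\gamma$ for $|\beta|=p$, $|\gamma|=k$.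 For $n\ge0$ let $\mathcal C_n$ be the C*-algebra generated by $\{u_\alpha z^lu_\beta^*: l\ge0,\ np\le|\alpha|=|\beta|<(n+1)p,\ s(\alpha)=s(\beta)\}$. For every $v\in E^0$ fix a path $\xi_v$ of length $p-1$ with $s(\xi_v)=v$, and put $\mathcal C_v=u_{\xi_v}u_{\xi_v}^*\,\mathcal C_0\,u_{\xi_v}u_{\xi_v}^*\subseteq\mathcal C_0$. Let $\Gamma_n=E^{(n+1)p-1}$, let $e_{\gamma_1,\gamma_2}$ be the matrix units of $M_{\Gamma_n}(\mathbb C)$, and let $$\mathcal A_n=\sum_{\gamma_1,\gamma_2\in\Gamma_n,\ s(\gamma_1)=s(\gamma_2)}e_{\gamma_1,\gamma_2}\otimes\mathcal C_{s(\gamma_1)}\subseteq M_{\Gamma_n}(\mathbb C)\otimes\mathcal C_0 .$$ Then the following hold. (1) For every $n\ge0$, the map $$\tau_n(c)=\sum_{\gamma_1,\gamma_2\in\Gamma_n,\ s(\gamma_1)=s(\gamma_2)}e_{\gamma_1,\gamma_2}\otimes u_{\xi_{s(\gamma_1)}}u_{\gamma_1}^*\,c\,u_{\gamma_2}u_{\xi_{s(\gamma_1)}}^*$$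 is a $*$-isomorphism of $\mathcal C_n$ onto $\mathcal A_n$, with inverse given by $\tau_n^{-1}(e_{\gamma_1,\gamma_2}\otimes b)=u_{\gamma_1}u_{\xi_{s(\gamma_1)}}^*\,b\,u_{\xi_{s(\gamma_1)}}u_{\gamma_2}^*$ for $\gamma_1,\gamma_2\in\Gamma_n$ with $s(\gamma_1)=s(\gamma_2)$ and $b\in\mathcal C_{s(\gamma_1)}$. (2) $\mathcal C_n\subseteq\mathcal C_{n+1}\subseteq q(\mathcal D)$ for all $n\ge0$, and $q(\mathcal D)$ is closed, hence a C*-algebra. With $\iota_n:\mathcal C_n\to\mathcal C_{n+1}$ the inclusion and $\psi_n=\tau_{n+1}\circ\iota_n\circ\tau_n^{-1}:\mathcal A_n\to\mathcal A_{n+1}$, the algebra $q(\mathcal D)$, together with the maps $\mathcal A_n\xrightarrow{\ \tau_n^{-1}\ }\mathcal C_n\subseteq q(\mathcal D)$, is the direct limit of the sequence $(\mathcal A_n,\psi_n)$ in the category of C*-algebras and $*$-homomorphisms; in particular $q(\mathcal D)\cong\varinjlim(\mathcal A_n,\psi_n)$. -/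

import Mathlib

universe w

noncomputable section

/-- `I` is a closed self-adjoint two-sided ideal. -/
class IsCStarIdeal {A : Type*} [CStarAlgebra A] (I : Ideal A) : Prop where
  twoSided : I.IsTwoSided
  closed : IsClosed (I : Set A)
  star_mem : ∀ x ∈ I, star x ∈ I

namespace IsCStarIdeal

variable {A : Type*} [CStarAlgebra A] (I : Ideal A) [hI : IsCStarIdeal I]

instance : I.IsTwoSided := hI.twoSided
instance : IsClosed (I : Set A) := hI.closed

instance instStarQuot : Star (A ⧸ I) where
  star := Quotient.map' star (by
    intro a b h
    rw [Submodule.quotientRel_def] at h ⊢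
    rw [← star_sub]
    exact hI.star_mem _ h)

theorem star_mk (a : A) :
    star (Ideal.Quotient.mk I a) = Ideal.Quotient.mk I (star a) := rfl

instance instStarRingQuot : StarRing (A ⧸ I) where
  star_involutive x := by
    obtain ⟨a, rfl⟩ := Ideal.Quotient.mk_surjective x
    simp [star_mk]
  star_mul x y := by
    obtain ⟨a, rfl⟩ := Ideal.Quotient.mk_surjective x
    obtain ⟨b, rfl⟩ := Ideal.Quotient.mk_surjective y
    simp [star_mk, ← map_mul]
  star_add x y := by
    obtain ⟨a, rfl⟩ := Ideal.Quotient.mk_surjective x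
    obtain ⟨b, rfl⟩ := Ideal.Quotient.mk_surjective y
    simp [star_mk, ← map_add]

theorem norm_mk_le (a : A) : ‖Ideal.Quotient.mk I a‖ ≤ ‖a‖ :=
  Submodule.Quotient.norm_mk_le I a

theorem norm_mk_lt (x : A ⧸ I) {ε : ℝ} (hε : 0 < ε) :
    ∃ a : A, Ideal.Quotient.mk I a = x ∧ ‖a‖ < ‖x‖ + ε :=
  Submodule.Quotient.norm_mk_lt x hε

instance instNormedRingQuot : NormedRing (A ⧸ I) where
  __ := Submodule.Quotient.normedAddCommGroup I
  __ := Ideal.Quotient.ring I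
  norm_mul_le x y := by
    refine le_of_forall_pos_le_add fun ε hε => ?_
    have hc : Filter.Tendsto (fun δ : ℝ => (‖x‖ + δ) * (‖y‖ + δ)) (nhdsWithin 0 (Set.Ioi 0))
        (nhds (‖x‖ * ‖y‖)) := by
      have : Continuous (fun δ : ℝ => (‖x‖ + δ) * (‖y‖ + δ)) := by fun_prop
      simpa using (this.tendsto 0).mono_left nhdsWithin_le_nhds
    obtain ⟨δ, h1, h2⟩ := ((hc.eventually (gt_mem_nhds (show ‖x‖ * ‖y‖ < ‖x‖ * ‖y‖ + ε by
      linarith))).and self_mem_nhdsWithin).exists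
    obtain ⟨a, rfl, ha⟩ := norm_mk_lt I x h2
    obtain ⟨b, rfl, hb⟩ := norm_mk_lt I y h2
    refine le_trans ?_ h1.le
    rw [← map_mul]
    exact (norm_mk_le I _).trans ((norm_mul_le a b).trans
      (mul_le_mul ha.le hb.le (norm_nonneg _) ((norm_nonneg _).trans ha.le)))

theorem exists_approx (k : A) (hk : k ∈ I) {δ : ℝ} (hδ : 0 < δ) :
    ∃ e ∈ I, star e = e ∧ ‖1 - e‖ ≤ 1 ∧ ‖k * (1 - e)‖ < δ := by
  let : PartialOrder A := CStarAlgebra.spectralOrder A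
  have : StarOrderedRing A := CStarAlgebra.spectralOrderedRing A
  let J : NonUnitalStarSubalgebra ℂ A :=
    { carrier := I
      add_mem' := I.add_mem
      zero_mem' := I.zero_mem
      mul_mem' := fun {a b} _ hb => I.mul_mem_left a hb
      smul_mem' := fun c x hx => by
        have h := I.mul_mem_left (algebraMap ℂ A c) hx
        rwa [← Algebra.smul_def] at h
      star_mem' := fun {a} ha => hI.star_mem a ha }
  have : IsClosed (J : Set A) := hI.closed
  let : PartialOrder J := CStarAlgebra.spectralOrder J
  have : StarOrderedRing J := CStarAlgebra.spectralOrderedRing J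
  have hl := CStarAlgebra.increasingApproximateUnit J
  have ht := hl.tendsto_mul_left ⟨k, hk⟩
  have ht' := (Metric.tendsto_nhds.1 ht) δ hδ
  obtain ⟨e, ⟨⟨h0, h1⟩, h2⟩⟩ :=
    ((hl.eventually_nonneg.and hl.eventually_norm).and ht').exists
  obtain ⟨s, hs⟩ := CStarAlgebra.nonneg_iff_eq_star_mul_self.1 h0
  have he0 : (0 : A) ≤ (e : A) := by
    rw [show (e : A) = star (s : A) * (s : A) by
      rw [hs]; rfl]
    exact star_mul_self_nonneg _
  have he1 : (e : A) ≤ 1 := (CStarAlgebra.norm_le_one_iff_of_nonneg (e : A)).1 h1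
  refine ⟨e, e.2, (IsSelfAdjoint.of_nonneg he0).star_eq, ?_, ?_⟩
  · rw [CStarAlgebra.norm_le_one_iff_of_nonneg (1 - (e : A)) (sub_nonneg.2 he1)]
    simpa using he0
  · rw [dist_eq_norm] at h2
    rw [mul_sub, mul_one, norm_sub_rev]
    exact h2

/-- The quotient of a C⋆-algebra by a closed two-sided ideal is a C⋆-algebra, with the quotient
norm and the induced involution. -/
def quotCStarAlgebra : CStarAlgebra (A ⧸ I) where
  toStarRing := instStarRingQuot I
  toCompleteSpace := Submodule.Quotient.completeSpace I
  norm_mul_self_le x := by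
    obtain ⟨a, rfl⟩ := Ideal.Quotient.mk_surjective x
    refine le_of_forall_pos_le_add fun ε hε => ?_
    obtain ⟨b, hb, hb'⟩ := norm_mk_lt I (star (Ideal.Quotient.mk I a) * Ideal.Quotient.mk I a)
      (half_pos hε)
    have hk : star a * a - b ∈ I := by
      rw [← Ideal.Quotient.eq, map_mul, hb]; rfl
    obtain ⟨e, heI, hes, he1, hek⟩ := exists_approx I _ hk (half_pos hε)
    have h1 : ‖Ideal.Quotient.mk I a‖ ≤ ‖a * (1 - e)‖ := by
      refine le_trans (le_of_eq ?_) (norm_mk_le I (a * (1 - e)))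
      congr 1
      rw [Ideal.Quotient.eq, mul_sub, mul_one, sub_sub_cancel]
      exact I.mul_mem_left _ heI
    have h2 : ‖a * (1 - e)‖ * ‖a * (1 - e)‖ ≤ ‖star a * a * (1 - e)‖ := by
      rw [← CStarRing.norm_star_mul_self, star_mul, star_sub, star_one, hes]
      calc _ = ‖(1 - e) * (star a * a * (1 - e))‖ := by simp only [mul_assoc]
        _ ≤ ‖1 - e‖ * ‖star a * a * (1 - e)‖ := norm_mul_le _ _
        _ ≤ 1 * ‖star a * a * (1 - e)‖ := by gcongr
        _ = _ := one_mul _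
    have h3 : ‖star a * a * (1 - e)‖ ≤ ‖b‖ + ε / 2 := by
      calc _ = ‖b * (1 - e) + (star a * a - b) * (1 - e)‖ := by
            rw [← add_mul, add_sub_cancel]
        _ ≤ ‖b * (1 - e)‖ + ‖(star a * a - b) * (1 - e)‖ := norm_add_le _ _
        _ ≤ ‖b‖ * 1 + ε / 2 := by
            gcongr
            exact (norm_mul_le _ _).trans (by gcongr)
        _ = _ := by rw [mul_one]
    have h4 := mul_self_le_mul_self (norm_nonneg _) h1
    linarith
  toNormedAlgebra :=
    { __ := Ideal.Quotient.algebra ℂ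
      norm_smul_le := fun c x => norm_smul_le c x }
  star_smul c x := by
    obtain ⟨a, rfl⟩ := Ideal.Quotient.mk_surjective x
    change Ideal.Quotient.mk I (star (c • a)) = star c • Ideal.Quotient.mk I (star a)
    rw [star_smul]; rfl

end IsCStarIdeal

/-! ### Hilbert modules over `c(V)` -/

/-- `ℓ²(I)`. Given a map `σ : I → V` to a finite set, this is the Hilbert module over
`A = c(V)` with basis `(δ_i)`, where `δ_i · a = a (σ i) δ_i`. -/
abbrev Ell2 (I : Type*) : Type _ := lp (fun _ : I => ℂ) 2

namespace Ell2

variable {I J V : Type*}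

theorem sum_sq_le (x : Ell2 I) (t : Finset I) : ∑ i ∈ t, ‖x i‖ ^ 2 ≤ ‖x‖ ^ 2 := by
  have h := lp.sum_rpow_le_norm_rpow (p := 2) (by norm_num) x t
  simpa using h

/-- A linear map into functions which is bounded in the `ℓ²`-sense, as a bounded operator. -/
def mkOp (T : Ell2 I →ₗ[ℂ] (J → ℂ)) (C : ℝ) (hC : 0 ≤ C)
    (h : ∀ x (t : Finset J), ∑ j ∈ t, ‖T x j‖ ^ 2 ≤ (C * ‖x‖) ^ 2) : Ell2 I →L[ℂ] Ell2 J :=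
  LinearMap.mkContinuous
    { toFun := fun x => ⟨T x, memℓp_gen' (C := (C * ‖x‖) ^ 2) (by simpa using h x)⟩
      map_add' := fun x y => by ext j; exact congrFun (map_add T x y) j
      map_smul' := fun c x => by ext j; exact congrFun (map_smul T c x) j } C
    (fun x => lp.norm_le_of_forall_sum_le (by norm_num) (by positivity) (by simpa using h x))

@[simp] theorem mkOp_apply (T : Ell2 I →ₗ[ℂ] (J → ℂ)) (C : ℝ) (hC : 0 ≤ C)
    (h : ∀ x (t : Finset J), ∑ j ∈ t, ‖T x j‖ ^ 2 ≤ (C * ‖x‖) ^ 2) (x : Ell2 I) (j : J) :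
    mkOp T C hC h x j = T x j := rfl

/-- The diagonal operator `δ_i ↦ f i • δ_i` for a bounded function `f`. -/
def diagOp (f : I → ℂ) (hf : ∃ C, ∀ i, ‖f i‖ ≤ C) : Ell2 I →L[ℂ] Ell2 I :=
  mkOp { toFun := fun x i => f i * x i
         map_add' := fun x y => by ext i; simp [mul_add]
         map_smul' := fun c x => by ext i; simp [mul_left_comm] }
    (max hf.choose 0) (le_max_right _ _) (by
      intro x t
      have hf' : ∀ i, ‖f i‖ ≤ max hf.choose 0 := fun i => (hf.choose_spec i).trans (le_max_left _ _)
      calc ∑ i ∈ t, ‖f i * x i‖ ^ 2 ≤ ∑ i ∈ t, (max hf.choose 0) ^ 2 * ‖x i‖ ^ 2 := by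
            refine Finset.sum_le_sum fun i _ => ?_
            rw [norm_mul, mul_pow]
            gcongr
            exact hf' i
        _ = (max hf.choose 0) ^ 2 * ∑ i ∈ t, ‖x i‖ ^ 2 := by rw [Finset.mul_sum]
        _ ≤ _ := by
            rw [mul_pow]
            gcongr
            exact sum_sq_le x t)

@[simp] theorem diagOp_apply (f : I → ℂ) (hf : ∃ C, ∀ i, ‖f i‖ ≤ C) (x : Ell2 I) (i : I) :
    diagOp f hf x i = f i * x i := rfl

theorem exists_bound [Finite V] (a : V → ℂ) (f : I → V) : ∃ C, ∀ i, ‖a (f i)‖ ≤ C := by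
  cases nonempty_fintype V
  exact ⟨∑ v, ‖a v‖, fun i =>
    Finset.single_le_sum (f := fun v => ‖a v‖) (fun _ _ => norm_nonneg _) (Finset.mem_univ (f i))⟩

open Classical in
/-- For a relation `R` that is the graph of an injective partial map `I ⇀ J`, the operator
`δ_i ↦ δ_j` if `R i j`, and `δ_i ↦ 0` if there is no such `j`. -/
def partialOp (R : I → J → Prop) (_h₁ : ∀ i i' j, R i j → R i' j → i = i')
    (h₂ : ∀ i j j', R i j → R i j' → j = j') : Ell2 I →L[ℂ] Ell2 J :=
  mkOp { toFun := fun x j => if h : ∃ i, R i j then x h.choose else 0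
         map_add' := fun x y => by
          ext j
          by_cases h : ∃ i, R i j <;> simp [h]
         map_smul' := fun c x => by
          ext j
          by_cases h : ∃ i, R i j <;> simp [h] }
    1 zero_le_one (by
      intro x t
      simp only [LinearMap.coe_mk, AddHom.coe_mk, one_mul]
      let t' := t.filter (fun j => ∃ i, R i j)
      have e1 : ∑ j ∈ t, ‖(if h : ∃ i, R i j then x h.choose else 0 : ℂ)‖ ^ 2 =
          ∑ j ∈ t'.attach, ‖x (Finset.mem_filter.1 j.2).2.choose‖ ^ 2 := by
        rw [← Finset.sum_filter_of_ne (p := fun j => ∃ i, R i j), ← Finset.sum_attach]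
        · refine Finset.sum_congr rfl fun j _ => ?_
          rw [dif_pos (Finset.mem_filter.1 j.2).2]
        · intro j _ hj
          by_contra h
          simp [h] at hj
      rw [e1, ← Finset.sum_image (s := t'.attach) (f := fun i => ‖x i‖ ^ 2)
        (g := fun j => (Finset.mem_filter.1 j.2).2.choose)]
      · exact sum_sq_le x _
      · intro j _ j' _ hjj
        have a1 := (Finset.mem_filter.1 j.2).2.choose_spec
        have a2 := (Finset.mem_filter.1 j'.2).2.choose_spec
        simp only at hjj
        rw [hjj] at a1
        exact Subtype.ext (h₂ _ _ _ a1 a2))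

theorem partialOp_apply (R : I → J → Prop) (h₁ : ∀ i i' j, R i j → R i' j → i = i')
    (h₂ : ∀ i j j', R i j → R i j' → j = j') (x : Ell2 I) {i : I} {j : J} (h : R i j) :
    partialOp R h₁ h₂ x j = x i := by
  have h' : ∃ i, R i j := ⟨i, h⟩
  have : partialOp R h₁ h₂ x j = x h'.choose := dif_pos h'
  rw [this, h₁ _ _ _ h'.choose_spec h]

theorem partialOp_apply_of_not (R : I → J → Prop) (h₁ : ∀ i i' j, R i j → R i' j → i = i')
    (h₂ : ∀ i j j', R i j → R i j' → j = j') (x : Ell2 I) {j : J} (h : ∀ i, ¬ R i j) :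
    partialOp R h₁ h₂ x j = 0 :=
  dif_neg (by simpa using h)

/-- The `c(V)`-valued inner product `⟨x, y⟩(v) = ∑_{σ i = v} conj (x i) * y i`. -/
def ainner (σ : I → V) (x y : Ell2 I) : V → ℂ :=
  fun v => ∑' i : {i // σ i = v}, (starRingEnd ℂ) (x i.1) * y i.1

/-- The right action `(x · a) i = x i * a (σ i)` of `a ∈ c(V)`. -/
def rightAct [Finite V] (σ : I → V) (a : V → ℂ) : Ell2 I →L[ℂ] Ell2 I :=
  diagOp (fun i => a (σ i)) (exists_bound a σ)

/-- `T` is an adjointable operator on the Hilbert `c(V)`-module `ℓ²(I)`. -/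
def IsAdjointable (σ : I → V) (T : Ell2 I →L[ℂ] Ell2 I) : Prop :=
  ∃ T' : Ell2 I → Ell2 I, ∀ x y, ainner σ (T x) y = ainner σ x (T' y)

open Classical in
/-- The right action of the indicator function of `v`. -/
def fiberProj [Finite V] (σ : I → V) (v : V) : Ell2 I →L[ℂ] Ell2 I :=
  rightAct σ (Pi.single v 1)

section
variable [Finite V] (σ : I → V)

open Classical in
theorem fiberProj_apply (v : V) (x : Ell2 I) (i : I) :
    fiberProj σ v x i = if σ i = v then x i else 0 := by
  simp [fiberProj, rightAct, Pi.single_apply]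

theorem inner_fiberProj (v : V) (x y : Ell2 I) :
    inner ℂ x (fiberProj σ v y) = ainner σ x y v := by
  classical
  rw [lp.inner_eq_tsum, ainner]
  refine Eq.trans ?_ (tsum_subtype ({i | σ i = v} : Set I)
    (fun i => (starRingEnd ℂ) (x i) * y i)).symm
  refine tsum_congr fun i => ?_
  by_cases h : σ i = v <;> simp [fiberProj_apply, Set.indicator, h, mul_comm]

theorem fiberProj_adjoint (v : V) : star (fiberProj σ v) = fiberProj σ v := by
  rw [ContinuousLinearMap.star_eq_adjoint]
  symm
  rw [ContinuousLinearMap.eq_adjoint_iff]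
  intro x y
  classical
  rw [lp.inner_eq_tsum, lp.inner_eq_tsum]
  refine tsum_congr fun i => ?_
  by_cases h : σ i = v <;> simp [fiberProj_apply, h]

theorem sum_fiberProj [Fintype V] (x : Ell2 I) : ∑ v, fiberProj σ v x = x := by
  classical
  ext i
  rw [lp.coeFn_sum, Finset.sum_apply]
  simp [fiberProj_apply]

/-- Adjointable operators are those commuting with the right action. -/
theorem isAdjointable_iff (T : Ell2 I →L[ℂ] Ell2 I) :
    IsAdjointable σ T ↔ ∀ v, fiberProj σ v * T = T * fiberProj σ v := by
  cases nonempty_fintype V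
  constructor
  · rintro ⟨T', h⟩ v
    have hT' : ∀ y, T' y = star T y := by
      intro y
      refine ext_inner_left ℂ fun x => ?_
      rw [ContinuousLinearMap.star_eq_adjoint, ContinuousLinearMap.adjoint_inner_right]
      rw [← sum_fiberProj σ (T' y), inner_sum]
      conv_rhs => rw [← sum_fiberProj σ y, inner_sum]
      refine Finset.sum_congr rfl fun v _ => ?_
      rw [inner_fiberProj, inner_fiberProj, h]
    have h2 : star T * fiberProj σ v = fiberProj σ v * star T := by
      refine ContinuousLinearMap.ext fun y => ext_inner_left ℂ fun x => ?_
      simp only [mul_apply_eq_comp]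
      rw [inner_fiberProj, ← hT' y, ← h, ContinuousLinearMap.star_eq_adjoint,
        ContinuousLinearMap.adjoint_inner_right, inner_fiberProj]
    have h3 := congrArg star h2
    rwa [star_mul, star_mul, star_star, fiberProj_adjoint] at h3
  · intro h
    refine ⟨fun y => (star T : Ell2 I →L[ℂ] Ell2 I) y, fun x y => funext fun v => ?_⟩
    have h2 : star T * fiberProj σ v = fiberProj σ v * star T := by
      have := congrArg star (h v)
      rwa [star_mul, star_mul, fiberProj_adjoint] at this
    rw [← inner_fiberProj, ← inner_fiberProj, ← ContinuousLinearMap.adjoint_inner_right,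
      ← ContinuousLinearMap.star_eq_adjoint]
    exact congrArg (inner ℂ x) (congrArg (fun S => S y) h2)

/-- The C⋆-algebra `ℒ(ℓ²(I))` of adjointable operators. The adjoint of an adjointable operator is
its Hilbert space adjoint and its norm on the Hilbert module is its Hilbert space operator norm. -/
def adjointables : StarSubalgebra ℂ (Ell2 I →L[ℂ] Ell2 I) where
  carrier := {T | IsAdjointable σ T}
  mul_mem' {S T} hS hT := by
    simp only [Set.mem_ofPred_eq, isAdjointable_iff] at *
    intro v
    rw [← mul_assoc, hS, mul_assoc, hT, mul_assoc]
  add_mem' {S T} hS hT := by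
    simp only [Set.mem_ofPred_eq, isAdjointable_iff] at *
    intro v
    rw [mul_add, add_mul, hS, hT]
  algebraMap_mem' c := by
    simp only [Set.mem_ofPred_eq, isAdjointable_iff]
    intro v
    exact (Algebra.commutes c _).symm
  star_mem' {T} hT := by
    simp only [Set.mem_ofPred_eq, isAdjointable_iff] at *
    intro v
    have := congrArg star (hT v)
    rw [star_mul, star_mul, fiberProj_adjoint] at this
    exact this.symm

theorem mem_adjointables (T : Ell2 I →L[ℂ] Ell2 I) :
    T ∈ adjointables σ ↔ IsAdjointable σ T := Iff.rfl

instance : IsClosed (adjointables σ : Set (Ell2 I →L[ℂ] Ell2 I)) := by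
  have : (adjointables σ : Set (Ell2 I →L[ℂ] Ell2 I)) =
      ⋂ v, {T | fiberProj σ v * T = T * fiberProj σ v} := by
    ext T
    simp only [SetLike.mem_coe, mem_adjointables, isAdjointable_iff, Set.mem_iInter,
      Set.mem_ofPred_eq]
  rw [this]
  exact isClosed_iInter fun v => isClosed_eq (by fun_prop) (by fun_prop)

theorem diagOp_mem (f : I → ℂ) (hf : ∃ C, ∀ i, ‖f i‖ ≤ C) : diagOp f hf ∈ adjointables σ := by
  rw [mem_adjointables, isAdjointable_iff]
  intro v
  ext x i
  by_cases h : σ i = v <;> simp [fiberProj_apply, h]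

end

section
variable [Fintype V] (σ : I → V)

/-- The operator `θ_{x,y} z = x · ⟨y, z⟩`, see `theta_apply`. -/
def thetaOp (x y : Ell2 I) : Ell2 I →L[ℂ] Ell2 I :=
  ∑ v, (innerSL ℂ (fiberProj σ v y)).smulRight (fiberProj σ v x)

theorem fiberProj_inner (v : V) (x y : Ell2 I) :
    inner ℂ (fiberProj σ v x) y = ainner σ x y v := by
  rw [← inner_fiberProj, ← ContinuousLinearMap.adjoint_inner_right,
    ← ContinuousLinearMap.star_eq_adjoint, fiberProj_adjoint]

theorem thetaOp_apply (x y z : Ell2 I) : thetaOp σ x y z = rightAct σ (ainner σ y z) x := by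
  classical
  ext i
  simp only [thetaOp, sum_apply, ContinuousLinearMap.smulRight_apply,
    innerSL_apply_apply, fiberProj_inner, rightAct, diagOp_apply]
  rw [lp.coeFn_sum, Finset.sum_apply]
  simp [fiberProj_apply]

theorem mul_thetaOp (T : Ell2 I →L[ℂ] Ell2 I) (hT : T ∈ adjointables σ) (x y : Ell2 I) :
    T * thetaOp σ x y = thetaOp σ (T x) y := by
  rw [mem_adjointables, isAdjointable_iff] at hT
  ext1 z
  simp only [thetaOp, mul_apply_eq_comp, sum_apply,
    ContinuousLinearMap.smulRight_apply, map_sum, map_smul]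
  refine Finset.sum_congr rfl fun v _ => ?_
  congr 1
  exact congrArg (fun S => S x) (hT v).symm

theorem star_thetaOp (x y : Ell2 I) : star (thetaOp σ x y) = thetaOp σ y x := by
  rw [ContinuousLinearMap.star_eq_adjoint]
  symm
  rw [ContinuousLinearMap.eq_adjoint_iff]
  intro a b
  simp only [thetaOp, sum_apply, ContinuousLinearMap.smulRight_apply,
    innerSL_apply_apply, sum_inner, inner_sum, inner_smul_left, inner_smul_right, inner_conj_symm]
  exact Finset.sum_congr rfl fun v _ => mul_comm _ _

theorem thetaOp_mem (x y : Ell2 I) : thetaOp σ x y ∈ adjointables σ := by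
  rw [mem_adjointables]
  refine ⟨thetaOp σ y x, fun a b => funext fun v => ?_⟩
  rw [← inner_fiberProj, ← fiberProj_inner]
  have e1 : ∀ x y z, fiberProj σ v (thetaOp σ x y z) =
      (inner ℂ (fiberProj σ v y) z : ℂ) • fiberProj σ v x := by
    intro x y z
    ext i
    simp only [thetaOp_apply, fiberProj_apply, rightAct, diagOp_apply, lp.coeFn_smul,
      Pi.smul_apply, smul_eq_mul, fiberProj_inner]
    by_cases h : σ i = v <;> simp [h]
  have e2 : inner ℂ (thetaOp σ x y a) (fiberProj σ v b) =
      inner ℂ (fiberProj σ v (thetaOp σ x y a)) b := by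
    rw [fiberProj_inner, inner_fiberProj]
  have e3 : inner ℂ (fiberProj σ v a) (thetaOp σ y x b) =
      inner ℂ a (fiberProj σ v (thetaOp σ y x b)) := by
    rw [fiberProj_inner, inner_fiberProj]
  rw [e2, e3, e1, e1, inner_smul_left, inner_smul_right, inner_conj_symm, mul_comm]

/-- `θ_{x,y}` as an element of `ℒ(ℓ²(I))`. -/
def theta (x y : Ell2 I) : adjointables σ := ⟨thetaOp σ x y, thetaOp_mem σ x y⟩

/-- The closed linear span of the operators `θ_{x,y}`. -/
def compactSpan : Submodule ℂ (adjointables σ) :=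
  (Submodule.span ℂ {T | ∃ x y, T = theta σ x y}).topologicalClosure

theorem mul_mem_compactSpan (S T : adjointables σ) (hT : T ∈ compactSpan σ) :
    S * T ∈ compactSpan σ := by
  have h : Submodule.span ℂ {T | ∃ x y, T = theta σ x y} ≤
      (compactSpan σ).comap (LinearMap.mulLeft ℂ S) := by
    rw [Submodule.span_le]
    rintro _ ⟨x, y, rfl⟩
    refine Submodule.le_topologicalClosure _ (Submodule.subset_span ⟨S.1 x, y, ?_⟩)
    exact Subtype.ext (mul_thetaOp σ S.1 S.2 x y)
  refine (Submodule.topologicalClosure_minimal _ h ?_) hT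
  exact IsClosed.preimage (f := fun T => S * T) (by fun_prop)
    (Submodule.isClosed_topologicalClosure _)

theorem star_mem_compactSpan (T : adjointables σ) (hT : T ∈ compactSpan σ) :
    star T ∈ compactSpan σ := by
  have hs : ∀ T ∈ Submodule.span ℂ {T | ∃ x y, T = theta σ x y}, star T ∈ compactSpan σ := by
    intro T hT
    induction hT using Submodule.span_induction with
    | mem T h =>
      obtain ⟨x, y, rfl⟩ := h
      exact Submodule.le_topologicalClosure _ (Submodule.subset_span
        ⟨y, x, Subtype.ext (star_thetaOp σ x y)⟩)
    | zero => rw [star_zero]; exact Submodule.zero_mem _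
    | add S T _ _ hS hT => rw [star_add]; exact Submodule.add_mem _ hS hT
    | smul c T _ hT => rw [star_smul]; exact Submodule.smul_mem _ _ hT
  have hcl : IsClosed {T : adjointables σ | star T ∈ compactSpan σ} :=
    IsClosed.preimage continuous_star (Submodule.isClosed_topologicalClosure _)
  exact closure_minimal (t := {T : adjointables σ | star T ∈ compactSpan σ}) hs hcl hT

/-- The ideal `𝒦(ℓ²(I))` of generalized compact operators in `ℒ(ℓ²(I))`: the closed linear span of
the operators `θ_{x,y}`. -/
def compacts : Ideal (adjointables σ) where
  carrier := compactSpan σ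
  add_mem' := (compactSpan σ).add_mem
  zero_mem' := (compactSpan σ).zero_mem
  smul_mem' := mul_mem_compactSpan σ

instance : IsCStarIdeal (compacts σ) where
  twoSided := ⟨fun {a} b ha => by
    have h := star_mem_compactSpan σ _
      (mul_mem_compactSpan σ (star b) _ (star_mem_compactSpan σ a ha))
    rwa [star_mul, star_star, star_star] at h⟩
  closed := Submodule.isClosed_topologicalClosure _
  star_mem := star_mem_compactSpan σ

end

end Ell2

/-! ### Directed graphs, paths and the Fock correspondence -/

/-- A directed graph with vertex set `V`, edge set `E`, source map `s` and range map `r`. -/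
structure DirGraph (V E : Type*) where
  s : E → V
  r : E → V

namespace DirGraph

open Ell2

variable {V E : Type*} (G : DirGraph V E)

/-- The range of `e₁ ⋯ e_k`: it is `r e₁` if `k ≥ 1`, and the vertex `v` if `k = 0`. -/
def rangeOf (v : V) : List E → V
  | [] => v
  | e :: _ => G.r e

/-- `e₁ ⋯ e_k` satisfies `s e_j = r e_{j+1}` for `j < k` and `s e_k = v`. -/
def IsPath (v : V) : List E → Prop
  | [] => True
  | e :: l => G.s e = G.rangeOf v l ∧ IsPath v l

/-- A path `e₁ ⋯ e_k` of length `k ≥ 0` together with its source; paths of length `0` are the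
vertices. -/
@[ext]
structure Path where
  edges : List E
  src : V
  isPath : G.IsPath src edges

namespace Path
variable {G}

/-- The length `|α|`. -/
def len (α : G.Path) : ℕ := α.edges.length

/-- The range `r(α)`. -/
def rng (α : G.Path) : V := G.rangeOf α.src α.edges

end Path

/-- The set `E^k` of paths of length `k`. -/
abbrev PathN (k : ℕ) : Type _ := {α : G.Path // α.len = k}

instance [Finite V] [Finite E] (k : ℕ) : Finite (G.PathN k) := by
  cases nonempty_fintype E
  let f : G.PathN k → List.Vector E k × V := fun α => (⟨α.1.edges, α.2⟩, α.1.src)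
  refine Finite.of_injective f ?_
  intro α β h
  have h1 := congrArg Prod.fst h
  have h2 := congrArg Prod.snd h
  exact Subtype.ext (Path.ext (congrArg Subtype.val h1) h2)

instance [Finite V] [Finite E] (k : ℕ) : Fintype (G.PathN k) := Fintype.ofFinite _

instance : DecidableEq G.Path := Classical.decEq _

/-- The source map on `E^k`. -/
def srcN (k : ℕ) (α : G.PathN k) : V := α.1.src

/-- The left action `φ(a) δ_α = a (r α) δ_α` of `a ∈ c(E⁰)` on `X_E^{⊗ k} = ℓ²(E^k)`. -/
def leftN [Finite V] (k : ℕ) (a : V → ℂ) : Ell2 (G.PathN k) →L[ℂ] Ell2 (G.PathN k) :=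
  diagOp (fun α => a α.1.rng) (exists_bound a _)

/-- For `|β| = p`, the map `x ↦ δ_β ⊗ x` from `X_E^{⊗ k}` to `X_E^{⊗ (k + p)}`; it maps `δ_γ` to
`δ_{βγ}` if `r γ = s β`, and to `0` otherwise. -/
def tensorLeft (p k : ℕ) (β : G.PathN p) : Ell2 (G.PathN k) →L[ℂ] Ell2 (G.PathN (k + p)) :=
  partialOp (fun γ α => γ.1.rng = β.1.src ∧ α.1.edges = β.1.edges ++ γ.1.edges ∧
      α.1.src = γ.1.src)
    (fun _ _ _ h h' => Subtype.ext (Path.ext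
      (List.append_cancel_left (h.2.1.symm.trans h'.2.1)) (h.2.2.symm.trans h'.2.2)))
    (fun _ _ _ h h' => Subtype.ext (Path.ext
      (h.2.1.trans h'.2.1.symm) (h.2.2.trans h'.2.2.symm)))

/-- `I_p ⊗ T` on `X_E^{⊗ (k + p)}`, which maps `δ_{βγ}` with `|β| = p` and `|γ| = k` to
`δ_β ⊗ T δ_γ`. -/
def tensorId [Finite V] [Finite E] (p k : ℕ) (T : Ell2 (G.PathN k) →L[ℂ] Ell2 (G.PathN k)) :
    Ell2 (G.PathN (k + p)) →L[ℂ] Ell2 (G.PathN (k + p)) :=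
  ∑ β : G.PathN p, G.tensorLeft p k β ∘L T ∘L ContinuousLinearMap.adjoint (G.tensorLeft p k β)

/-- A weight sequence: uniformly bounded, positive, invertible adjointable operators `Z_k` on
`X_E^{⊗ k}` which commute with the left action, with `Z_0 = I` and `Z_k ≥ ε I` for all `k ≥ 1`, for
some `ε > 0`. -/
structure WeightSeq [Finite V] where
  Z : ∀ k, Ell2 (G.PathN k) →L[ℂ] Ell2 (G.PathN k)
  adjointable : ∀ k, IsAdjointable (G.srcN k) (Z k)
  comm_left : ∀ k a, Z k * G.leftN k a = G.leftN k a * Z k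
  zero_eq : Z 0 = 1
  bounded : ∃ C : ℝ, ∀ k, ‖Z k‖ ≤ C
  pos : ∀ k, (Z k).IsPositive
  isUnit : ∀ k, IsUnit (Z k)
  lower : ∃ ε : ℝ, 0 < ε ∧ ∀ k, 1 ≤ k → (Z k - (ε : ℂ) • 1).IsPositive

/-- The condition `‖I_p ⊗ Z_k - Z_{k+p}‖ → 0`. -/
def ConditionA [Finite V] [Finite E] (Z : G.WeightSeq) (p : ℕ) : Prop :=
  Filter.Tendsto (fun k => ‖G.tensorId p k (Z.Z k) - Z.Z (k + p)‖) Filter.atTop (nhds 0)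

/-! Operators on the Fock correspondence `ℱ(X_E) = ⨁_k X_E^{⊗ k}`, which is `ℓ²` of the set of all
paths, the right action of `c(E⁰)` being `δ_α · a = a (s α) δ_α`. -/

/-- The component of `x ∈ ℱ(X_E)` in `X_E^{⊗ k}`. -/
def component (k : ℕ) : Ell2 G.Path →L[ℂ] Ell2 (G.PathN k) :=
  partialOp (fun α β => β.1 = α) (fun _ _ _ h h' => h.symm.trans h')
    (fun _ _ _ h h' => Subtype.ext (h.trans h'.symm))

theorem component_apply (k : ℕ) (x : Ell2 G.Path) (α : G.PathN k) :
    G.component k x α = x α.1 := partialOp_apply _ _ _ _ rfl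

section Fock
variable [Fintype V]

/-- `ℒ(ℱ(X_E))`. -/
abbrev L : StarSubalgebra ℂ (Ell2 G.Path →L[ℂ] Ell2 G.Path) := adjointables (Path.src (G := G))

/-- The creation operator `S_e δ_β = δ_{eβ}`, where `δ_{eβ} = 0` unless `s e = r β`. -/
def creationOp (e : E) : Ell2 G.Path →L[ℂ] Ell2 G.Path :=
  partialOp (fun β α => α.edges = e :: β.edges ∧ α.src = β.src)
    (fun _ _ _ h h' => Path.ext (List.cons.inj (h.1.symm.trans h'.1)).2 (h.2.symm.trans h'.2))
    (fun _ _ _ h h' => Path.ext (h.1.trans h'.1.symm) (h.2.trans h'.2.symm))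

theorem creationOp_mem (e : E) : G.creationOp e ∈ G.L := by
  rw [mem_adjointables, isAdjointable_iff]
  intro v
  ext x α
  simp only [mul_apply_eq_comp, fiberProj_apply]
  by_cases h : ∃ β : G.Path, α.edges = e :: β.edges ∧ α.src = β.src
  · obtain ⟨β, hβ⟩ := h
    have h1 : ∀ y : Ell2 G.Path, G.creationOp e y α = y β := fun y =>
      partialOp_apply (i := β) (j := α) _ _ _ y hβ
    rw [h1, h1, fiberProj_apply, hβ.2]
  · have h1 : ∀ y : Ell2 G.Path, G.creationOp e y α = 0 := fun y =>
      partialOp_apply_of_not (j := α) _ _ _ y (fun β hβ => h ⟨β, hβ⟩)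
    rw [h1, h1, ite_self]

/-- `S_e` in `ℒ(ℱ(X_E))`. -/
def S (e : E) : G.L := ⟨G.creationOp e, G.creationOp_mem e⟩

/-- The left action `φ_∞(a) δ_β = a (r β) δ_β`. -/
def phi (a : V → ℂ) : G.L :=
  ⟨diagOp (fun α : G.Path => a α.rng) (exists_bound a _), diagOp_mem _ _ _⟩

open Classical in
/-- `P_v = φ_∞(δ_v)`. -/
def P (v : V) : G.L := G.phi (Pi.single v 1)

/-- `S_α = S_{e₁} ⋯ S_{e_k}` for a path `α = e₁ ⋯ e_k`, and `S_v = P_v` for a vertex `v`. (The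
factor `P_{s(α)}` does not change the product if `k ≥ 1`.) -/
def Spath (α : G.Path) : G.L := (α.edges.map G.S).prod * G.P α.src

/-- The unitary `W_t = ∑_n e^{int} Q_n`, where `Q_n` is the projection onto `X_E^{⊗ n}`. -/
def gauge (t : ℝ) : G.L :=
  ⟨diagOp (fun α : G.Path => Complex.exp (Complex.I * α.len * t))
    ⟨1, fun α => by simp [Complex.norm_exp]⟩, diagOp_mem _ _ _⟩

theorem star_gauge_mul (t : ℝ) : star (G.gauge t) * G.gauge t = 1 := by
  have h : star (G.gauge t) = G.gauge (-t) := by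
    refine Subtype.ext ?_
    change star (G.gauge t).1 = (G.gauge (-t)).1
    rw [ContinuousLinearMap.star_eq_adjoint]
    symm
    rw [ContinuousLinearMap.eq_adjoint_iff]
    intro x y
    rw [lp.inner_eq_tsum, lp.inner_eq_tsum]
    refine tsum_congr fun α => ?_
    change inner ℂ (Complex.exp (Complex.I * α.len * ((-t : ℝ) : ℂ)) * x α) (y α) =
      inner ℂ (x α) (Complex.exp (Complex.I * α.len * (t : ℂ)) * y α)
    simp [← Complex.exp_conj]
    ring
  rw [h]
  refine Subtype.ext ?_
  ext x α
  change Complex.exp (Complex.I * α.len * ((-t : ℝ) : ℂ)) *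
    (Complex.exp (Complex.I * α.len * (t : ℂ)) * x α) = x α
  rw [← mul_assoc, ← Complex.exp_add]
  simp

variable [Fintype E]

theorem sum_component_le (x : Ell2 G.Path) (K : Finset ℕ) :
    ∑ k ∈ K, ‖G.component k x‖ ^ 2 ≤ ‖x‖ ^ 2 := by
  have h1 : ∀ k, ‖G.component k x‖ ^ 2 =
      ∑ α ∈ (Finset.univ : Finset (G.PathN k)).map (Function.Embedding.subtype _), ‖x α‖ ^ 2 := by
    intro k
    rw [Finset.sum_map]
    have := lp.norm_rpow_eq_tsum (p := 2) (by norm_num) (G.component k x)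
    simp only [ENNReal.toReal_ofNat, Real.rpow_ofNat, tsum_fintype, component_apply] at this
    exact this
  simp only [h1]
  rw [← Finset.sum_biUnion]
  · exact sum_sq_le x _
  · intro k _ l _ hkl
    refine Finset.disjoint_left.2 fun α h h' => hkl ?_
    obtain ⟨a, -, rfl⟩ := Finset.mem_map.1 h
    obtain ⟨b, -, hb⟩ := Finset.mem_map.1 h'
    rw [← a.2, ← b.2]
    exact congrArg Path.len hb.symm

/-- The diagonal operator `diag(Z_0, Z_1, …)` on `ℱ(X_E)`. -/
def weightOp (Z : G.WeightSeq) : Ell2 G.Path →L[ℂ] Ell2 G.Path :=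
  mkOp { toFun := fun x α => Z.Z α.len (G.component α.len x) ⟨α, rfl⟩
         map_add' := fun x y => by ext α; simp
         map_smul' := fun c x => by ext α; simp }
    (max Z.bounded.choose 0) (le_max_right _ _) (by
      intro x t
      set C := max Z.bounded.choose 0
      have hC : ∀ k, ‖Z.Z k‖ ≤ C := fun k => (Z.bounded.choose_spec k).trans (le_max_left _ _)
      have hC0 : 0 ≤ C := le_max_right _ _
      simp only [LinearMap.coe_mk, AddHom.coe_mk]
      rw [← Finset.sum_fiberwise_of_maps_to (t := t.image Path.len) (g := Path.len)
        (fun α h => Finset.mem_image_of_mem _ h)]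
      calc _ ≤ ∑ k ∈ t.image Path.len, C ^ 2 * ‖G.component k x‖ ^ 2 := by
            refine Finset.sum_le_sum fun k _ => ?_
            have e : ∑ α ∈ t.filter (fun α => α.len = k),
                ‖Z.Z α.len (G.component α.len x) ⟨α, rfl⟩‖ ^ 2 =
                ∑ α ∈ t.subtype (fun α => α.len = k), ‖Z.Z k (G.component k x) α‖ ^ 2 := by
              rw [← Finset.subtype_map, Finset.sum_map]
              refine Finset.sum_congr rfl fun α _ => ?_
              obtain ⟨α, rfl⟩ := α
              rfl
            rw [e, ← mul_pow]
            refine (sum_sq_le _ _).trans ?_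
            gcongr
            exact ContinuousLinearMap.le_of_opNorm_le _ (hC k) _
        _ = C ^ 2 * ∑ k ∈ t.image Path.len, ‖G.component k x‖ ^ 2 := by rw [Finset.mul_sum]
        _ ≤ _ := by
            rw [mul_pow]
            gcongr
            exact G.sum_component_le x _)

theorem weightOp_mem (Z : G.WeightSeq) : G.weightOp Z ∈ G.L := by
  rw [mem_adjointables, isAdjointable_iff]
  intro v
  ext x α
  have h := (isAdjointable_iff _ _).1 (Z.adjointable α.len) v
  have h1 : G.component α.len (fiberProj Path.src v x) =
      fiberProj (G.srcN α.len) v (G.component α.len x) := by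
    ext β
    simp only [component_apply, fiberProj_apply, srcN]
    congr
  have h2 := congrArg (fun T => T (G.component α.len x) ⟨α, rfl⟩) h
  simp only [mul_apply_eq_comp, fiberProj_apply, srcN] at h2
  simp only [mul_apply_eq_comp, fiberProj_apply]
  refine h2.trans ?_
  rw [← h1]
  rfl

/-- The weight operator `Z` in `ℒ(ℱ(X_E))`. -/
def weight (Z : G.WeightSeq) : G.L := ⟨G.weightOp Z, G.weightOp_mem Z⟩

/-- The weighted Toeplitz algebra: the C⋆-algebra generated by the weighted shifts
`W_e = Z S_e`. -/
def toeplitz (Z : G.WeightSeq) : NonUnitalStarSubalgebra ℂ G.L :=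
  (NonUnitalStarAlgebra.adjoin ℂ {T | ∃ e : E, T = G.weight Z * G.S e}).topologicalClosure

/-- The fixed point algebra `𝒟` of the gauge action `γ_t = Ad W_t` on the weighted Toeplitz
algebra. -/
def fixedAlg (Z : G.WeightSeq) : NonUnitalStarSubalgebra ℂ G.L where
  carrier := {T | T ∈ G.toeplitz Z ∧ ∀ t : ℝ, G.gauge t * T * star (G.gauge t) = T}
  add_mem' {a b} ha hb := ⟨add_mem ha.1 hb.1, fun t => by
    rw [mul_add, add_mul, ha.2, hb.2]⟩
  zero_mem' := ⟨zero_mem _, fun t => by simp⟩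
  mul_mem' {a b} ha hb := ⟨mul_mem ha.1 hb.1, fun t => by
    conv_rhs => rw [← ha.2 t, ← hb.2 t]
    have := G.star_gauge_mul t
    calc _ = G.gauge t * a * 1 * b * star (G.gauge t) := by simp only [mul_assoc, one_mul]
      _ = _ := by rw [← this]; simp only [mul_assoc]⟩
  smul_mem' c a ha := ⟨SMulMemClass.smul_mem c ha.1, fun t => by
    rw [mul_smul_comm, smul_mul_assoc, ha.2]⟩
  star_mem' {a} ha := ⟨star_mem ha.1, fun t => by
    conv_rhs => rw [← ha.2 t]
    simp only [star_mul, star_star, mul_assoc]⟩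

/-- The quotient C⋆-algebra `ℒ(ℱ(X_E)) / 𝒦(ℱ(X_E))`. -/
def Calkin : Type _ := G.L ⧸ compacts (Path.src (G := G))

instance : CStarAlgebra G.Calkin :=
  IsCStarIdeal.quotCStarAlgebra (compacts (Path.src (G := G)))

/-- The quotient map `q`. -/
def q : G.L →⋆ₐ[ℂ] G.Calkin where
  toFun T := Ideal.Quotient.mk (compacts (Path.src (G := G))) T
  map_one' := rfl
  map_mul' _ _ := rfl
  map_zero' := rfl
  map_add' _ _ := rfl
  commutes' _ := rfl
  map_star' _ := rfl

/-- `q(𝒟)`. -/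
def qD (Z : G.WeightSeq) : NonUnitalStarSubalgebra ℂ G.Calkin :=
  (G.fixedAlg Z).map G.q.toNonUnitalStarAlgHom

/-- `u_α = q(S_α)`. -/
def u (α : G.Path) : G.Calkin := G.q (G.Spath α)

/-- `z = q(Z)`. -/
def z (Z : G.WeightSeq) : G.Calkin := G.q (G.weight Z)

/-- `𝒞_n`, the C⋆-algebra generated by the elements `u_α z^l u_β^*` with `l ≥ 0`,
`np ≤ |α| = |β| < (n+1)p` and `s α = s β`. -/
def C (Z : G.WeightSeq) (p n : ℕ) : NonUnitalStarSubalgebra ℂ G.Calkin :=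
  (NonUnitalStarAlgebra.adjoin ℂ {x | ∃ (α β : G.Path) (l : ℕ), n * p ≤ α.len ∧ α.len = β.len ∧
    α.len < (n + 1) * p ∧ α.src = β.src ∧
    x = G.u α * G.z Z ^ l * star (G.u β)}).topologicalClosure

/-- A choice, for every vertex `v`, of a path `ξ_v` of length `p - 1` with source `v`
(where `p ≥ 1`). -/
structure PathChoice (G : DirGraph V E) (p : ℕ) where
  ξ : V → G.Path
  len_add_one : ∀ v, (ξ v).len + 1 = p
  src_eq : ∀ v, (ξ v).src = v

variable {G}

/-- `u_{ξ_v} u_{ξ_v}^* ∈ 𝒞_0`. -/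
theorem u_mul_star_mem (Z : G.WeightSeq) {p : ℕ} (ξ : PathChoice G p) (v : V) :
    G.u (ξ.ξ v) * star (G.u (ξ.ξ v)) ∈ G.C Z p 0 := by
  refine NonUnitalStarSubalgebra.le_topologicalClosure _
    (NonUnitalStarAlgebra.subset_adjoin ℂ _ ⟨ξ.ξ v, ξ.ξ v, 0, by simp, rfl, ?_, rfl, by simp⟩)
  have := ξ.len_add_one v
  omega

variable (G)

/-- `𝒞_v = u_{ξ_v} u_{ξ_v}^* 𝒞_0 u_{ξ_v} u_{ξ_v}^*`. -/
def Cv (Z : G.WeightSeq) {p : ℕ} (ξ : PathChoice G p) (v : V) :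
    NonUnitalStarSubalgebra ℂ G.Calkin where
  carrier := {x | ∃ c ∈ G.C Z p 0,
    x = G.u (ξ.ξ v) * star (G.u (ξ.ξ v)) * c * (G.u (ξ.ξ v) * star (G.u (ξ.ξ v)))}
  add_mem' := by
    rintro _ _ ⟨c, hc, rfl⟩ ⟨d, hd, rfl⟩
    exact ⟨c + d, add_mem hc hd, by rw [mul_add, add_mul]⟩
  zero_mem' := ⟨0, zero_mem _, by simp⟩
  mul_mem' := by
    rintro _ _ ⟨c, hc, rfl⟩ ⟨d, hd, rfl⟩
    have he := u_mul_star_mem Z ξ v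
    exact ⟨c * (G.u (ξ.ξ v) * star (G.u (ξ.ξ v))) * (G.u (ξ.ξ v) * star (G.u (ξ.ξ v))) * d,
      mul_mem (mul_mem (mul_mem hc he) he) hd, by simp only [mul_assoc]⟩
  smul_mem' := by
    rintro k _ ⟨c, hc, rfl⟩
    exact ⟨k • c, SMulMemClass.smul_mem k hc, by rw [mul_smul_comm, smul_mul_assoc]⟩
  star_mem' := by
    rintro _ ⟨c, hc, rfl⟩
    exact ⟨star c, star_mem hc, by simp only [star_mul, star_star, mul_assoc]⟩

/-- `Γ_n`, the set of paths of length `(n+1)p - 1`. -/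
abbrev Gam (p n : ℕ) : Type _ := G.PathN (n * p + (p - 1))

/-- `𝒜_n = ∑ e_{γ₁,γ₂} ⊗ 𝒞_{s(γ₁)}`, the sum over all `γ₁, γ₂ ∈ Γ_n` with `s γ₁ = s γ₂`: the
`Γ_n × Γ_n`-matrices whose entry at `(γ₁, γ₂)` lies in `𝒞_{s(γ₁)}` if `s γ₁ = s γ₂`, and is `0`
otherwise. -/
def A (Z : G.WeightSeq) {p : ℕ} (ξ : PathChoice G p) (n : ℕ) :
    NonUnitalStarSubalgebra ℂ (Matrix (G.Gam p n) (G.Gam p n) G.Calkin) where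
  carrier := {M | ∀ γ₁ γ₂ : G.Gam p n,
    (γ₁.1.src = γ₂.1.src → M γ₁ γ₂ ∈ G.Cv Z ξ γ₁.1.src) ∧
    (γ₁.1.src ≠ γ₂.1.src → M γ₁ γ₂ = 0)}
  add_mem' {M N} hM hN γ₁ γ₂ :=
    ⟨fun h => add_mem ((hM γ₁ γ₂).1 h) ((hN γ₁ γ₂).1 h),
      fun h => by rw [Matrix.add_apply, (hM γ₁ γ₂).2 h, (hN γ₁ γ₂).2 h, add_zero]⟩
  zero_mem' _ _ := ⟨fun _ => zero_mem _, fun _ => rfl⟩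
  mul_mem' {M N} hM hN γ₁ γ₂ := by
    rw [Matrix.mul_apply]
    refine ⟨fun h => sum_mem fun γ _ => ?_, fun h => Finset.sum_eq_zero fun γ _ => ?_⟩
    · by_cases h' : γ₁.1.src = γ.1.src
      · refine mul_mem ((hM γ₁ γ).1 h') ?_
        rw [h']
        exact (hN γ γ₂).1 (h'.symm.trans h)
      · rw [(hM γ₁ γ).2 h', zero_mul]
        exact zero_mem _
    · by_cases h' : γ₁.1.src = γ.1.src
      · rw [(hN γ γ₂).2 fun h'' => h (h'.trans h''), mul_zero]
      · rw [(hM γ₁ γ).2 h', zero_mul]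
  smul_mem' c M hM γ₁ γ₂ :=
    ⟨fun h => SMulMemClass.smul_mem c ((hM γ₁ γ₂).1 h),
      fun h => by rw [Matrix.smul_apply, (hM γ₁ γ₂).2 h, smul_zero]⟩
  star_mem' {M} hM γ₁ γ₂ := by
    rw [Matrix.star_apply]
    refine ⟨fun h => ?_, fun h => by rw [(hM γ₂ γ₁).2 (Ne.symm h), star_zero]⟩
    rw [h]
    exact star_mem ((hM γ₂ γ₁).1 h.symm)

/-- The matrix `e_{γ₁,γ₂} ⊗ b`. -/
abbrev unit {p n : ℕ} (γ₁ γ₂ : G.Gam p n) (b : G.Calkin) :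
    Matrix (G.Gam p n) (G.Gam p n) G.Calkin := Matrix.single γ₁ γ₂ b

theorem unit_mem (Z : G.WeightSeq) {p : ℕ} (ξ : PathChoice G p) (n : ℕ) (γ₁ γ₂ : G.Gam p n)
    (h : γ₁.1.src = γ₂.1.src) (b : G.Calkin) (hb : b ∈ G.Cv Z ξ γ₁.1.src) :
    G.unit γ₁ γ₂ b ∈ G.A Z ξ n := by
  intro δ₁ δ₂
  by_cases h' : γ₁ = δ₁ ∧ γ₂ = δ₂
  · obtain ⟨rfl, rfl⟩ := h'
    simp only [Matrix.single_apply_same]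
    exact ⟨fun _ => hb, fun h' => (h' h).elim⟩
  · rw [unit, Matrix.single_apply_of_ne _ _ _ _ _ h']
    exact ⟨fun _ => zero_mem _, fun _ => rfl⟩

open Classical in
/-- The formula for `τ_n`: the sum of `e_{γ₁,γ₂} ⊗ u_{ξ_{s(γ₁)}} u_{γ₁}^* c u_{γ₂} u_{ξ_{s(γ₁)}}^*`
over all `γ₁, γ₂ ∈ Γ_n` with `s γ₁ = s γ₂`. -/
def tauFormula {p : ℕ} (ξ : PathChoice G p) (n : ℕ) (c : G.Calkin) :
    Matrix (G.Gam p n) (G.Gam p n) G.Calkin :=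
  ∑ γ₁ : G.Gam p n, ∑ γ₂ : G.Gam p n,
    if γ₁.1.src = γ₂.1.src then
      G.unit γ₁ γ₂ (G.u (ξ.ξ γ₁.1.src) * star (G.u γ₁.1) * c * G.u γ₂.1 *
        star (G.u (ξ.ξ γ₁.1.src)))
    else 0

end Fock

end DirGraph

/-! ### Direct limits of C⋆-algebras -/

/-- `L` with the `⋆`-homomorphisms `μ n : A n → L` is the direct limit, in the category of
C⋆-algebras and `⋆`-homomorphisms, of the sequence `A 0 → A 1 → ⋯` with connecting maps `ψ n`: it is the universal
compatible family of `⋆`-homomorphisms into a C⋆-algebra. Only the `⋆`-algebra structures of `A n`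
and `L` enter, since `⋆`-homomorphisms of C⋆-algebras are automatically continuous. -/
structure IsCStarDirectLimit {A : ℕ → Type*} [∀ n, NonUnitalRing (A n)]
    [∀ n, StarRing (A n)] [∀ n, Module ℂ (A n)] {L : Type*} [NonUnitalRing L] [StarRing L]
    [Module ℂ L] (ψ : ∀ n, A n →⋆ₙₐ[ℂ] A (n + 1)) (μ : ∀ n, A n →⋆ₙₐ[ℂ] L) : Prop where
  compat : ∀ n a, μ (n + 1) (ψ n a) = μ n a
  universal : ∀ (B : Type w) [NonUnitalCStarAlgebra B] (φ : ∀ n, A n →⋆ₙₐ[ℂ] B),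
    (∀ n a, φ (n + 1) (ψ n a) = φ n a) → ∃! Φ : L →⋆ₙₐ[ℂ] B, ∀ n a, Φ (μ n a) = φ n a

end

noncomputable section

/-!
The projection onto the paths of length less than `k` is compact, so the `u_α` satisfy the
Cuntz–Krieger relations, and Condition A(p) says that `z` commutes with `u_β` whenever `|β| = p`.
Hence `z u_α = u_α z_m` for `|α| = m`, where `z_m` is a conditional shift of `z` that depends on `m`
only modulo `p`. Consequently `C_n` is the closed span of the elements `u_α b u_β*` with
`|α| = |β| = (n + 1) p - 1` and `b` in the algebra generated by the `z_m`; these multiply like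
matrices indexed by `Γ_n`, and compressing by the row of the `u_γ u_{ξ_{s(γ)}}*`, whose entries
satisfy `∑ r_γ r_γ* = 1`, is the isomorphism `τ_n`.

Averaging over the gauge action kills the parts of nonzero degree, so the union of the `C_n` is
dense in `q(D)`. Conversely, since every vertex emits an edge and `Z` is bounded below, the elements
`z u_e` determine the shifts of `z` by positive functional calculus; dividing by them puts all `u_α`
and `z` into `q(T)`, whence `C_n ⊆ q(D)`. A compatible family of `*`-homomorphisms on the `C_n` is
contractive and so extends from their union to its closure `q(D)`.
-/

/-! ### Spectral subspaces -/

section SpectralSubspace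
variable {B : Type*} [Ring B] [StarRing B] [Algebra ℂ B] {g : ℝ → B} {d e : ℤ} {x y : B}

/-- The spectral subspace of degree `d` of the action `x ↦ g_t x g_t*` of `ℝ`. -/
def spectralSubspace (g : ℝ → B) (d : ℤ) : Submodule ℂ B where
  carrier := {x | ∀ t : ℝ, g t * x * star (g t) = Complex.exp (Complex.I * d * t) • x}
  zero_mem' t := by rw [mul_zero, zero_mul, smul_zero]
  add_mem' hx hy t := by rw [mul_add, add_mul, hx, hy, smul_add]
  smul_mem' c x hx t := by rw [mul_smul_comm, smul_mul_assoc, hx, smul_comm]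

theorem mem_spectralSubspace_zero :
    x ∈ spectralSubspace g 0 ↔ ∀ t, g t * x * star (g t) = x := by
  refine forall_congr' fun t => ?_
  rw [Int.cast_zero, mul_zero, zero_mul, Complex.exp_zero, one_smul]

theorem mul_mem_spectralSubspace (hg : ∀ t, star (g t) * g t = 1) (hx : x ∈ spectralSubspace g d)
    (hy : y ∈ spectralSubspace g e) : x * y ∈ spectralSubspace g (d + e) := fun t => by
  calc g t * (x * y) * star (g t) = g t * x * 1 * y * star (g t) := by
        simp only [mul_assoc, mul_one]
    _ = (g t * x * star (g t)) * (g t * y * star (g t)) := by rw [← hg t]; simp only [mul_assoc]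
    _ = Complex.exp (Complex.I * (d + e : ℤ) * t) • (x * y) := by
      rw [hx, hy, smul_mul_smul_comm, ← Complex.exp_add]
      push_cast
      ring_nf

theorem star_mem_spectralSubspace [StarModule ℂ B] (hx : x ∈ spectralSubspace g d) :
    star x ∈ spectralSubspace g (-d) := fun t => by
  have h := congrArg star (hx t)
  rw [star_mul, star_mul, star_star, ← mul_assoc, star_smul] at h
  rw [h, Complex.star_def, ← Complex.exp_conj]
  simp

theorem map_mem_spectralSubspace {C : Type*} [Ring C] [StarRing C] [Algebra ℂ C] (φ : B →⋆ₐ[ℂ] C)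
    (hx : x ∈ spectralSubspace g d) : φ x ∈ spectralSubspace (fun t => φ (g t)) d := fun t => by
  rw [← map_star, ← map_mul, ← map_mul, hx, map_smul]

/-- The average of `g_t x g_t*` over the `N`-th roots of unity `e^{it}`. -/
def rootAverage (g : ℝ → B) (N : ℕ) : B →ₗ[ℂ] B :=
  (N : ℂ)⁻¹ • ∑ j ∈ Finset.range N,
    LinearMap.mulLeftRight ℂ (g (2 * Real.pi * j / N), star (g (2 * Real.pi * j / N)))

theorem rootAverage_apply (g : ℝ → B) (N : ℕ) (x : B) :
    rootAverage g N x = (N : ℂ)⁻¹ • ∑ j ∈ Finset.range N,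
      g (2 * Real.pi * j / N) * x * star (g (2 * Real.pi * j / N)) := by
  simp only [rootAverage, LinearMap.smul_apply, LinearMap.sum_apply, LinearMap.mulLeftRight_apply]

theorem rootAverage_of_mem_spectralSubspace_zero {N : ℕ} (hN : N ≠ 0)
    (hx : x ∈ spectralSubspace g 0) : rootAverage g N x = x := by
  rw [rootAverage_apply, Finset.sum_congr rfl fun j _ => mem_spectralSubspace_zero.1 hx _,
    Finset.sum_const, Finset.card_range, ← Nat.cast_smul_eq_nsmul ℂ,
    inv_smul_smul₀ (Nat.cast_ne_zero.2 hN)]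

theorem sum_exp_two_pi_mul_div_eq_zero {N : ℕ} (hd : d ≠ 0) (hN : d.natAbs < N) :
    ∑ j ∈ Finset.range N, Complex.exp (Complex.I * d * (2 * Real.pi * j / N : ℝ)) = 0 := by
  have hN0 : N ≠ 0 := by lia
  have hζ := Complex.isPrimitiveRoot_exp N hN0
  set ζ := Complex.exp (2 * Real.pi * Complex.I / N)
  have hpow (j : ℕ) : Complex.exp (Complex.I * d * (2 * Real.pi * j / N : ℝ)) = (ζ ^ d) ^ j := by
    rw [← Complex.exp_int_mul, ← Complex.exp_nat_mul]
    push_cast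
    ring_nf
  have hne : ζ ^ d ≠ 1 := fun h => hd <|
    Int.eq_zero_of_dvd_of_natAbs_lt_natAbs ((hζ.zpow_eq_one_iff_dvd d).1 h) hN
  have hone : (ζ ^ d) ^ N = 1 := by
    rw [← zpow_natCast, zpow_comm, zpow_natCast, hζ.pow_eq_one, one_zpow]
  simp only [hpow, geom_sum_eq hne, hone, sub_self, zero_div]

theorem rootAverage_of_mem_spectralSubspace {N : ℕ} (hd : d ≠ 0) (hN : d.natAbs < N)
    (hx : x ∈ spectralSubspace g d) : rootAverage g N x = 0 := by
  rw [rootAverage_apply, Finset.sum_congr rfl fun j _ => hx _, ← Finset.sum_smul,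
    sum_exp_two_pi_mul_div_eq_zero hd hN, zero_smul, smul_zero]

theorem exists_forall_rootAverage_mem {M : ℤ → Submodule ℂ B} (hM : ∀ d, M d ≤ spectralSubspace g d)
    (hx : x ∈ ⨆ d, M d) : ∃ N₀, ∀ N ≥ N₀, rootAverage g N x ∈ M 0 := by
  induction hx using Submodule.iSup_induction' with
  | mem d x hx =>
    refine ⟨d.natAbs + 1, fun N hN => ?_⟩
    rcases eq_or_ne d 0 with rfl | hd
    · rwa [rootAverage_of_mem_spectralSubspace_zero (by lia) (hM 0 hx)]
    · rw [rootAverage_of_mem_spectralSubspace hd (by lia) (hM d hx)]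
      exact zero_mem _
  | zero => exact ⟨0, fun N _ => by rw [map_zero]; exact zero_mem _⟩
  | add x y _ _ hx hy =>
    obtain ⟨N₁, h₁⟩ := hx
    obtain ⟨N₂, h₂⟩ := hy
    refine ⟨max N₁ N₂, fun N hN => ?_⟩
    rw [map_add]
    exact add_mem (h₁ N (le_of_max_le_left hN)) (h₂ N (le_of_max_le_right hN))

theorem adjoin_le_iSup_of_graded [StarModule ℂ B] {M : ℤ → Submodule ℂ B} {s : Set B}
    (hmul : ∀ {d e x y}, x ∈ M d → y ∈ M e → x * y ∈ M (d + e))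
    (hstar : ∀ {d x}, x ∈ M d → star x ∈ M (-d)) (hs : s ⊆ M 1) :
    (NonUnitalStarAlgebra.adjoin ℂ s : Set B) ⊆ (⨆ d, M d : Submodule ℂ B) := by
  have hstar' {x : B} (hx : x ∈ ⨆ d, M d) : star x ∈ ⨆ d, M d := by
    induction hx using Submodule.iSup_induction' with
    | mem d x hx => exact Submodule.mem_iSup_of_mem _ (hstar hx)
    | zero => rw [star_zero]; exact zero_mem _
    | add x y _ _ hx hy => rw [star_add]; exact add_mem hx hy
  have hmul' : (⨆ d, M d) * (⨆ d, M d) ≤ ⨆ d, M d := by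
    simp only [Submodule.iSup_mul, Submodule.mul_iSup]
    exact iSup_le fun d => iSup_le fun e => Submodule.mul_le.2 fun x hx y hy =>
      Submodule.mem_iSup_of_mem _ (hmul hx hy)
  let S : NonUnitalStarSubalgebra ℂ B :=
    { (⨆ d, M d : Submodule ℂ B) with
      mul_mem' := fun hx hy => hmul' (Submodule.mul_mem_mul hx hy)
      star_mem' := hstar' }
  exact show _ ≤ S from
    NonUnitalStarAlgebra.adjoin_le fun x hx => Submodule.mem_iSup_of_mem 1 (hs hx)

end SpectralSubspace

section CStar
variable {B : Type*} [CStarAlgebra B] {g : ℝ → B}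

theorem norm_rootAverage_le (hg : ∀ t, g t * star (g t) = 1) (N : ℕ) (x : B) :
    ‖rootAverage g N x‖ ≤ ‖x‖ := by
  have hnorm_one : ‖(1 : B)‖ ≤ 1 := by
    have h := CStarRing.norm_star_mul_self (x := (1 : B))
    rw [star_one, mul_one] at h
    nlinarith [norm_nonneg (1 : B)]
  have hnorm (t : ℝ) : ‖g t‖ ≤ 1 := by
    have h := CStarRing.norm_self_mul_star (x := g t)
    rw [hg] at h
    nlinarith [norm_nonneg (g t)]
  have hterm (t : ℝ) : ‖g t * x * star (g t)‖ ≤ ‖x‖ := by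
    calc ‖g t * x * star (g t)‖ ≤ ‖g t‖ * ‖x‖ * ‖star (g t)‖ := norm_mul₃_le
      _ ≤ 1 * ‖x‖ * 1 := by
        rw [norm_star]
        gcongr <;> exact hnorm t
      _ = ‖x‖ := by rw [one_mul, mul_one]
  rw [rootAverage_apply, norm_smul, norm_inv, Complex.norm_natCast]
  rcases eq_or_ne N 0 with rfl | hN
  · simp
  · rw [inv_mul_le_iff₀ (by positivity)]
    refine (norm_sum_le_of_le _ fun j _ => hterm _).trans_eq ?_
    rw [Finset.sum_const, Finset.card_range, nsmul_eq_mul]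

theorem mem_closure_of_mem_closure_iSup (hg : ∀ t, g t * star (g t) = 1) {M : ℤ → Submodule ℂ B}
    (hM : ∀ d, M d ≤ spectralSubspace g d) {x : B} (hx₀ : x ∈ spectralSubspace g 0)
    (hx : x ∈ closure ((⨆ d, M d : Submodule ℂ B) : Set B)) : x ∈ closure (M 0 : Set B) := by
  refine Metric.mem_closure_iff.2 fun ε hε => ?_
  obtain ⟨y, hy, hxy⟩ := Metric.mem_closure_iff.1 hx ε hε
  obtain ⟨N₀, hN₀⟩ := exists_forall_rootAverage_mem hM hy
  refine ⟨rootAverage g (N₀ + 1) y, hN₀ _ (Nat.le_succ _), ?_⟩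
  rw [← rootAverage_of_mem_spectralSubspace_zero N₀.succ_ne_zero hx₀, dist_eq_norm, ← map_sub]
  exact (norm_rootAverage_le hg _ _).trans_lt (dist_eq_norm x y ▸ hxy)

end CStar

/-! ### Homomorphisms of C⋆-algebras -/

section ClosedRange
open scoped CStarAlgebra
variable {A B : Type*} [NonUnitalCStarAlgebra A] [NonUnitalCStarAlgebra B]

/-- Truncate `a` by the functional calculus at height `‖φ a‖`; on the spectrum of `φ a` the
truncation is the identity. -/
theorem exists_apply_eq_norm_le_of_isSelfAdjoint (φ : A →⋆ₙₐ[ℂ] B) {a : A}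
    (ha : IsSelfAdjoint a) : ∃ b, φ b = φ a ∧ ‖b‖ ≤ ‖φ a‖ := by
  set r := ‖φ a‖
  have hr : 0 ≤ r := norm_nonneg _
  let f : ℝ → ℝ := fun t => max (-r) (min t r)
  have hf : Continuous f := by fun_prop
  have hf0 : f 0 = 0 := by simp [f, hr]
  have hφa : IsSelfAdjoint (φ a) := ha.map φ
  refine ⟨cfcₙ f a, ?_, norm_cfcₙ_le fun x _ => abs_le.2
    ⟨le_max_left _ _, max_le (by linarith) (min_le_right _ _)⟩⟩
  rw [NonUnitalStarAlgHom.map_cfcₙ φ f a hf.continuousOn hf0 (map_continuous φ) ha hφa]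
  refine (cfcₙ_congr fun x hx => ?_).trans (cfcₙ_id ℝ (φ a) hφa)
  have hx' : |x| ≤ r := by
    simpa only [cfcₙ_id ℝ (φ a)] using! norm_apply_le_norm_cfcₙ (id : ℝ → ℝ) (φ a) hx
  rw [abs_le] at hx'
  simp only [f, id, min_eq_left hx'.2, max_eq_right hx'.1]

theorem exists_apply_eq_norm_le (φ : A →⋆ₙₐ[ℂ] B) (a : A) :
    ∃ b, φ b = φ a ∧ ‖b‖ ≤ 2 * ‖φ a‖ := by
  obtain ⟨b₁, h₁, hn₁⟩ := exists_apply_eq_norm_le_of_isSelfAdjoint φ (realPart a).2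
  obtain ⟨b₂, h₂, hn₂⟩ := exists_apply_eq_norm_le_of_isSelfAdjoint φ (imaginaryPart a).2
  have hsmul (x : A) : φ ((2⁻¹ : ℝ) • x) = (2⁻¹ : ℝ) • φ x := by
    rw [← Complex.coe_smul, map_smul, Complex.coe_smul]
  have hre : φ (realPart a : A) = (realPart (φ a) : B) := by
    rw [realPart_apply_coe, realPart_apply_coe, hsmul, map_add, map_star]
  have him : φ (imaginaryPart a : A) = (imaginaryPart (φ a) : B) := by
    rw [imaginaryPart_apply_coe, imaginaryPart_apply_coe, map_smul, hsmul, map_sub, map_star]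
  refine ⟨b₁ + Complex.I • b₂, ?_, ?_⟩
  · rw [map_add, map_smul, h₁, h₂, ← map_smul, ← map_add, realPart_add_I_smul_imaginaryPart]
  · calc ‖b₁ + Complex.I • b₂‖ ≤ ‖b₁‖ + ‖b₂‖ := by
          simpa only [norm_smul, Complex.norm_I, one_mul] using norm_add_le b₁ (Complex.I • b₂)
      _ ≤ ‖(realPart (φ a) : B)‖ + ‖(imaginaryPart (φ a) : B)‖ := by
          rw [← hre, ← him]
          exact add_le_add hn₁ hn₂
      _ ≤ ‖φ a‖ + ‖φ a‖ := add_le_add (realPart.norm_le (φ a)) (imaginaryPart.norm_le (φ a))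
      _ = 2 * ‖φ a‖ := (two_mul _).symm

theorem isClosed_range_starAlgHom (φ : A →⋆ₙₐ[ℂ] B) : IsClosed (Set.range φ) := by
  let f : NormedAddGroupHom A B := AddMonoidHom.mkNormedAddGroupHom (φ : A →+ B) 1 fun x =>
    (NonUnitalStarAlgHom.norm_apply_le φ x).trans_eq (one_mul _).symm
  have hf : f.SurjectiveOnWith f.range 2 := by
    rintro _ ⟨a, rfl⟩
    exact exists_apply_eq_norm_le φ a
  refine isClosed_of_closure_subset fun x hx => ?_
  obtain ⟨a, ha, -⟩ := controlled_closure_of_complete two_pos one_pos hf x hx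
  exact ⟨a, ha⟩

theorem isClosed_map_starAlgHom {A B : Type*} [NonUnitalCStarAlgebra A] [NonUnitalCStarAlgebra B]
    (φ : A →⋆ₙₐ[ℂ] B) (S : NonUnitalStarSubalgebra ℂ A) (hS : IsClosed (S : Set A)) :
    IsClosed (S.map φ : Set B) := by
  have := hS
  have hrange := isClosed_range_starAlgHom (φ.comp (NonUnitalStarSubalgebraClass.subtype S))
  rwa [NonUnitalStarAlgHom.coe_comp, Set.range_comp, NonUnitalStarSubalgebraClass.coe_subtype,
    Subtype.range_coe] at hrange

end ClosedRange

section FunctionalCalculus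
variable {A : Type*} [CStarAlgebra A] [PartialOrder A] [StarOrderedRing A]

theorem exists_mem_star_mul_self_eq (S : StarSubalgebra ℂ A) [IsClosed (S : Set A)] {a : A}
    (h : 0 ≤ a) (ha : a ∈ S) : ∃ r ∈ S, star r * r = a := by
  have hsa : IsSelfAdjoint a := IsSelfAdjoint.of_nonneg h
  refine ⟨cfc Real.sqrt a, cfc_mem (𝕜' := ℂ) Real.sqrt ha, ?_⟩
  have hsqrt : IsSelfAdjoint (cfc Real.sqrt a) := cfc_predicate _ _
  rw [hsqrt.star_eq, ← cfc_mul Real.sqrt Real.sqrt a]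
  exact (cfc_congr fun x hx => Real.mul_self_sqrt (spectrum_nonneg_of_nonneg h hx)).trans
    (cfc_id' ℝ a)

/-- Take `w = g (y * y)`, where `g` vanishes at `0` and `g (t ^ 2) = t⁻¹` for `t ≥ ε`. -/
theorem exists_mem_mul_eq_one (S : NonUnitalStarSubalgebra ℂ A) [IsClosed (S : Set A)] {y : A}
    {ε : ℝ} (hε : 0 < ε) (hy : algebraMap ℝ A ε ≤ y) (hyS : y * y ∈ S) : ∃ w ∈ S, y * w = 1 := by
  have hsa : IsSelfAdjoint y := by
    simpa only [sub_add_cancel] using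
      (IsSelfAdjoint.of_nonneg (sub_nonneg.2 hy)).add (IsSelfAdjoint.algebraMap A (.all ε))
  let g : ℝ → ℝ := fun t => t / (max t (ε ^ 2) * √(max t (ε ^ 2)))
  have hg : Continuous g := by
    refine continuous_id.div (by fun_prop) fun t => ?_
    have : 0 < max t (ε ^ 2) := lt_max_of_lt_right (by positivity)
    positivity
  have hg_sq {t : ℝ} (ht : ε ≤ t) : t * g (t * t) = 1 := by
    have ht0 : 0 < t := hε.trans_le ht
    simp only [g]
    rw [max_eq_left (by nlinarith), Real.sqrt_mul_self ht0.le]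
    field_simp
  have hsq : y * y = cfc (fun t : ℝ => t * t) y := by
    rw [cfc_mul (fun t : ℝ => t) (fun t : ℝ => t) y, cfc_id' ℝ y]
  refine ⟨cfcₙ g (y * y), cfcₙ_mem (𝕜' := ℂ) g hyS, ?_⟩
  calc y * cfcₙ g (y * y) = cfc (fun t : ℝ => t) y * cfc (fun t : ℝ => g (t * t)) y := by
        rw [cfcₙ_eq_cfc (hf := hg.continuousOn) (hf0 := by simp [g]), hsq,
          ← cfc_comp' g (fun t : ℝ => t * t) y (hg := hg.continuousOn), cfc_id' ℝ y]
    _ = cfc (fun t : ℝ => t * g (t * t)) y :=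
        (cfc_mul _ _ y (by fun_prop) (hg.comp (by fun_prop)).continuousOn).symm
    _ = cfc (1 : ℝ → ℝ) y :=
        cfc_congr fun t ht => hg_sq ((algebraMap_le_iff_le_spectrum hsa).1 hy t ht)
    _ = 1 := cfc_one ℝ y

end FunctionalCalculus

section Extension
open scoped CStarAlgebra

theorem existsUnique_extension_of_denseRange {U D B : Type*} [NonUnitalRing U] [StarRing U]
    [Module ℂ U] [NonUnitalCStarAlgebra D] [NonUnitalCStarAlgebra B] (j : U →⋆ₙₐ[ℂ] D)
    (hj : DenseRange j) (φ : U →⋆ₙₐ[ℂ] B) (hφ : ∀ x, ‖φ x‖ ≤ ‖j x‖) :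
    ∃! Φ : D →⋆ₙₐ[ℂ] B, ∀ x, Φ (j x) = φ x := by
  let F : D →L[ℂ] B := (φ : U →ₗ[ℂ] B).extendOfNorm (j : U →ₗ[ℂ] D)
  have hF (x : U) : F (j x) = φ x :=
    LinearMap.extendOfNorm_eq (f := (φ : U →ₗ[ℂ] B)) (e := (j : U →ₗ[ℂ] D)) hj
      ⟨1, fun x => (hφ x).trans_eq (one_mul _).symm⟩ x
  have hmul (a b : D) : F (a * b) = F a * F b :=
    hj.induction_on₂ (p := fun a b => F (a * b) = F a * F b)
      (isClosed_eq (by fun_prop) (by fun_prop))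
      (fun x y => by rw [← map_mul, hF, hF, hF, map_mul]) a b
  have hstar (a : D) : F (star a) = star (F a) :=
    hj.induction_on (p := fun a => F (star a) = star (F a)) a
      (isClosed_eq (by fun_prop) (by fun_prop))
      fun x => by rw [← map_star, hF, hF, map_star]
  refine ⟨{ toFun := F
            map_smul' := map_smul F
            map_zero' := map_zero F
            map_add' := map_add F
            map_mul' := hmul
            map_star' := hstar }, hF, fun Φ hΦ => DFunLike.coe_injective ?_⟩
  exact hj.equalizer (map_continuous Φ) F.continuous (funext fun x => (hΦ x).trans (hF x).symm)

open NonUnitalStarSubalgebra (inclusion)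

variable {Q : Type*} [NonUnitalCStarAlgebra Q] (C : ℕ → NonUnitalStarSubalgebra ℂ Q)
  (D : NonUnitalStarSubalgebra ℂ Q) (hC : ∀ n, IsClosed (C n : Set Q)) (hD : IsClosed (D : Set Q))
  (hle : ∀ n, C n ≤ C (n + 1)) (hCD : ∀ n, C n ≤ D)
  (hdense : (D : Set Q) ⊆ closure (⋃ n, (C n : Set Q)))
include hC hD hdense

theorem existsUnique_extension_of_subset_closure_iUnion (B : Type w) [NonUnitalCStarAlgebra B]
    (φ : ∀ n, C n →⋆ₙₐ[ℂ] B) (hφ : ∀ n c, φ (n + 1) (inclusion (hle n) c) = φ n c) :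
    ∃! Φ : D →⋆ₙₐ[ℂ] B, ∀ n c, Φ (inclusion (hCD n) c) = φ n c := by
  have hmono : Monotone C := monotone_nat_of_le_succ hle
  have hφ_le {n m : ℕ} (h : n ≤ m) (x : C n) : φ m (inclusion (hmono h) x) = φ n x := by
    induction m, h using Nat.le_induction with
    | base => rfl
    | succ m hnm ih => rw [← ih]; exact hφ m (inclusion (hmono hnm) x)
  have hcompat (n m : ℕ) (h : C n ≤ C m) : φ n = (φ m).comp (inclusion h) :=
    NonUnitalStarAlgHom.ext fun x =>
      (hφ_le (le_max_left n m) x).symm.trans (hφ_le (le_max_right n m) (inclusion h x))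
  let ψ : (⨆ n, C n : NonUnitalStarSubalgebra ℂ Q) →⋆ₙₐ[ℂ] B :=
    NonUnitalStarSubalgebra.iSupLift C hmono.directed_le φ hcompat _ rfl
  let j := inclusion (iSup_le hCD)
  have hcoe := NonUnitalStarSubalgebra.coe_iSup_of_directed hmono.directed_le
  have hmem (x : (⨆ n, C n : NonUnitalStarSubalgebra ℂ Q)) :
      ∃ n, ∃ c : C n, inclusion (le_iSup C n) c = x := by
    obtain ⟨n, hn⟩ := Set.mem_iUnion.1 (hcoe ▸ SetLike.mem_coe.2 x.2)
    exact ⟨n, ⟨x, hn⟩, rfl⟩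
  have hψ (n : ℕ) (c : C n) : ψ (inclusion (le_iSup C n) c) = φ n c :=
    NonUnitalStarSubalgebra.iSupLift_inclusion _ _
  have hj : DenseRange j :=
    (denseRange_inclusion_iff (SetLike.coe_subset_coe.2 (iSup_le hCD))).2 (hcoe.symm ▸ hdense)
  have hbound (x) : ‖ψ x‖ ≤ ‖j x‖ := by
    obtain ⟨n, c, rfl⟩ := hmem x
    rw [hψ]
    exact NonUnitalStarAlgHom.norm_apply_le (φ n) c
  obtain ⟨Φ, hΦ, hunique⟩ := existsUnique_extension_of_denseRange j hj ψ hbound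
  refine ⟨Φ, fun n c => (hΦ (inclusion (le_iSup C n) c)).trans (hψ n c),
    fun Ψ hΨ => hunique Ψ fun x => ?_⟩
  obtain ⟨n, c, rfl⟩ := hmem x
  exact (hΨ n c).trans (hψ n c).symm

theorem IsCStarDirectLimit.of_dense
    {A : ℕ → Type*} [∀ n, NonUnitalRing (A n)] [∀ n, StarRing (A n)] [∀ n, Module ℂ (A n)]
    (τ : ∀ n, C n ≃⋆ₐ[ℂ] A n) :
    IsCStarDirectLimit.{w}
      (fun n => (τ (n + 1) : C (n + 1) →⋆ₙₐ[ℂ] A (n + 1)).comp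
        ((inclusion (hle n)).comp ((τ n).symm : A n →⋆ₙₐ[ℂ] C n)))
      (fun n => (inclusion (hCD n)).comp ((τ n).symm : A n →⋆ₙₐ[ℂ] C n)) where
  compat n a := congrArg (inclusion (hCD (n + 1)))
    ((τ (n + 1)).symm_apply_apply (inclusion (hle n) ((τ n).symm a)))
  universal B _ φ hφ := by
    have hφτ (n : ℕ) (c : C n) : φ (n + 1) (τ (n + 1) (inclusion (hle n) c)) = φ n (τ n c) := by
      simpa only [NonUnitalStarAlgHom.comp_apply, NonUnitalStarAlgHom.coe_coe,
        StarAlgEquiv.symm_apply_apply] using hφ n (τ n c)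
    obtain ⟨Φ, hΦ, hunique⟩ := existsUnique_extension_of_subset_closure_iUnion C D hC hD hle hCD
      hdense B (fun n => (φ n).comp (τ n : C n →⋆ₙₐ[ℂ] A n)) hφτ
    refine ⟨Φ, fun n a => ?_, fun Ψ hΨ => hunique Ψ fun n c => ?_⟩
    · exact (hΦ n ((τ n).symm a)).trans (congrArg (φ n) ((τ n).apply_symm_apply a))
    · refine Eq.trans ?_ (hΨ n (τ n c))
      exact congrArg (fun x => Ψ (inclusion (hCD n) x)) ((τ n).symm_apply_apply c).symm

end Extension

/-! ### Row compressions -/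

/-- The `⋆`-homomorphism `c ↦ (r_i* c r_j)` into matrices, for a row `r` with `∑ r_i r_i* = 1`. -/
def rowCompression {Γ B : Type*} [Fintype Γ] [Ring B] [StarRing B] [Algebra ℂ B] (r : Γ → B)
    (hr : ∑ i, r i * star (r i) = 1) : B →⋆ₙₐ[ℂ] Matrix Γ Γ B where
  toFun c := Matrix.of fun i j => star (r i) * c * r j
  map_smul' a c := by
    ext i j
    simp only [Matrix.of_apply, Matrix.smul_apply, MonoidHom.id_apply, mul_smul_comm,
      smul_mul_assoc]
  map_zero' := by
    ext i j
    simp only [Matrix.of_apply, Matrix.zero_apply, mul_zero, zero_mul]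
  map_add' c d := by
    ext i j
    simp only [Matrix.of_apply, Matrix.add_apply, mul_add, add_mul]
  map_mul' c d := by
    ext i j
    calc star (r i) * (c * d) * r j = star (r i) * c * 1 * d * r j := by
          simp only [mul_one, mul_assoc]
      _ = ∑ k, star (r i) * c * r k * (star (r k) * d * r j) := by
          rw [← hr]
          simp only [Finset.mul_sum, Finset.sum_mul, mul_assoc]
  map_star' c := by
    ext i j
    simp only [Matrix.of_apply, Matrix.star_apply, star_mul, star_star, mul_assoc]

section RowCompression
variable {Γ B : Type*} [Fintype Γ] [Ring B] [StarRing B] [Algebra ℂ B] {r : Γ → B}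
  (hr : ∑ i, r i * star (r i) = 1)

theorem rowCompression_apply (c : B) (i j : Γ) :
    rowCompression r hr c i j = star (r i) * c * r j := rfl

theorem rowCompression_injective : Function.Injective (rowCompression r hr) := by
  refine (injective_iff_map_eq_zero _).2 fun c hc => ?_
  have hentry : ∀ i j, star (r i) * c * r j = 0 := fun i j => congrFun (congrFun hc i) j
  calc c = (∑ i, r i * star (r i)) * c * ∑ j, r j * star (r j) := by rw [hr, one_mul, mul_one]
    _ = ∑ i, ∑ j, r i * (star (r i) * c * r j) * star (r j) := by
        simp only [Finset.mul_sum, Finset.sum_mul, mul_assoc]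
        exact Finset.sum_comm
    _ = 0 := by simp only [hentry, mul_zero, zero_mul, Finset.sum_const_zero]

theorem rowCompression_mul_mul_star [DecidableEq Γ]
    (horth : ∀ i j, i ≠ j → star (r i) * r j = 0) (i j : Γ) (b : B) :
    rowCompression r hr (r i * b * star (r j)) =
      Matrix.single i j (star (r i) * r i * b * (star (r j) * r j)) := by
  ext k l
  rw [rowCompression_apply, ← mul_assoc, ← mul_assoc, mul_assoc _ (star (r j))]
  by_cases h : i = k ∧ j = l
  · rw [← h.1, ← h.2, Matrix.single_apply_same]
  · rw [Matrix.single_apply_of_ne _ _ _ _ _ h]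
    rcases not_and_or.1 h with hk | hl
    · rw [horth k i (Ne.symm hk), zero_mul, zero_mul]
    · rw [horth j l hl, mul_zero]

end RowCompression

/-! ### Operators on the Fock module -/

namespace Ell2
variable {I J V : Type*}

theorem inner_single_one [DecidableEq I] (i : I) (x : Ell2 I) :
    inner ℂ (lp.single 2 i (1 : ℂ) : Ell2 I) x = x i := by
  rw [lp.inner_single_left, RCLike.inner_apply, map_one, mul_one]

theorem adjoint_apply [DecidableEq I] (T : Ell2 I →L[ℂ] Ell2 J) (y : Ell2 J) (i : I) :
    ContinuousLinearMap.adjoint T y i = inner ℂ (T (lp.single 2 i (1 : ℂ))) y := by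
  rw [← inner_single_one, ContinuousLinearMap.adjoint_inner_right]

theorem star_diagOp (f : I → ℂ) (hf : ∃ C, ∀ i, ‖f i‖ ≤ C) (hf' : ∃ C, ∀ i, ‖star (f i)‖ ≤ C) :
    star (diagOp f hf) = diagOp (fun i => star (f i)) hf' := by
  classical
  ext y i
  have diagOp_single : diagOp f hf (lp.single 2 i (1 : ℂ)) = f i • lp.single 2 i (1 : ℂ) := by
    ext j
    by_cases h : j = i
    · rw [h]; rfl
    · rw [diagOp_apply, lp.coeFn_smul, Pi.smul_apply, lp.single_apply_ne 2 i _ h, mul_zero,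
        smul_zero]
  rw [ContinuousLinearMap.star_eq_adjoint, adjoint_apply, diagOp_single, inner_smul_left,
    inner_single_one]
  rfl

section PartialOp
variable (R : I → J → Prop) (h₁ : ∀ i i' j, R i j → R i' j → i = i')
  (h₂ : ∀ i j j', R i j → R i j' → j = j')

theorem norm_partialOp_le : ‖partialOp R h₁ h₂‖ ≤ 1 := by
  unfold partialOp mkOp
  exact LinearMap.mkContinuous_norm_le _ zero_le_one _

theorem partialOp_single [DecidableEq I] [DecidableEq J] {i : I} {j : J} (h : R i j) :
    partialOp R h₁ h₂ (lp.single 2 i (1 : ℂ)) = lp.single 2 j (1 : ℂ) := by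
  ext k
  by_cases hk : ∃ i', R i' k
  · obtain ⟨i', hi'⟩ := hk
    rw [partialOp_apply R h₁ h₂ _ hi']
    by_cases e : i' = i
    · subst e
      rw [h₂ _ _ _ hi' h, lp.single_apply_self, lp.single_apply_self]
    · rw [lp.single_apply_ne 2 i _ e, lp.single_apply_ne]
      rintro rfl
      exact e (h₁ _ _ _ hi' h)
  · rw [partialOp_apply_of_not R h₁ h₂ _ (not_exists.1 hk), lp.single_apply_ne]
    rintro rfl
    exact hk ⟨i, h⟩

theorem partialOp_single_of_not [DecidableEq I] {i : I} (h : ∀ j, ¬ R i j) :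
    partialOp R h₁ h₂ (lp.single 2 i (1 : ℂ)) = 0 := by
  ext k
  by_cases hk : ∃ i', R i' k
  · obtain ⟨i', hi'⟩ := hk
    rw [partialOp_apply R h₁ h₂ _ hi', lp.single_apply_ne]
    · rfl
    · rintro rfl
      exact h _ hi'
  · rw [partialOp_apply_of_not R h₁ h₂ _ (not_exists.1 hk)]
    rfl

theorem adjoint_partialOp_apply (y : Ell2 J) {i : I} {j : J} (h : R i j) :
    ContinuousLinearMap.adjoint (partialOp R h₁ h₂) y i = y j := by
  classical
  rw [adjoint_apply, partialOp_single R h₁ h₂ h, inner_single_one]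

theorem adjoint_partialOp_apply_of_not (y : Ell2 J) {i : I} (h : ∀ j, ¬ R i j) :
    ContinuousLinearMap.adjoint (partialOp R h₁ h₂) y i = 0 := by
  classical
  rw [adjoint_apply, partialOp_single_of_not R h₁ h₂ h, inner_zero_left]

end PartialOp

section Compacts
variable [Fintype V] (σ : I → V)

theorem theta_single_apply [DecidableEq I] (i : I) (x : Ell2 I) :
    (theta σ (lp.single 2 i (1 : ℂ)) (lp.single 2 i (1 : ℂ))).1 x =
      x i • lp.single 2 i (1 : ℂ) := by
  have fiberProj_single :
      fiberProj σ (σ i) (lp.single 2 i (1 : ℂ)) = lp.single 2 i (1 : ℂ) := by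
    ext k
    rw [fiberProj_apply]
    by_cases hk : k = i
    · rw [hk, if_pos rfl]
    · rw [lp.single_apply_ne 2 i _ hk, ite_self]
  ext j
  change thetaOp σ _ _ x j = _
  rw [thetaOp_apply, rightAct, diagOp_apply, lp.coeFn_smul, Pi.smul_apply, smul_eq_mul]
  by_cases h : j = i
  · rw [h, ← fiberProj_inner, fiberProj_single, inner_single_one]
  · rw [lp.single_apply_ne 2 i _ h, mul_zero, mul_zero]

theorem diagOp_mem_compacts (f : I → ℂ) (hf : ∃ C, ∀ i, ‖f i‖ ≤ C) (hfin : f.support.Finite) :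
    (⟨diagOp f hf, diagOp_mem σ f hf⟩ : adjointables σ) ∈ compacts σ := by
  classical
  have diag_eq_sum : (⟨diagOp f hf, diagOp_mem σ f hf⟩ : adjointables σ) =
      ∑ i ∈ hfin.toFinset, f i • theta σ (lp.single 2 i (1 : ℂ)) (lp.single 2 i (1 : ℂ)) := by
    refine Subtype.ext ?_
    rw [AddSubmonoidClass.coe_finsetSum]
    ext x j
    simp only [diagOp_apply, sum_apply, SetLike.val_smul,
      smul_apply, theta_single_apply, lp.coeFn_sum, Finset.sum_apply,
      lp.coeFn_smul, Pi.smul_apply, lp.single_apply, Pi.single_apply, smul_eq_mul, mul_ite,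
      mul_one, mul_zero, Finset.sum_ite_eq, Set.Finite.mem_toFinset, Function.mem_support]
    split_ifs with h
    · rfl
    · rw [Classical.not_not.1 h, zero_mul]
  rw [diag_eq_sum]
  exact (compactSpan σ).sum_mem fun i _ => (compactSpan σ).smul_mem _
    (Submodule.le_topologicalClosure _ (Submodule.subset_span ⟨_, _, rfl⟩))

end Compacts

end Ell2

namespace DirGraph
open Ell2
variable {V E : Type*} {G : DirGraph V E}

namespace Path

/-- The path `eβ`. -/
def cons (e : E) (β : G.Path) (h : G.s e = β.rng) : G.Path := ⟨e :: β.edges, β.src, h, β.isPath⟩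

/-- A vertex as a path of length `0`. -/
def vertex (G : DirGraph V E) (v : V) : G.Path := ⟨[], v, trivial⟩

/-- The edge `e` as a path of length `1`. -/
def edge (G : DirGraph V E) (e : E) : G.Path := cons e (vertex G (G.s e)) rfl

@[simp] theorem vertex_len (v : V) : (vertex G v).len = 0 := rfl
@[simp] theorem vertex_src (v : V) : (vertex G v).src = v := rfl
@[simp] theorem vertex_rng (v : V) : (vertex G v).rng = v := rfl

@[simp] theorem edge_len (e : E) : (edge G e).len = 1 := rfl
@[simp] theorem edge_src (e : E) : (edge G e).src = G.s e := rfl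

theorem eq_vertex {α : G.Path} (h : α.len = 0) : α = vertex G α.src :=
  Path.ext (List.length_eq_zero_iff.1 h) rfl

@[elab_as_elim]
theorem cons_induction {motive : G.Path → Prop} (vertex : ∀ v, motive (vertex G v))
    (cons : ∀ e β h, motive β → motive (cons e β h)) (α : G.Path) : motive α := by
  obtain ⟨edges, v, hpath⟩ := α
  induction edges with
  | nil => exact vertex v
  | cons e edges ih => exact cons e ⟨edges, v, hpath.2⟩ hpath.1 (ih hpath.2)

theorem rangeOf_append (v : V) (l m : List E) :
    G.rangeOf v (l ++ m) = G.rangeOf (G.rangeOf v m) l := by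
  cases l <;> rfl

theorem isPath_append {v : V} {l m : List E} :
    G.IsPath v (l ++ m) ↔ G.IsPath (G.rangeOf v m) l ∧ G.IsPath v m := by
  induction l with
  | nil => exact ⟨fun h => ⟨trivial, h⟩, And.right⟩
  | cons e l ih => simp only [List.cons_append, IsPath, rangeOf_append, ih, and_assoc]

/-- The concatenation `αβ` of two paths. -/
def comp (α β : G.Path) (h : β.rng = α.src) : G.Path where
  edges := α.edges ++ β.edges
  src := β.src
  isPath := isPath_append.2 ⟨by
    rw [show G.rangeOf β.src β.edges = α.src from h]
    exact α.isPath, β.isPath⟩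

@[simp] theorem comp_len (α β : G.Path) (h : β.rng = α.src) :
    (comp α β h).len = α.len + β.len := List.length_append

@[simp] theorem comp_rng (α β : G.Path) (h : β.rng = α.src) : (comp α β h).rng = α.rng :=
  (rangeOf_append _ _ _).trans (congrArg (fun v => G.rangeOf v α.edges) h)

@[simp] theorem vertex_comp (v : V) (β : G.Path) (h : β.rng = (vertex G v).src) :
    (vertex G v).comp β h = β := rfl

theorem comp_vertex (α : G.Path) : α.comp (vertex G α.src) rfl = α :=
  Path.ext (List.append_nil _) rfl

theorem exists_comp_eq (γ : G.Path) {k : ℕ} (hk : k ≤ γ.len) :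
    ∃ (α β : G.Path) (h : β.rng = α.src), α.len = k ∧ γ = comp α β h := by
  have hγ := γ.isPath
  rw [← List.take_append_drop k γ.edges, isPath_append] at hγ
  exact ⟨⟨γ.edges.take k, _, hγ.1⟩, ⟨γ.edges.drop k, γ.src, hγ.2⟩, rfl,
    List.length_take.trans (min_eq_left hk), Path.ext (List.take_append_drop k γ.edges).symm rfl⟩

theorem comp_inj {α α' β β' : G.Path} {h : β.rng = α.src} {h' : β'.rng = α'.src}
    (hlen : α.len = α'.len) (H : comp α β h = comp α' β' h') : α = α' ∧ β = β' := by
  obtain ⟨hα, hβ⟩ := List.append_inj (congrArg Path.edges H) hlen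
  have hββ' : β = β' := Path.ext hβ (congrArg Path.src H :)
  exact ⟨Path.ext hα (by rw [← h, ← h', hββ']), hββ'⟩

end Path

theorem finite_setOf_len_lt [Finite V] [Finite E] (k : ℕ) :
    {α : G.Path | α.len < k}.Finite :=
  ((Set.finite_Iio k).biUnion fun j _ => Set.finite_range (Subtype.val : G.PathN j → G.Path)).subset
    fun α hα => Set.mem_biUnion hα ⟨⟨α, rfl⟩, rfl⟩

section Fock
variable [Fintype V]

theorem L_ext {S T : G.L} (h : ∀ x α, S.1 x α = T.1 x α) : S = T :=
  Subtype.ext (ContinuousLinearMap.ext fun x => lp.ext (funext (h x)))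

theorem S_apply_cons (e : E) (β : G.Path) (h : G.s e = β.rng) (x : Ell2 G.Path) :
    (G.S e).1 x (Path.cons e β h) = x β := by
  change G.creationOp e x _ = _
  exact partialOp_apply (i := β) (j := Path.cons e β h) _ _ _ x ⟨rfl, rfl⟩

theorem S_apply_of_ne (e : E) (α : G.Path) (hα : ∀ β h, α ≠ Path.cons e β h) (x : Ell2 G.Path) :
    (G.S e).1 x α = 0 := by
  change G.creationOp e x α = 0
  refine partialOp_apply_of_not (j := α) _ _ _ x fun β hβ => ?_
  obtain ⟨edges, v, hpath⟩ := α
  obtain ⟨rfl, rfl⟩ := hβ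
  exact hα β hpath.1 rfl

open Classical in
theorem P_apply (v : V) (x : Ell2 G.Path) (α : G.Path) :
    (G.P v).1 x α = if α.rng = v then x α else 0 := by
  rw [P, phi, diagOp_apply, Pi.single_apply, ite_mul, one_mul, zero_mul]

theorem Spath_vertex (v : V) : G.Spath (Path.vertex G v) = G.P v := one_mul _

theorem Spath_cons (e : E) (β : G.Path) (h : G.s e = β.rng) :
    G.Spath (Path.cons e β h) = G.S e * G.Spath β := by
  simp only [Spath, Path.cons, List.map_cons, List.prod_cons, mul_assoc]

theorem Spath_apply_comp (β γ : G.Path) (h : γ.rng = β.src) (x : Ell2 G.Path) :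
    (G.Spath β).1 x (β.comp γ h) = x γ := by
  induction β using Path.cons_induction with
  | vertex v =>
    rw [Spath_vertex]
    exact (P_apply v x γ).trans (if_pos h)
  | cons e β he ih =>
    rw [Spath_cons]
    exact (S_apply_cons e (β.comp γ h) (he.trans (Path.comp_rng β γ h).symm) _).trans (ih h)

theorem Spath_apply_of_ne (β α : G.Path) (hα : ∀ γ h, α ≠ β.comp γ h) (x : Ell2 G.Path) :
    (G.Spath β).1 x α = 0 := by
  induction β using Path.cons_induction generalizing α with
  | vertex v =>
    rw [Spath_vertex, P_apply, if_neg]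
    exact fun h => hα α h rfl
  | cons e β he ih =>
    rw [Spath_cons]
    change (G.S e).1 ((G.Spath β).1 x) α = 0
    by_cases hcons : ∃ α' h, α = Path.cons e α' h
    · obtain ⟨α', h, rfl⟩ := hcons
      rw [S_apply_cons]
      refine ih α' ?_
      rintro γ hγ rfl
      exact hα γ hγ rfl
    · push Not at hcons
      exact S_apply_of_ne e α hcons _

theorem Spath_edge (e : E) : G.Spath (Path.edge G e) = G.S e := by
  refine L_ext fun x α => ?_
  by_cases h : ∃ γ h, α = (Path.edge G e).comp γ h
  · obtain ⟨γ, h, rfl⟩ := h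
    exact (Spath_apply_comp _ γ h x).trans (S_apply_cons e γ h.symm x).symm
  · push Not at h
    rw [Spath_apply_of_ne _ α h, S_apply_of_ne e α fun β hβ => h β hβ.symm]

theorem coe_Spath (β : G.Path) :
    (G.Spath β).1 = partialOp (fun γ α => ∃ h, α = β.comp γ h)
      (fun _ _ _ h h' => (Path.comp_inj rfl (h.2.symm.trans h'.2)).2)
      (fun _ _ _ h h' => h.2.trans h'.2.symm) := by
  ext x α
  by_cases h : ∃ γ h, α = β.comp γ h
  · obtain ⟨γ, h, rfl⟩ := h
    rw [Spath_apply_comp]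
    exact (partialOp_apply (i := γ) _ _ _ x ⟨h, rfl⟩).symm
  · push Not at h
    rw [Spath_apply_of_ne β α h]
    exact (partialOp_apply_of_not _ _ _ x fun γ hγ => h γ hγ.1 hγ.2).symm

theorem star_Spath_apply (β γ : G.Path) (h : γ.rng = β.src) (x : Ell2 G.Path) :
    (star (G.Spath β)).1 x γ = x (β.comp γ h) := by
  rw [StarMemClass.coe_star, coe_Spath, ContinuousLinearMap.star_eq_adjoint]
  exact adjoint_partialOp_apply (i := γ) _ _ _ x ⟨h, rfl⟩

theorem star_Spath_apply_of_ne (β γ : G.Path) (h : γ.rng ≠ β.src) (x : Ell2 G.Path) :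
    (star (G.Spath β)).1 x γ = 0 := by
  rw [StarMemClass.coe_star, coe_Spath, ContinuousLinearMap.star_eq_adjoint]
  exact adjoint_partialOp_apply_of_not (i := γ) _ _ _ x fun _ hα => h hα.1

theorem Spath_comp (α β : G.Path) (h : β.rng = α.src) :
    G.Spath (α.comp β h) = G.Spath α * G.Spath β := by
  induction α using Path.cons_induction with
  | vertex v =>
    refine L_ext fun x γ => ?_
    rw [Spath_vertex, Path.vertex_comp]
    refine Eq.trans ?_ (P_apply v ((G.Spath β).1 x) γ).symm
    split_ifs with hγ
    · rfl
    · refine Spath_apply_of_ne β γ ?_ x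
      rintro δ hδ rfl
      exact hγ ((Path.comp_rng β δ hδ).trans h)
  | cons e α he ih =>
    rw [Spath_cons, mul_assoc, ← ih h, ← Spath_cons e _ (he.trans (Path.comp_rng α β h).symm)]
    rfl

theorem Spath_mul_Spath_of_ne {α β : G.Path} (h : α.src ≠ β.rng) :
    G.Spath α * G.Spath β = 0 := by
  refine L_ext fun x δ => ?_
  change (G.Spath α).1 ((G.Spath β).1 x) δ = 0
  by_cases hδ : ∃ γ h, δ = α.comp γ h
  · obtain ⟨γ, hγ, rfl⟩ := hδ
    rw [Spath_apply_comp, Spath_apply_of_ne]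
    rintro ε hε rfl
    exact h (hγ.symm.trans (Path.comp_rng β ε hε))
  · push Not at hδ
    exact Spath_apply_of_ne α δ hδ _

theorem star_Spath_mul_Spath (α : G.Path) :
    star (G.Spath α) * G.Spath α = G.Spath (Path.vertex G α.src) := by
  refine L_ext fun x γ => ?_
  rw [Spath_vertex, P_apply]
  change (star (G.Spath α)).1 ((G.Spath α).1 x) γ = _
  split_ifs with h
  · rw [star_Spath_apply α γ h, Spath_apply_comp]
  · exact star_Spath_apply_of_ne α γ h _

theorem star_Spath_mul_Spath_of_ne {α β : G.Path} (hlen : α.len = β.len) (h : α ≠ β) :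
    star (G.Spath α) * G.Spath β = 0 := by
  refine L_ext fun x γ => ?_
  change (star (G.Spath α)).1 ((G.Spath β).1 x) γ = 0
  by_cases hγ : γ.rng = α.src
  · rw [star_Spath_apply α γ hγ]
    exact Spath_apply_of_ne β _ (fun δ _ hδ => h (Path.comp_inj hlen hδ).1) x
  · exact star_Spath_apply_of_ne α γ hγ _

variable (G) in
/-- The projection onto the closed span of the paths of length less than `k`. -/
def lowProj (k : ℕ) : G.L :=
  ⟨diagOp (fun α : G.Path => if α.len < k then 1 else 0)
    ⟨1, fun α => by split_ifs <;> simp⟩, diagOp_mem _ _ _⟩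

theorem lowProj_apply (k : ℕ) (x : Ell2 G.Path) (α : G.Path) :
    (G.lowProj k).1 x α = if α.len < k then x α else 0 := by
  rw [lowProj, diagOp_apply, ite_mul, one_mul, zero_mul]

variable [Finite E]

theorem lowProj_mem_compacts (k : ℕ) : G.lowProj k ∈ compacts (Path.src (G := G)) :=
  diagOp_mem_compacts _ _ _ ((finite_setOf_len_lt k).subset fun α hα => by
    by_contra h
    exact hα (if_neg h))

theorem sum_Spath_mul_star_Spath (k : ℕ) :
    ∑ μ : G.PathN k, G.Spath μ.1 * star (G.Spath μ.1) = 1 - G.lowProj k := by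
  refine L_ext fun x α => ?_
  rw [AddSubmonoidClass.coe_finsetSum, sum_apply, lp.coeFn_sum,
    Finset.sum_apply]
  change ∑ μ : G.PathN k, (G.Spath μ.1).1 ((star (G.Spath μ.1)).1 x) α =
    x α - (G.lowProj k).1 x α
  rw [lowProj_apply]
  split_ifs with hα
  · rw [sub_self]
    refine Finset.sum_eq_zero fun μ _ => Spath_apply_of_ne _ _ ?_ _
    rintro γ h rfl
    have := μ.2
    rw [Path.comp_len] at hα
    lia
  · obtain ⟨μ, γ, h, hμ, rfl⟩ := α.exists_comp_eq (not_lt.1 hα)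
    rw [Finset.sum_eq_single (⟨μ, hμ⟩ : G.PathN k), Spath_apply_comp, star_Spath_apply μ γ h,
      sub_zero]
    · refine fun ν _ hν => Spath_apply_of_ne _ _ (fun δ _ hδ => hν (Subtype.ext ?_)) _
      exact (Path.comp_inj (hμ.trans ν.2.symm) hδ).1.symm
    · exact fun h => absurd (Finset.mem_univ _) h

end Fock

end DirGraph

/-! ### The weight and the tensor decomposition -/

namespace DirGraph
open Ell2
variable {V E : Type*} {G : DirGraph V E}

section Components
variable {p k : ℕ}

/-- The concatenation of paths of fixed lengths. -/
def PathN.comp (β : G.PathN p) (γ : G.PathN k) (h : γ.1.rng = β.1.src) : G.PathN (k + p) :=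
  ⟨β.1.comp γ.1 h, by rw [Path.comp_len, β.2, γ.2, add_comm]⟩

theorem PathN.exists_eq_comp (β : G.PathN p) (α : G.PathN (k + p)) {γ : G.Path}
    {h : γ.rng = β.1.src} (hα : α.1 = β.1.comp γ h) :
    ∃ (δ : G.PathN k) (h : δ.1.rng = β.1.src), α = PathN.comp β δ h := by
  have hlen := α.2
  rw [hα, Path.comp_len, β.2] at hlen
  exact ⟨⟨γ, by lia⟩, h, Subtype.ext hα⟩

theorem tensorLeft_apply_comp (β : G.PathN p) (γ : G.PathN k) (h : γ.1.rng = β.1.src)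
    (x : Ell2 (G.PathN k)) : G.tensorLeft p k β x (PathN.comp β γ h) = x γ :=
  partialOp_apply (i := γ) _ _ _ x ⟨h, rfl, rfl⟩

theorem tensorLeft_apply_of_ne (β : G.PathN p) (α : G.PathN (k + p))
    (hα : ∀ γ h, α ≠ PathN.comp β γ h) (x : Ell2 (G.PathN k)) : G.tensorLeft p k β x α = 0 :=
  partialOp_apply_of_not (j := α) _ _ _ x fun γ hγ =>
    hα γ hγ.1 (Subtype.ext (Path.ext hγ.2.1 hγ.2.2))

theorem adjoint_tensorLeft_apply (β : G.PathN p) (γ : G.PathN k) (h : γ.1.rng = β.1.src)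
    (x : Ell2 (G.PathN (k + p))) :
    ContinuousLinearMap.adjoint (G.tensorLeft p k β) x γ = x (PathN.comp β γ h) :=
  adjoint_partialOp_apply (i := γ) _ _ _ x ⟨h, rfl, rfl⟩

theorem adjoint_tensorLeft_apply_of_ne (β : G.PathN p) (γ : G.PathN k)
    (h : γ.1.rng ≠ β.1.src) (x : Ell2 (G.PathN (k + p))) :
    ContinuousLinearMap.adjoint (G.tensorLeft p k β) x γ = 0 :=
  adjoint_partialOp_apply_of_not (i := γ) _ _ _ x fun _ hγ => h hγ.1

theorem norm_tensorLeft_apply_le (β : G.PathN p) (x : Ell2 (G.PathN k)) :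
    ‖G.tensorLeft p k β x‖ ≤ ‖x‖ := by
  have h := (G.tensorLeft p k β).le_of_opNorm_le (norm_partialOp_le _ _ _) x
  rwa [one_mul] at h

theorem adjoint_tensorLeft_tensorLeft [Finite V] [DecidableEq V] (β : G.PathN p)
    (x : Ell2 (G.PathN k)) :
    ContinuousLinearMap.adjoint (G.tensorLeft p k β) (G.tensorLeft p k β x) =
      G.leftN k (Pi.single β.1.src 1) x := by
  ext γ
  rw [leftN, diagOp_apply, Pi.single_apply, ite_mul, one_mul, zero_mul]
  split_ifs with h
  · rw [adjoint_tensorLeft_apply β γ h, tensorLeft_apply_comp]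
  · exact adjoint_tensorLeft_apply_of_ne β γ h _

theorem adjoint_tensorLeft_tensorLeft_of_ne {β β' : G.PathN p} (hne : β' ≠ β)
    (x : Ell2 (G.PathN k)) :
    ContinuousLinearMap.adjoint (G.tensorLeft p k β') (G.tensorLeft p k β x) = 0 := by
  ext γ
  by_cases h : γ.1.rng = β'.1.src
  · rw [adjoint_tensorLeft_apply β' γ h]
    refine tensorLeft_apply_of_ne β _ (fun δ hδ H => hne (Subtype.ext ?_)) x
    exact (Path.comp_inj (h := h) (h' := hδ) (β'.2.trans β.2.symm) (congrArg Subtype.val H)).1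
  · exact adjoint_tensorLeft_apply_of_ne β' γ h _

theorem tensorLeft_leftN [Finite V] [DecidableEq V] (β : G.PathN p) (x : Ell2 (G.PathN k)) :
    G.tensorLeft p k β (G.leftN k (Pi.single β.1.src 1) x) = G.tensorLeft p k β x := by
  ext α
  by_cases h : ∃ γ h, α = PathN.comp β γ h
  · obtain ⟨γ, h, rfl⟩ := h
    rw [tensorLeft_apply_comp, tensorLeft_apply_comp, leftN, diagOp_apply, Pi.single_apply,
      if_pos h, one_mul]
  · push Not at h
    rw [tensorLeft_apply_of_ne _ _ h, tensorLeft_apply_of_ne _ _ h]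

theorem tensorId_tensorLeft [Finite V] [Finite E] [DecidableEq V]
    {T : Ell2 (G.PathN k) →L[ℂ] Ell2 (G.PathN k)} (β : G.PathN p)
    (hT : T * G.leftN k (Pi.single β.1.src 1) = G.leftN k (Pi.single β.1.src 1) * T)
    (x : Ell2 (G.PathN k)) :
    G.tensorId p k T (G.tensorLeft p k β x) = G.tensorLeft p k β (T x) := by
  rw [tensorId, sum_apply, Finset.sum_eq_single β]
  · rw [ContinuousLinearMap.comp_apply, ContinuousLinearMap.comp_apply,
      adjoint_tensorLeft_tensorLeft, ← mul_apply_eq_comp, hT,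
      mul_apply_eq_comp, tensorLeft_leftN]
  · intro β' _ hne
    rw [ContinuousLinearMap.comp_apply, ContinuousLinearMap.comp_apply,
      adjoint_tensorLeft_tensorLeft_of_ne hne, map_zero, map_zero]
  · exact fun h => absurd (Finset.mem_univ β) h

theorem ext_component {x y : Ell2 G.Path} (h : ∀ k, G.component k x = G.component k y) :
    x = y := by
  ext α
  have hα := congrArg (fun z : Ell2 (G.PathN α.len) => z ⟨α, rfl⟩) (h α.len)
  rwa [component_apply, component_apply] at hα

theorem hasSum_inner_component (x y : Ell2 G.Path) :
    HasSum (fun k => inner ℂ (G.component k x) (G.component k y)) (inner ℂ x y) := by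
  have hsigma := lp.hasSum_inner (𝕜 := ℂ) x y
  rw [← (Equiv.sigmaFiberEquiv (Path.len (G := G))).hasSum_iff] at hsigma
  refine hsigma.sigma fun k => ?_
  have hk := lp.hasSum_inner (𝕜 := ℂ) (G.component k x) (G.component k y)
  simp only [component_apply] at hk
  exact hk

theorem hasSum_norm_component (x : Ell2 G.Path) :
    HasSum (fun k => ‖G.component k x‖ ^ 2) (‖x‖ ^ 2) := by
  have h := Complex.hasSum_re (hasSum_inner_component x x)
  simp only [inner_self_eq_norm_sq_to_K] at h
  norm_cast at h

theorem norm_le_of_component {x y : Ell2 G.Path} {c : ℝ} (hc : 0 ≤ c) (d : ℕ)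
    (hlow : ∀ j < d, G.component j y = 0)
    (h : ∀ k, ‖G.component (k + d) y‖ ≤ c * ‖G.component k x‖) : ‖y‖ ≤ c * ‖x‖ := by
  have hy := hasSum_norm_component y
  rw [← hasSum_nat_add_iff' d, Finset.sum_eq_zero, sub_zero] at hy
  · have hx := (hasSum_norm_component x).mul_left (c ^ 2)
    refine le_of_sq_le_sq ?_ (by positivity)
    rw [mul_pow]
    refine hasSum_le (fun k => ?_) hy hx
    rw [← mul_pow]
    gcongr
    exact h k
  · intro j hj
    rw [hlow j (Finset.mem_range.1 hj), norm_zero, zero_pow two_ne_zero]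

end Components

section Weight
variable [Fintype V]

theorem component_gauge (t : ℝ) (x : Ell2 G.Path) (k : ℕ) :
    G.component k ((G.gauge t).1 x) = Complex.exp (Complex.I * k * t) • G.component k x := by
  ext α
  rw [component_apply, gauge, diagOp_apply, lp.coeFn_smul, Pi.smul_apply, component_apply, α.2]
  rfl

theorem component_P [DecidableEq V] (v : V) (x : Ell2 G.Path) (k : ℕ) :
    G.component k ((G.P v).1 x) = G.leftN k (Pi.single v 1) (G.component k x) := by
  ext α
  rw [component_apply, P_apply, leftN, diagOp_apply, component_apply, Pi.single_apply, ite_mul,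
    one_mul, zero_mul]
  congr

theorem component_Spath {p : ℕ} (β : G.PathN p) (x : Ell2 G.Path) (k : ℕ) :
    G.component (k + p) ((G.Spath β.1).1 x) = G.tensorLeft p k β (G.component k x) := by
  ext α
  rw [component_apply]
  by_cases h : ∃ γ h, α = PathN.comp β γ h
  · obtain ⟨γ, h, rfl⟩ := h
    rw [tensorLeft_apply_comp, component_apply]
    exact Spath_apply_comp _ _ h x
  · push Not at h
    rw [tensorLeft_apply_of_ne _ _ h]
    refine Spath_apply_of_ne _ _ (fun γ hγ hα => ?_) x
    obtain ⟨δ, hδ, hαδ⟩ := PathN.exists_eq_comp β α hα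
    exact h δ hδ hαδ

theorem component_Spath_of_lt {p j : ℕ} (β : G.PathN p) (x : Ell2 G.Path) (hj : j < p) :
    G.component j ((G.Spath β.1).1 x) = 0 := by
  ext α
  rw [component_apply]
  refine Spath_apply_of_ne _ _ (fun γ h hα => ?_) x
  have hlen := congrArg Path.len hα
  rw [Path.comp_len, α.2, β.2] at hlen
  lia

theorem gauge_mul_Spath (t : ℝ) (α : G.Path) :
    G.gauge t * G.Spath α = Complex.exp (Complex.I * α.len * t) • (G.Spath α * G.gauge t) := by
  refine Subtype.ext (ContinuousLinearMap.ext fun x => ext_component fun k => ?_)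
  change G.component k ((G.gauge t).1 ((G.Spath α).1 x)) =
    G.component k (Complex.exp (Complex.I * α.len * t) • (G.Spath α).1 ((G.gauge t).1 x))
  rw [component_gauge, map_smul]
  by_cases hk : k < α.len
  · rw [component_Spath_of_lt ⟨α, rfl⟩ _ hk, component_Spath_of_lt ⟨α, rfl⟩ _ hk, smul_zero,
      smul_zero]
  · obtain ⟨j, rfl⟩ := Nat.exists_eq_add_of_le' (not_lt.1 hk)
    rw [component_Spath ⟨α, rfl⟩, component_Spath ⟨α, rfl⟩, component_gauge, map_smul, smul_smul,
      ← Complex.exp_add]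
    congr 2
    push_cast
    ring

theorem mem_compacts_of_norm_component_le [Finite E] (T : G.L) (d : ℕ) {c : ℕ → ℝ}
    (hc : Filter.Tendsto c Filter.atTop (nhds 0))
    (hlow : ∀ x, ∀ j < d, G.component j (T.1 x) = 0)
    (hT : ∀ x k, ‖G.component (k + d) (T.1 x)‖ ≤ c k * ‖G.component k x‖) :
    T ∈ compacts (Path.src (G := G)) := by
  have hclosed : IsClosed (compacts (Path.src (G := G)) : Set G.L) := IsCStarIdeal.closed
  rw [← SetLike.mem_coe, ← hclosed.closure_eq, Metric.mem_closure_iff]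
  intro ε hε
  obtain ⟨N, hN⟩ := Filter.eventually_atTop.1 (hc.eventually (gt_mem_nhds (half_pos hε)))
  refine ⟨T * G.lowProj N, Ideal.mul_mem_left _ _ (lowProj_mem_compacts N), ?_⟩
  rw [dist_eq_norm]
  refine lt_of_le_of_lt ?_ (half_lt_self hε)
  refine ContinuousLinearMap.opNorm_le_bound _ (half_pos hε).le fun x => ?_
  have hcomp : ∀ k, G.component k (x - (G.lowProj N).1 x) =
      if k < N then 0 else G.component k x := by
    intro k
    ext α
    rw [component_apply, lp.coeFn_sub, Pi.sub_apply, lowProj_apply, α.2]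
    split_ifs
    · exact sub_self _
    · rw [sub_zero, component_apply]
  have hsub : (T - T * G.lowProj N).1 x = T.1 (x - (G.lowProj N).1 x) := (map_sub T.1 _ _).symm
  change ‖(T - T * G.lowProj N).1 x‖ ≤ _
  rw [hsub]
  refine norm_le_of_component (half_pos hε).le d (hlow _) fun k => (hT _ k).trans ?_
  rw [hcomp]
  split_ifs with hk
  · rw [norm_zero, mul_zero]
    positivity
  · gcongr
    exact (hN k (not_lt.1 hk)).le

variable [Fintype E] (Z : G.WeightSeq)

theorem component_weight (x : Ell2 G.Path) (k : ℕ) :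
    G.component k ((G.weight Z).1 x) = Z.Z k (G.component k x) := by
  ext α
  obtain ⟨α, rfl⟩ := α
  rw [component_apply]
  rfl

theorem weight_mul_P (v : V) : G.weight Z * G.P v = G.P v * G.weight Z := by
  classical
  refine Subtype.ext (ContinuousLinearMap.ext fun x => ext_component fun k => ?_)
  change G.component k ((G.weight Z).1 ((G.P v).1 x)) =
    G.component k ((G.P v).1 ((G.weight Z).1 x))
  rw [component_weight, component_P, component_P, component_weight]
  exact congrArg (fun T => T (G.component k x)) (Z.comm_left k (Pi.single v 1))

theorem gauge_mul_weight (t : ℝ) : G.gauge t * G.weight Z = G.weight Z * G.gauge t := by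
  refine Subtype.ext (ContinuousLinearMap.ext fun x => ext_component fun k => ?_)
  change G.component k ((G.gauge t).1 ((G.weight Z).1 x)) =
    G.component k ((G.weight Z).1 ((G.gauge t).1 x))
  rw [component_weight, component_gauge, component_gauge, component_weight, map_smul]

theorem weight_mul_Spath_sub_mem_compacts {p : ℕ} (hA : G.ConditionA Z p) (β : G.PathN p) :
    G.weight Z * G.Spath β.1 - G.Spath β.1 * G.weight Z ∈ compacts (Path.src (G := G)) := by
  classical
  have sub_eq : ∀ x, (G.weight Z * G.Spath β.1 - G.Spath β.1 * G.weight Z).1 x =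
      (G.weight Z).1 ((G.Spath β.1).1 x) - (G.Spath β.1).1 ((G.weight Z).1 x) := fun _ => rfl
  refine mem_compacts_of_norm_component_le _ p hA (fun x j hj => ?_) fun x k => ?_
  · rw [sub_eq, map_sub, component_weight, component_Spath_of_lt _ _ hj,
      component_Spath_of_lt _ _ hj, map_zero, sub_zero]
  · rw [sub_eq, map_sub, component_weight, component_Spath, component_Spath, component_weight,
      ← tensorId_tensorLeft β (Z.comm_left k _), ← sub_apply, norm_sub_rev]
    exact (ContinuousLinearMap.le_opNorm _ _).trans
      (mul_le_mul_of_nonneg_left (norm_tensorLeft_apply_le β _) (norm_nonneg _))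

end Weight

open scoped ComplexOrder in
theorem isPositive_of_component {T : Ell2 G.Path →L[ℂ] Ell2 G.Path}
    {T' : ∀ k, Ell2 (G.PathN k) →L[ℂ] Ell2 (G.PathN k)} (hT' : ∀ k, (T' k).IsPositive)
    (hT : ∀ x k, G.component k (T x) = T' k (G.component k x)) : T.IsPositive := by
  rw [ContinuousLinearMap.isPositive_iff]
  constructor
  · intro x y
    refine HasSum.unique (hasSum_inner_component _ _) ?_
    convert hasSum_inner_component x _ using 2 with k
    rw [ContinuousLinearMap.coe_coe, hT, hT]
    exact (hT' k).isSymmetric _ _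
  · intro x
    refine (hasSum_inner_component _ _).nonneg fun k => ?_
    rw [hT]
    exact (hT' k).inner_nonneg_left _

open scoped ComplexOrder in
theorem isPositive_sub_smul_one_of_le {H : Type*} [NormedAddCommGroup H] [InnerProductSpace ℂ H]
    [CompleteSpace H] {T : H →L[ℂ] H} {δ ε : ℝ} (h : δ ≤ ε) (hT : (T - (ε : ℂ) • 1).IsPositive) :
    (T - (δ : ℂ) • 1).IsPositive := by
  have hnonneg : (0 : ℂ) ≤ (ε : ℂ) - (δ : ℂ) := by
    rw [← Complex.ofReal_sub]
    exact_mod_cast sub_nonneg.2 h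
  convert hT.add (ContinuousLinearMap.isPositive_one.smul_of_nonneg hnonneg) using 1
  rw [sub_smul]
  abel

theorem exists_isPositive_weight_sub [Fintype V] [Fintype E] (Z : G.WeightSeq) :
    ∃ ε : ℝ, 0 < ε ∧ ((G.weight Z).1 - (ε : ℂ) • 1).IsPositive := by
  obtain ⟨ε, hε, hZ⟩ := Z.lower
  refine ⟨min ε 1, lt_min hε one_pos,
    isPositive_of_component (T' := fun k => Z.Z k - ((min ε 1 : ℝ) : ℂ) • 1) (fun k => ?_) ?_⟩
  · rcases Nat.eq_zero_or_pos k with rfl | hk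
    · refine isPositive_sub_smul_one_of_le (min_le_right ε 1) ?_
      rw [Z.zero_eq, Complex.ofReal_one, one_smul, sub_self]
      exact ContinuousLinearMap.isPositive_zero
    · exact isPositive_sub_smul_one_of_le (min_le_left ε 1) (hZ k hk)
  · intro x k
    change G.component k ((G.weight Z).1 x - ((min ε 1 : ℝ) : ℂ) • x) = _
    rw [map_sub, component_weight, map_smul]
    rfl

end DirGraph

/-! ### Cuntz–Krieger families and periodic weights -/

namespace DirGraph
variable {V E : Type*} {G : DirGraph V E} {B : Type*} [Ring B] [StarRing B]

section VertexCommutant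
variable [Algebra ℂ B] [StarModule ℂ B] {u : G.Path → B}

/-- The commutant of the vertex projections. -/
def vertexCommutant (u : G.Path → B) : StarSubalgebra ℂ B :=
  StarSubalgebra.centralizer ℂ (Set.range fun v => u (Path.vertex G v))

theorem commute_vertex {x : B} (hx : x ∈ vertexCommutant u) (v : V) :
    u (Path.vertex G v) * x = x * u (Path.vertex G v) :=
  ((StarSubalgebra.mem_centralizer_iff ℂ).1 hx _ ⟨v, rfl⟩).1

end VertexCommutant

variable [Finite V] [Finite E]

/-- The Cuntz–Krieger relations for a family indexed by all paths, so that `u (vertex v)` is the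
projection of the vertex `v`. Completeness is required along the paths of every fixed length. -/
structure IsCuntzKriegerFamily (u : G.Path → B) : Prop where
  comp (α β : G.Path) (h : β.rng = α.src) : u (α.comp β h) = u α * u β
  mul_eq_zero {α β : G.Path} (h : α.src ≠ β.rng) : u α * u β = 0
  star_mul_self (α : G.Path) : star (u α) * u α = u (Path.vertex G α.src)
  star_mul_eq_zero {α β : G.Path} (hlen : α.len = β.len) (h : α ≠ β) : star (u α) * u β = 0
  sum_path (k : ℕ) : ∑ μ : G.PathN k, u μ * star (u μ) = 1

namespace IsCuntzKriegerFamily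
variable {u : G.Path → B} (hu : IsCuntzKriegerFamily u)
include hu

theorem vertex_mul {v : V} {α : G.Path} (h : α.rng = v) : u (Path.vertex G v) * u α = u α :=
  (hu.comp (Path.vertex G v) α h).symm

theorem mul_vertex {v : V} {α : G.Path} (h : α.src = v) : u α * u (Path.vertex G v) = u α := by
  rw [← h, ← hu.comp _ _ (Path.vertex_rng _), Path.comp_vertex]

theorem star_vertex (v : V) : star (u (Path.vertex G v)) = u (Path.vertex G v) := by
  rw [← Path.vertex_src (G := G) v, ← hu.star_mul_self, star_mul, star_star]

theorem mul_star_mul_self (α : G.Path) : u α * star (u α) * u α = u α := by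
  rw [mul_assoc, hu.star_mul_self, hu.mul_vertex rfl]

end IsCuntzKriegerFamily

section Shift

/-- The conditional shift `x ↦ ∑ u_μ x u_μ*`, the sum over all paths `μ` of length `k`. -/
def shift (u : G.Path → B) (k : ℕ) (x : B) : B := ∑ μ : G.PathN k, u μ * x * star (u μ)

variable {u : G.Path → B} {x y : B} {k l : ℕ}

theorem shift_add (x y : B) : shift u k (x + y) = shift u k x + shift u k y := by
  simp only [shift, mul_add, add_mul, Finset.sum_add_distrib]

theorem star_shift (x : B) : star (shift u k x) = shift u k (star x) := by
  simp only [shift, star_sum, star_mul, star_star, mul_assoc]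

theorem IsCuntzKriegerFamily.eq_shift (hu : IsCuntzKriegerFamily u)
    (hy : ∀ α : G.Path, α.len = k → y * u α = u α * x) :
    y = shift u k x := by
  rw [← mul_one y, ← hu.sum_path k, Finset.mul_sum]
  exact Finset.sum_congr rfl fun μ _ => by rw [← mul_assoc, hy μ μ.2]

theorem IsCuntzKriegerFamily.shift_zero (hu : IsCuntzKriegerFamily u)
    (hx : ∀ v, x * u (Path.vertex G v) = u (Path.vertex G v) * x) :
    shift u 0 x = x :=
  (hu.eq_shift fun α hα => by rw [Path.eq_vertex hα, hx]).symm

variable [Algebra ℂ B]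

theorem IsCuntzKriegerFamily.shift_algebraMap (hu : IsCuntzKriegerFamily u) (c : ℂ) :
    shift u k (algebraMap ℂ B c) = algebraMap ℂ B c := by
  simp only [shift, ← Algebra.commutes c, mul_assoc, ← Finset.mul_sum, hu.sum_path, mul_one]

variable [StarModule ℂ B]

namespace IsCuntzKriegerFamily
variable (hu : IsCuntzKriegerFamily u)
include hu

theorem mem_vertexCommutant (hx : ∀ v, u (Path.vertex G v) * x = x * u (Path.vertex G v)) :
    x ∈ vertexCommutant u := by
  rw [vertexCommutant, StarSubalgebra.mem_centralizer_iff]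
  rintro _ ⟨v, rfl⟩
  exact ⟨hx v, by rw [hu.star_vertex, hx]⟩

theorem shift_mul (hx : x ∈ vertexCommutant u) {α : G.Path} (hα : α.len = k) :
    shift u k x * u α = u α * x := by
  rw [shift, Finset.sum_mul, Finset.sum_eq_single ⟨α, hα⟩]
  · rw [mul_assoc, hu.star_mul_self, mul_assoc, ← commute_vertex hx, ← mul_assoc,
      hu.mul_vertex rfl]
  · intro μ _ hμ
    rw [mul_assoc, hu.star_mul_eq_zero (μ.2.trans hα.symm) (fun h => hμ (Subtype.ext h)),
      mul_zero]
  · exact fun h => absurd (Finset.mem_univ _) h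

theorem shift_mem_vertexCommutant (x : B) : shift u k x ∈ vertexCommutant u := by
  refine hu.mem_vertexCommutant fun v => ?_
  rw [shift, Finset.mul_sum, Finset.sum_mul]
  refine Finset.sum_congr rfl fun μ _ => ?_
  rw [mul_assoc _ (star (u μ)), ← hu.star_vertex v, ← star_mul, hu.star_vertex, ← mul_assoc,
    ← mul_assoc]
  by_cases h : μ.1.rng = v
  · rw [hu.vertex_mul h]
  · rw [hu.mul_eq_zero (Ne.symm h), zero_mul, zero_mul, star_zero, mul_zero]

theorem shift_mul_shift (hx : x ∈ vertexCommutant u) (hy : y ∈ vertexCommutant u) :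
    shift u k x * shift u k y = shift u k (x * y) :=
  hu.eq_shift fun α hα => by
    rw [mul_assoc, hu.shift_mul hy hα, ← mul_assoc, hu.shift_mul hx hα, mul_assoc]

theorem shift_shift (hx : x ∈ vertexCommutant u) :
    shift u k (shift u l x) = shift u (k + l) x :=
  hu.eq_shift fun α hα => by
    obtain ⟨β, γ, h, hβ, rfl⟩ := α.exists_comp_eq ((Nat.le_add_right k l).trans hα.ge)
    rw [Path.comp_len, hβ, Nat.add_left_cancel_iff] at hα
    rw [hu.comp, ← mul_assoc, hu.shift_mul (hu.shift_mem_vertexCommutant x) hβ, mul_assoc,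
      hu.shift_mul hx hα, mul_assoc]

end IsCuntzKriegerFamily

end Shift

section PeriodicWeight
variable [Algebra ℂ B] [StarModule ℂ B] {u : G.Path → B} {p : ℕ} {z : B}

/-- `z` commutes with the vertex projections and with `u_β` for all paths `β` of length `p`. -/
structure IsPeriodicWeight (u : G.Path → B) (p : ℕ) (z : B) : Prop where
  mem_vertexCommutant : z ∈ vertexCommutant u
  mul_of_len {β : G.Path} (hβ : β.len = p) : z * u β = u β * z

/-- The element `z_m` such that `z u_α = u_α z_m` for all paths `α` of length `m`, for a weight `z`
of period `p ≥ 1`. Shifting `(p - 1) m` times undoes `m` shifts, as `p m` shifts fix `z`. -/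
def weightShift (u : G.Path → B) (p : ℕ) (z : B) (m : ℕ) : B := shift u ((p - 1) * m) z

/-- The `⋆`-algebra generated by the elements `z_m`. -/
def weightAlg (u : G.Path → B) (p : ℕ) (z : B) : StarSubalgebra ℂ B :=
  StarAlgebra.adjoin ℂ (Set.range (weightShift u p z))

theorem weightShift_mem_weightAlg (m : ℕ) : weightShift u p z m ∈ weightAlg u p z :=
  StarAlgebra.subset_adjoin ℂ _ ⟨m, rfl⟩

theorem IsCuntzKriegerFamily.weightAlg_le_vertexCommutant (hu : IsCuntzKriegerFamily u) :
    weightAlg u p z ≤ vertexCommutant u :=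
  StarAlgebra.adjoin_le <| by
    rintro _ ⟨m, rfl⟩
    exact hu.shift_mem_vertexCommutant z

namespace IsPeriodicWeight
variable (hz : IsPeriodicWeight u p z) (hu : IsCuntzKriegerFamily u)
include hz hu

theorem shift_period_mul (j : ℕ) : shift u (p * j) z = z := by
  induction j with
  | zero => exact hu.shift_zero fun v => (commute_vertex hz.mem_vertexCommutant v).symm
  | succ j ih =>
    rw [mul_add_one, ← hu.shift_shift hz.mem_vertexCommutant,
      ← hu.eq_shift fun _ => hz.mul_of_len, ih]

theorem shift_weightShift_add (hp : 1 ≤ p) (k m : ℕ) :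
    shift u k (weightShift u p z (m + k)) = weightShift u p z m := by
  have hexp : k + (p - 1) * (m + k) = (p - 1) * m + p * k := by
    obtain ⟨r, rfl⟩ := Nat.exists_eq_add_of_le' hp
    rw [Nat.add_sub_cancel]
    ring
  rw [weightShift, weightShift, hu.shift_shift hz.mem_vertexCommutant, hexp,
    ← hu.shift_shift hz.mem_vertexCommutant, hz.shift_period_mul hu]

theorem weightShift_zero : weightShift u p z 0 = z :=
  hz.shift_period_mul hu 0

theorem weightShift_mod (m : ℕ) : weightShift u p z (m % p) = weightShift u p z m := by
  conv_rhs => rw [← Nat.mod_add_div m p, weightShift, mul_add, mul_left_comm,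
    ← hu.shift_shift hz.mem_vertexCommutant, hz.shift_period_mul hu]
  rfl

theorem shift_weightShift (hp : 1 ≤ p) (m : ℕ) : shift u m (weightShift u p z m) = z := by
  simpa only [zero_add, hz.weightShift_zero hu] using hz.shift_weightShift_add hu hp m 0

theorem mul_eq_mul_weightShift (hp : 1 ≤ p) (α : G.Path) :
    z * u α = u α * weightShift u p z α.len := by
  rw [weightShift, ← hu.shift_mul (hu.shift_mem_vertexCommutant z) rfl, ← weightShift,
    hz.shift_weightShift hu hp]

theorem exists_shift_eq (hp : 1 ≤ p) (k : ℕ) {b : B} (hb : b ∈ weightAlg u p z) :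
    ∃ b' ∈ weightAlg u p z, shift u k b' = b := by
  induction hb using StarAlgebra.adjoin_induction with
  | mem _ h =>
    obtain ⟨m, rfl⟩ := h
    exact ⟨_, weightShift_mem_weightAlg _, hz.shift_weightShift_add hu hp k m⟩
  | algebraMap c => exact ⟨_, algebraMap_mem _ c, hu.shift_algebraMap c⟩
  | add _ _ _ _ h₁ h₂ =>
    obtain ⟨b₁, hb₁, rfl⟩ := h₁
    obtain ⟨b₂, hb₂, rfl⟩ := h₂
    exact ⟨b₁ + b₂, add_mem hb₁ hb₂, shift_add b₁ b₂⟩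
  | mul _ _ _ _ h₁ h₂ =>
    obtain ⟨b₁, hb₁, rfl⟩ := h₁
    obtain ⟨b₂, hb₂, rfl⟩ := h₂
    exact ⟨b₁ * b₂, mul_mem hb₁ hb₂,
      (hu.shift_mul_shift (hu.weightAlg_le_vertexCommutant hb₁)
        (hu.weightAlg_le_vertexCommutant hb₂)).symm⟩
  | star _ _ h =>
    obtain ⟨b, hb, rfl⟩ := h
    exact ⟨star b, star_mem hb, (star_shift b).symm⟩

theorem weightShift_one_mul_self_mem (hp : 1 ≤ p) (no_sinks : ∀ v, ∃ e, G.s e = v)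
    {S : NonUnitalStarSubalgebra ℂ B} (hS : ∀ e, z * u (Path.edge G e) ∈ S)
    (hsa : IsSelfAdjoint z) :
    weightShift u p z 1 * weightShift u p z 1 ∈ S := by
  set y := weightShift u p z 1
  have hy : y ∈ vertexCommutant u := hu.shift_mem_vertexCommutant z
  have hy_star : star y = y := by simp only [y, weightShift, star_shift, hsa.star_eq]
  rw [← hu.shift_zero (x := y * y) fun v => (commute_vertex (mul_mem hy hy) v).symm]
  refine sum_mem fun μ _ => ?_
  obtain ⟨e, he⟩ := no_sinks μ.1.src
  set P := u (Path.vertex G μ.1.src)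
  have hμ : u μ = P := congrArg u (Path.eq_vertex μ.2)
  have hP_star : star P = P := hu.star_vertex _
  have hPP : P * P = P := hu.vertex_mul rfl
  have hPy : P * y = y * P := commute_vertex hy _
  have hP : star (u (Path.edge G e)) * u (Path.edge G e) = P := by
    rw [hu.star_mul_self, Path.edge_src, he]
  have hzu : z * u (Path.edge G e) = u (Path.edge G e) * y := hz.mul_eq_mul_weightShift hu hp _
  have hterm : u μ * (y * y) * star (u μ) =
      star (z * u (Path.edge G e)) * (z * u (Path.edge G e)) := by
    calc u μ * (y * y) * star (u μ) = P * y * (y * P) := by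
          rw [hμ, hP_star]
          simp only [mul_assoc]
      _ = y * P * (P * y) := by rw [hPy]
      _ = y * (P * P) * y := by simp only [mul_assoc]
      _ = y * (star (u (Path.edge G e)) * u (Path.edge G e)) * y := by rw [hPP, hP]
      _ = star (z * u (Path.edge G e)) * (z * u (Path.edge G e)) := by
          rw [hzu, star_mul, hy_star]
          simp only [mul_assoc]
  rw [hterm]
  exact mul_mem (star_mem (hS e)) (hS e)

end IsPeriodicWeight

end PeriodicWeight

end DirGraph

namespace DirGraph
variable {V E : Type*} {G : DirGraph V E}

section PathSpan
variable [Finite V] [Finite E] {B : Type*} [Ring B] [StarRing B] [Algebra ℂ B] [StarModule ℂ B]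
  {u : G.Path → B} {p : ℕ} {z : B}

/-- The linear span of the elements `u_α b u_β*` with `|α| = m`, `|β| = n` and `b` in the algebra
generated by the shifts of the weight `z`. These spans multiply like spaces of matrices whose rows
and columns are indexed by paths. -/
def pathSpan (u : G.Path → B) (p : ℕ) (z : B) (m n : ℕ) : Submodule ℂ B :=
  Submodule.span ℂ {x | ∃ α β : G.Path, α.len = m ∧ β.len = n ∧ ∃ b ∈ weightAlg u p z,
    x = u α * b * star (u β)}

theorem mul_mul_star_mem_pathSpan {m n : ℕ} {α β : G.Path} (hα : α.len = m) (hβ : β.len = n)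
    {b : B} (hb : b ∈ weightAlg u p z) : u α * b * star (u β) ∈ pathSpan u p z m n :=
  Submodule.subset_span ⟨α, β, hα, hβ, b, hb, rfl⟩

theorem mul_star_mem_pathSpan {m n : ℕ} {α β : G.Path} (hα : α.len = m) (hβ : β.len = n) :
    u α * star (u β) ∈ pathSpan u p z m n := by
  simpa only [mul_one] using mul_mul_star_mem_pathSpan (u := u) (p := p) (z := z) hα hβ (one_mem _)

theorem star_mem_pathSpan {m n : ℕ} {x : B} (hx : x ∈ pathSpan u p z m n) :
    star x ∈ pathSpan u p z n m := by
  induction hx using Submodule.span_induction with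
  | mem _ h =>
    obtain ⟨α, β, hα, hβ, b, hb, rfl⟩ := h
    rw [star_mul, star_mul, star_star, ← mul_assoc]
    exact mul_mul_star_mem_pathSpan hβ hα (star_mem hb)
  | zero => rw [star_zero]; exact zero_mem _
  | add _ _ _ _ hx hy => rw [star_add]; exact add_mem hx hy
  | smul c _ _ hx => rw [star_smul]; exact Submodule.smul_mem _ _ hx

namespace IsCuntzKriegerFamily
variable (hu : IsCuntzKriegerFamily u)
include hu

theorem mul_mul_star_eq_zero {b : B} (hb : b ∈ weightAlg u p z) {α β : G.Path}
    (h : α.src ≠ β.src) : u α * b * star (u β) = 0 := by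
  rw [← hu.mul_vertex (α := β) rfl, star_mul, hu.star_vertex, mul_assoc (u α), ← mul_assoc b,
    ← commute_vertex (hu.weightAlg_le_vertexCommutant hb), mul_assoc, ← mul_assoc (u α),
    hu.mul_eq_zero h, zero_mul]

theorem pathSpan_mul_le (l m n : ℕ) :
    pathSpan u p z l m * pathSpan u p z m n ≤ pathSpan u p z l n := by
  rw [pathSpan, pathSpan, Submodule.span_mul_span, Submodule.span_le]
  rintro _ ⟨_, ⟨α, β, hα, hβ, b, hb, rfl⟩, _, ⟨β', γ, hβ', hγ, b', hb', rfl⟩, rfl⟩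
  have hassoc : u α * b * star (u β) * (u β' * b' * star (u γ)) =
      u α * b * (star (u β) * u β') * b' * star (u γ) := by
    simp only [mul_assoc]
  simp only [SetLike.mem_coe, hassoc]
  by_cases h : β = β'
  · rw [h, hu.star_mul_self, mul_assoc (u α * b),
      commute_vertex (hu.weightAlg_le_vertexCommutant hb'), ← mul_assoc, mul_assoc (u α),
      mul_assoc _ _ (star (u γ)), ← hu.star_vertex, ← star_mul]
    by_cases hsrc : γ.src = β'.src
    · rw [hu.mul_vertex hsrc]
      exact mul_mul_star_mem_pathSpan hα hγ (mul_mem hb hb')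
    · rw [hu.mul_eq_zero hsrc, star_zero, mul_zero]
      exact zero_mem _
  · rw [hu.star_mul_eq_zero (hβ.trans hβ'.symm) h, mul_zero, zero_mul, zero_mul]
    exact zero_mem _

theorem mul_mem_pathSpan {l m n : ℕ} {x y : B} (hx : x ∈ pathSpan u p z l m)
    (hy : y ∈ pathSpan u p z m n) : x * y ∈ pathSpan u p z l n :=
  hu.pathSpan_mul_le l m n (Submodule.mul_mem_mul hx hy)

theorem star_mul_mul_eq_zero {n : ℕ} {x : B} (hx : x ∈ pathSpan u p z n n) {γ₁ γ₂ : G.Path}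
    (h₁ : γ₁.len = n) (h₂ : γ₂.len = n) (hsrc : γ₁.src ≠ γ₂.src) : star (u γ₁) * x * u γ₂ = 0 := by
  induction hx using Submodule.span_induction with
  | mem _ h =>
    obtain ⟨α, β, hα, hβ, b, hb, rfl⟩ := h
    rw [← mul_assoc, ← mul_assoc, mul_assoc _ (star (u β))]
    by_cases hα' : γ₁ = α
    · by_cases hβ' : β = γ₂
      · rw [← hα', hβ', hu.star_mul_self, hu.star_mul_self, ← hu.star_vertex γ₂.src]
        exact hu.mul_mul_star_eq_zero hb hsrc
      · rw [hu.star_mul_eq_zero (hβ.trans h₂.symm) hβ', mul_zero]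
    · rw [hu.star_mul_eq_zero (h₁.trans hα.symm) hα', zero_mul, zero_mul]
  | zero => rw [mul_zero, zero_mul]
  | add _ _ _ _ hx hy => rw [mul_add, add_mul, hx, hy, add_zero]
  | smul c _ _ hx => rw [mul_smul_comm, smul_mul_assoc, hx, smul_zero]

end IsCuntzKriegerFamily

namespace IsPeriodicWeight
variable (hz : IsPeriodicWeight u p z) (hu : IsCuntzKriegerFamily u)
include hz hu

theorem mem_weightAlg : z ∈ weightAlg u p z := by
  simpa only [hz.weightShift_zero hu] using weightShift_mem_weightAlg (u := u) (p := p) (z := z) 0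

theorem pathSpan_le_add (hp : 1 ≤ p) (m n k : ℕ) :
    pathSpan u p z m n ≤ pathSpan u p z (m + k) (n + k) := by
  refine Submodule.span_le.2 ?_
  rintro _ ⟨α, β, rfl, rfl, b, hb, rfl⟩
  obtain ⟨b, hb', rfl⟩ := hz.exists_shift_eq hu hp k hb
  have hsum : u α * shift u k b * star (u β) =
      ∑ ν : G.PathN k, u α * u ν * b * star (u β * u ν) := by
    simp only [shift, Finset.mul_sum, Finset.sum_mul, star_mul, mul_assoc]
  rw [SetLike.mem_coe, hsum]
  refine sum_mem fun ν _ => ?_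
  by_cases hα : ν.1.rng = α.src
  · by_cases hβ : ν.1.rng = β.src
    · rw [← hu.comp α ν hα, ← hu.comp β ν hβ]
      exact mul_mul_star_mem_pathSpan (by rw [Path.comp_len, ν.2])
        (by rw [Path.comp_len, ν.2]) hb'
    · rw [hu.mul_eq_zero (Ne.symm hβ), star_zero, mul_zero]
      exact zero_mem _
  · rw [hu.mul_eq_zero (Ne.symm hα), zero_mul, zero_mul]
    exact zero_mem _

theorem mul_weightShift_mul_star (hp : 1 ≤ p) {α ν : G.Path} (h : ν.rng = α.src) (β : G.Path) :
    u (α.comp ν h) * weightShift u p z ν.len * star (u β) =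
      u α * z * star (u α) * (u (α.comp ν h) * star (u β)) := by
  have hν : star (u α) * (u α * u ν) = u ν := by
    rw [← mul_assoc, hu.star_mul_self, hu.vertex_mul h]
  calc u (α.comp ν h) * weightShift u p z ν.len * star (u β)
      = u α * z * u ν * star (u β) := by
        rw [hu.comp, mul_assoc (u α), ← hz.mul_eq_mul_weightShift hu hp, ← mul_assoc (u α)]
    _ = u α * z * (star (u α) * (u α * u ν)) * star (u β) := by rw [hν]
    _ = _ := by
        rw [hu.comp]
        simp only [mul_assoc]

section Generators
variable (hp : 1 ≤ p) {n : ℕ} {S : NonUnitalStarSubalgebra ℂ B}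
  (hS : ∀ (α β : G.Path) (l : ℕ), n * p ≤ α.len → α.len = β.len → α.len < (n + 1) * p →
    α.src = β.src → u α * z ^ l * star (u β) ∈ S)
include hp hS

omit hz hu [Finite V] [Finite E] [StarModule ℂ B] in
theorem mul_star_mem_of_generators_mem {α β : G.Path} (hα : α.len = n * p + (p - 1))
    (hβ : β.len = n * p + (p - 1)) (hsrc : α.src = β.src) : u α * star (u β) ∈ S := by
  have hlt : α.len < (n + 1) * p := by
    rw [hα, add_one_mul]
    lia
  simpa only [pow_zero, mul_one] using
    hS α β 0 (hα ▸ Nat.le_add_right _ _) (hα.trans hβ.symm) hlt hsrc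

/-- Split off the last `m % p` edges of `α`: the element `z_m` is `z` moved past that part. -/
theorem mul_weightShift_mul_star_mem {α β : G.Path} (hα : α.len = n * p + (p - 1))
    (hβ : β.len = n * p + (p - 1)) (hsrc : α.src = β.src) (m : ℕ) :
    u α * weightShift u p z m * star (u β) ∈ S := by
  have hm : m % p < p := Nat.mod_lt _ hp
  have hunit := mul_star_mem_of_generators_mem hp hS hα hβ hsrc
  obtain ⟨α, ν, h, hlen, rfl⟩ := α.exists_comp_eq (k := n * p + (p - 1) - m % p) (by lia)
  rw [Path.comp_len, hlen] at hα
  have hν : ν.len = m % p := by lia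
  rw [← hz.weightShift_mod hu, ← hν, hz.mul_weightShift_mul_star hu hp h]
  refine mul_mem ?_ hunit
  have hlt : α.len < (n + 1) * p := by
    rw [hlen, add_one_mul]
    lia
  simpa only [pow_one] using hS α α 1 (by lia) rfl hlt rfl

theorem mul_mul_star_mem_of_generators_mem {α β : G.Path} (hα : α.len = n * p + (p - 1))
    (hβ : β.len = n * p + (p - 1)) (hsrc : α.src = β.src) {b : B} (hb : b ∈ weightAlg u p z) :
    u α * b * star (u β) ∈ S := by
  induction hb using StarAlgebra.adjoin_induction generalizing α β with
  | mem _ h =>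
    obtain ⟨m, rfl⟩ := h
    exact hz.mul_weightShift_mul_star_mem hu hp hS hα hβ hsrc m
  | algebraMap c =>
    rw [← Algebra.commutes c, mul_assoc, ← Algebra.smul_def]
    exact SMulMemClass.smul_mem c (mul_star_mem_of_generators_mem hp hS hα hβ hsrc)
  | add x y _ _ hx hy =>
    rw [mul_add, add_mul]
    exact add_mem (hx hα hβ hsrc) (hy hα hβ hsrc)
  | mul x y hx' _ hx hy =>
    have hsplit : u α * (x * y) * star (u β) =
        u α * x * star (u α) * (u α * y * star (u β)) := by
      have hxy : u α * x * (star (u α) * u α) = u α * x := by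
        rw [hu.star_mul_self, mul_assoc,
          ← commute_vertex (hu.weightAlg_le_vertexCommutant hx'), ← mul_assoc, hu.mul_vertex rfl]
      calc u α * (x * y) * star (u β) = u α * x * y * star (u β) := by rw [← mul_assoc (u α)]
        _ = u α * x * (star (u α) * u α) * y * star (u β) := by rw [hxy]
        _ = _ := by simp only [mul_assoc]
    rw [hsplit]
    exact mul_mem (hx hα hα rfl) (hy hα hβ hsrc)
  | star x _ hx =>
    have h := star_mem (hx hβ hα hsrc.symm)
    rwa [star_mul, star_mul, star_star, ← mul_assoc] at h

theorem pathSpan_subset_of_generators_mem :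
    (pathSpan u p z (n * p + (p - 1)) (n * p + (p - 1)) : Set B) ⊆ S := by
  refine Submodule.span_le (p := S.toSubmodule).2 ?_
  rintro _ ⟨α, β, hα, hβ, b, hb, rfl⟩
  by_cases hsrc : α.src = β.src
  · exact hz.mul_mul_star_mem_of_generators_mem hu hp hS hα hβ hsrc hb
  · rw [hu.mul_mul_star_eq_zero hb hsrc]
    exact zero_mem _

end Generators

end IsPeriodicWeight

end PathSpan

end DirGraph

namespace DirGraph
variable {V E : Type*} {G : DirGraph V E}

section DegreePart
variable [Finite V] [Finite E] {B : Type*} [Ring B] [StarRing B] [Algebra ℂ B] [StarModule ℂ B]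
  {u : G.Path → B} {p : ℕ} {z : B} {d e : ℤ} {x y : B}

/-- The linear span of the elements `u_α b u_β*` with `|α| = |β| + d` and `b` in the algebra
generated by the shifts of the weight `z`. -/
def degreePart (u : G.Path → B) (p : ℕ) (z : B) (d : ℤ) : Submodule ℂ B :=
  ⨆ mn : {mn : ℕ × ℕ // (mn.1 : ℤ) = mn.2 + d}, pathSpan u p z mn.1.1 mn.1.2

theorem pathSpan_le_degreePart {m n : ℕ} (h : (m : ℤ) = n + d) :
    pathSpan u p z m n ≤ degreePart u p z d :=
  le_iSup (fun mn : {mn : ℕ × ℕ // (mn.1 : ℤ) = mn.2 + d} => pathSpan u p z mn.1.1 mn.1.2)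
    ⟨(m, n), h⟩

theorem star_mem_degreePart (hx : x ∈ degreePart u p z d) : star x ∈ degreePart u p z (-d) := by
  induction hx using Submodule.iSup_induction' with
  | mem mn _ hx => exact pathSpan_le_degreePart (by have := mn.2; lia) (star_mem_pathSpan hx)
  | zero => rw [star_zero]; exact zero_mem _
  | add _ _ _ _ hx hy => rw [star_add]; exact add_mem hx hy

namespace IsPeriodicWeight
variable (hz : IsPeriodicWeight u p z) (hu : IsCuntzKriegerFamily u) (hp : 1 ≤ p)
include hz hu hp

theorem mul_mem_degreePart (hx : x ∈ degreePart u p z d) (hy : y ∈ degreePart u p z e) :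
    x * y ∈ degreePart u p z (d + e) := by
  refine (?_ : degreePart u p z d * degreePart u p z e ≤ _) (Submodule.mul_mem_mul hx hy)
  simp only [degreePart, Submodule.iSup_mul, Submodule.mul_iSup]
  refine iSup_le fun ⟨⟨m, n⟩, hmn⟩ => iSup_le fun ⟨⟨k, l⟩, hkl⟩ => ?_
  have hraise : pathSpan u p z k l ≤ pathSpan u p z (k + m) (m + l) := by
    simpa only [add_comm l m] using hz.pathSpan_le_add hu hp k l m
  calc pathSpan u p z k l * pathSpan u p z m n
      ≤ pathSpan u p z (k + m) (m + l) * pathSpan u p z (m + l) (n + l) :=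
        mul_le_mul' hraise (hz.pathSpan_le_add hu hp m n l)
    _ ≤ pathSpan u p z (k + m) (n + l) := hu.pathSpan_mul_le _ _ _
    _ ≤ degreePart u p z (d + e) := pathSpan_le_degreePart (by push_cast; lia)

theorem exists_mem_pathSpan_of_mem_degreePart_zero (hx : x ∈ degreePart u p z 0) :
    ∃ n, x ∈ pathSpan u p z n n := by
  have hmono {m n : ℕ} (h : m ≤ n) : pathSpan u p z m m ≤ pathSpan u p z n n := by
    obtain ⟨k, rfl⟩ := Nat.exists_eq_add_of_le h
    exact hz.pathSpan_le_add hu hp m m k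
  have hle : degreePart u p z 0 ≤ ⨆ n, pathSpan u p z n n :=
    iSup_le fun ⟨⟨m, n⟩, hmn⟩ => by
      obtain rfl : m = n := by lia
      exact le_iSup (fun n => pathSpan u p z n n) m
  exact (Submodule.mem_iSup_of_directed _ (Monotone.directed_le fun _ _ => hmono)).1 (hle hx)

theorem mul_mem_degreePart_one {α : G.Path} (hα : α.len = 1) :
    z * u α ∈ degreePart u p z 1 := by
  have h : z * u α = u α * weightShift u p z α.len * star (u (Path.vertex G α.src)) := by
    rw [hu.star_vertex, ← hz.mul_eq_mul_weightShift hu hp, mul_assoc, hu.mul_vertex rfl]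
  rw [h]
  exact pathSpan_le_degreePart (m := 1) (n := 0) rfl
    (mul_mul_star_mem_pathSpan hα (Path.vertex_len _) (weightShift_mem_weightAlg _))

end IsPeriodicWeight

end DegreePart

section Positive
variable [Finite V] [Finite E] {B : Type*} [CStarAlgebra B] [PartialOrder B] [StarOrderedRing B]
  {u : G.Path → B} {p : ℕ} {z : B}

theorem shift_mono (k : ℕ) : Monotone (shift u k) := fun _ _ hxy =>
  Finset.sum_le_sum fun μ _ => star_right_conjugate_le_conjugate hxy (u μ)

theorem IsCuntzKriegerFamily.algebraMap_le_shift (hu : IsCuntzKriegerFamily u) {ε : ℝ} {x : B}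
    (hx : algebraMap ℝ B ε ≤ x) (k : ℕ) : algebraMap ℝ B ε ≤ shift u k x := by
  have h := shift_mono (u := u) k hx
  rwa [IsScalarTower.algebraMap_apply ℝ ℂ B, hu.shift_algebraMap] at h

namespace IsPeriodicWeight
variable (hz : IsPeriodicWeight u p z) (hu : IsCuntzKriegerFamily u) (hp : 1 ≤ p)
  (no_sinks : ∀ v, ∃ e, G.s e = v) {S : NonUnitalStarSubalgebra ℂ B} [IsClosed (S : Set B)]
  (hS : ∀ e, z * u (Path.edge G e) ∈ S) {ε : ℝ} (hε : 0 < ε) (hle : algebraMap ℝ B ε ≤ z)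
include hz hu hp no_sinks hS hε hle

theorem weightShift_one_mem_and_exists_mul_eq_one :
    weightShift u p z 1 ∈ S ∧ ∃ w ∈ S, weightShift u p z 1 * w = 1 := by
  have hsa : IsSelfAdjoint z := by
    simpa only [sub_add_cancel] using
      (IsSelfAdjoint.of_nonneg (sub_nonneg.2 hle)).add (IsSelfAdjoint.algebraMap B (.all ε))
  have hsq := hz.weightShift_one_mul_self_mem hu hp no_sinks hS hsa
  obtain ⟨w, hw, hyw⟩ := exists_mem_mul_eq_one (y := weightShift u p z 1) S hε
    (hu.algebraMap_le_shift hle _) hsq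
  refine ⟨?_, w, hw, hyw⟩
  have h := mul_mem hsq hw
  rwa [mul_assoc, hyw, mul_one] at h

theorem u_mem (α : G.Path) : u α ∈ S := by
  obtain ⟨-, w, hw, hyw⟩ :=
    hz.weightShift_one_mem_and_exists_mul_eq_one hu hp no_sinks hS hε hle
  have hedge (e : E) : u (Path.edge G e) ∈ S := by
    have h := mul_mem (hS e) hw
    rwa [hz.mul_eq_mul_weightShift hu hp, Path.edge_len, mul_assoc, hyw, mul_one] at h
  induction α using Path.cons_induction with
  | vertex v =>
    obtain ⟨e, rfl⟩ := no_sinks v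
    have h := mul_mem (star_mem (hedge e)) (hedge e)
    rwa [hu.star_mul_self] at h
  | cons e β h ih =>
    have hcomp := hu.comp (Path.edge G e) β h.symm
    exact (hcomp ▸ mul_mem (hedge e) ih : u ((Path.edge G e).comp β h.symm) ∈ S)

theorem one_mem_and_mem : 1 ∈ S ∧ z ∈ S := by
  have hu_mem := hz.u_mem hu hp no_sinks hS hε hle
  obtain ⟨hy, w, hw, hyw⟩ :=
    hz.weightShift_one_mem_and_exists_mul_eq_one hu hp no_sinks hS hε hle
  refine ⟨hyw ▸ mul_mem hy hw, ?_⟩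
  rw [← hz.shift_weightShift hu hp 1]
  exact sum_mem fun μ _ => mul_mem (mul_mem (hu_mem _) hy) (star_mem (hu_mem _))

end IsPeriodicWeight

end Positive

end DirGraph

/-! ### The core algebras -/

namespace DirGraph
open Ell2
variable {V E : Type*} [Fintype V] {G : DirGraph V E}

theorem q_eq_zero_iff {T : G.L} : G.q T = 0 ↔ T ∈ compacts (Path.src (G := G)) :=
  Ideal.Quotient.eq_zero_iff_mem

theorem isCuntzKriegerFamily_u [Finite E] : IsCuntzKriegerFamily G.u where
  comp α β h := by rw [u, Spath_comp, map_mul]; rfl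
  mul_eq_zero h := by rw [u, u, ← map_mul, Spath_mul_Spath_of_ne h, map_zero]
  star_mul_self α := by rw [u, ← map_star, ← map_mul, star_Spath_mul_Spath]; rfl
  star_mul_eq_zero hlen h := by
    rw [u, u, ← map_star, ← map_mul, star_Spath_mul_Spath_of_ne hlen h, map_zero]
  sum_path k := by
    simp only [u, ← map_star, ← map_mul, ← map_sum]
    rw [sum_Spath_mul_star_Spath, map_sub, map_one, q_eq_zero_iff.2 (lowProj_mem_compacts k),
      sub_zero]

section Core
variable [Fintype E] {Z : G.WeightSeq} {p : ℕ}

theorem isPeriodicWeight_z (hA : G.ConditionA Z p) : IsPeriodicWeight G.u p (G.z Z) where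
  mem_vertexCommutant := isCuntzKriegerFamily_u.mem_vertexCommutant fun v => by
    rw [u, Spath_vertex, z, ← map_mul, ← map_mul, weight_mul_P]
  mul_of_len {β} hβ := by
    rw [u, z, ← sub_eq_zero, ← map_mul, ← map_mul, ← map_sub, q_eq_zero_iff]
    exact weight_mul_Spath_sub_mem_compacts Z hA ⟨β, hβ⟩

theorem isClosed_C (n : ℕ) : IsClosed (G.C Z p n : Set G.Calkin) :=
  NonUnitalStarSubalgebra.isClosed_topologicalClosure _

theorem mul_z_pow_mul_star_mem_C {n : ℕ} {α β : G.Path} (l : ℕ) (h : n * p ≤ α.len)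
    (hlen : α.len = β.len) (hlt : α.len < (n + 1) * p) (hsrc : α.src = β.src) :
    G.u α * G.z Z ^ l * star (G.u β) ∈ G.C Z p n :=
  NonUnitalStarSubalgebra.le_topologicalClosure _
    (NonUnitalStarAlgebra.subset_adjoin ℂ _ ⟨α, β, l, h, hlen, hlt, hsrc, rfl⟩)

theorem pathSpan_subset_C (hp : 1 ≤ p) (hA : G.ConditionA Z p) (n : ℕ) :
    (pathSpan G.u p (G.z Z) (n * p + (p - 1)) (n * p + (p - 1)) : Set G.Calkin) ⊆ G.C Z p n :=
  (isPeriodicWeight_z hA).pathSpan_subset_of_generators_mem isCuntzKriegerFamily_u hp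
    fun _ _ l => mul_z_pow_mul_star_mem_C l

theorem coe_C (hp : 1 ≤ p) (hA : G.ConditionA Z p) (n : ℕ) : (G.C Z p n : Set G.Calkin) =
    closure (pathSpan G.u p (G.z Z) (n * p + (p - 1)) (n * p + (p - 1))) := by
  have hu := isCuntzKriegerFamily_u (G := G)
  have hz := isPeriodicWeight_z hA
  refine Set.Subset.antisymm ?_ (closure_minimal (pathSpan_subset_C hp hA n) (isClosed_C n))
  let M : NonUnitalStarSubalgebra ℂ G.Calkin :=
    { pathSpan G.u p (G.z Z) (n * p + (p - 1)) (n * p + (p - 1)) with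
      mul_mem' := hu.mul_mem_pathSpan
      star_mem' := star_mem_pathSpan }
  refine closure_mono (show _ ≤ M from NonUnitalStarAlgebra.adjoin_le ?_)
  rintro _ ⟨α, β, l, -, hlen, hlt, -, rfl⟩
  rw [add_one_mul] at hlt
  have hα : α.len + (n * p + (p - 1) - α.len) = n * p + (p - 1) := by lia
  have h := hz.pathSpan_le_add hu hp _ _ (n * p + (p - 1) - α.len)
    (mul_mul_star_mem_pathSpan (α := α) rfl hlen.symm (pow_mem (hz.mem_weightAlg hu) l))
  rwa [hα] at h

theorem C_le_C_succ (hp : 1 ≤ p) (hA : G.ConditionA Z p) (n : ℕ) :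
    G.C Z p n ≤ G.C Z p (n + 1) := by
  rw [← SetLike.coe_subset_coe, coe_C hp hA, coe_C hp hA]
  refine closure_mono ?_
  have h := (isPeriodicWeight_z hA).pathSpan_le_add isCuntzKriegerFamily_u hp
    (n * p + (p - 1)) (n * p + (p - 1)) p
  rwa [add_right_comm, ← add_one_mul] at h

theorem star_u_mul_mul_u_eq_zero (hp : 1 ≤ p) (hA : G.ConditionA Z p) {n : ℕ} {c : G.Calkin}
    (hc : c ∈ G.C Z p n) {γ₁ γ₂ : G.Gam p n} (hsrc : γ₁.1.src ≠ γ₂.1.src) :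
    star (G.u γ₁.1) * c * G.u γ₂.1 = 0 := by
  rw [← SetLike.mem_coe, coe_C hp hA] at hc
  refine closure_minimal (t := {c | star (G.u γ₁.1) * c * G.u γ₂.1 = 0}) (fun x hx => ?_)
    (isClosed_eq (by fun_prop) continuous_const) hc
  exact isCuntzKriegerFamily_u.star_mul_mul_eq_zero hx γ₁.2 γ₂.2 hsrc

/-- The elements `u_η u_γ*` move rows and columns between the levels `n` and `m`. -/
theorem transfer_mem_C (hp : 1 ≤ p) (hA : G.ConditionA Z p) {m n : ℕ} {c : G.Calkin}
    (hc : c ∈ G.C Z p n) (η₁ η₂ : G.Gam p m) (γ₁ γ₂ : G.Gam p n) :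
    G.u η₁.1 * star (G.u γ₁.1) * c * (G.u γ₂.1 * star (G.u η₂.1)) ∈ G.C Z p m := by
  have hu := isCuntzKriegerFamily_u (G := G)
  rw [← SetLike.mem_coe, coe_C hp hA] at hc ⊢
  refine map_mem_closure (f := fun c => G.u η₁.1 * star (G.u γ₁.1) * c *
    (G.u γ₂.1 * star (G.u η₂.1))) (by fun_prop) hc fun x hx => ?_
  exact hu.mul_mem_pathSpan (hu.mul_mem_pathSpan (mul_star_mem_pathSpan η₁.2 γ₁.2) hx)
    (mul_star_mem_pathSpan γ₂.2 η₂.2)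

end Core

section TauRow
variable {p n : ℕ} (ξ : PathChoice G p)

/-- The row of the elements `u_γ u_{ξ_v}*`, `v = s(γ)`, whose row compression is `τ_n`. -/
def tauRow (n : ℕ) (γ : G.Gam p n) : G.Calkin := G.u γ.1 * star (G.u (ξ.ξ γ.1.src))

variable [Finite E]

theorem sum_tauRow : ∑ γ : G.Gam p n, tauRow ξ n γ * star (tauRow ξ n γ) = 1 := by
  have hu := isCuntzKriegerFamily_u (G := G)
  rw [← hu.sum_path (n * p + (p - 1))]
  refine Finset.sum_congr rfl fun γ _ => ?_
  rw [tauRow, star_mul, star_star, mul_assoc, ← mul_assoc (star _), hu.star_mul_self, ← mul_assoc,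
    hu.mul_vertex (ξ.src_eq _).symm]

theorem star_tauRow_mul_of_ne {γ₁ γ₂ : G.Gam p n} (h : γ₁ ≠ γ₂) :
    star (tauRow ξ n γ₁) * tauRow ξ n γ₂ = 0 := by
  rw [tauRow, tauRow, star_mul, star_star, mul_assoc, ← mul_assoc (star _),
    isCuntzKriegerFamily_u.star_mul_eq_zero (γ₁.2.trans γ₂.2.symm) (Subtype.coe_ne_coe.2 h),
    zero_mul, mul_zero]

theorem star_tauRow_mul_self (γ : G.Gam p n) :
    star (tauRow ξ n γ) * tauRow ξ n γ = G.u (ξ.ξ γ.1.src) * star (G.u (ξ.ξ γ.1.src)) := by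
  have hu := isCuntzKriegerFamily_u (G := G)
  rw [tauRow, star_mul, star_star, mul_assoc, ← mul_assoc (star _), hu.star_mul_self, ← mul_assoc,
    hu.mul_vertex (ξ.src_eq _)]

end TauRow

section Tau
variable [Fintype E] {Z : G.WeightSeq} {p n : ℕ} (ξ : PathChoice G p)

theorem tauFormula_eq_rowCompression (hp : 1 ≤ p) (hA : G.ConditionA Z p) {c : G.Calkin}
    (hc : c ∈ G.C Z p n) :
    G.tauFormula ξ n c = rowCompression (tauRow ξ n) (sum_tauRow ξ) c := by
  classical
  rw [Matrix.matrix_eq_sum_single (rowCompression _ _ c), tauFormula]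
  refine Finset.sum_congr rfl fun γ₁ _ => Finset.sum_congr rfl fun γ₂ _ => ?_
  have hentry : star (tauRow ξ n γ₁) * c * tauRow ξ n γ₂ = G.u (ξ.ξ γ₁.1.src) *
      (star (G.u γ₁.1) * c * G.u γ₂.1) * star (G.u (ξ.ξ γ₂.1.src)) := by
    simp only [tauRow, star_mul, star_star, mul_assoc]
  rw [rowCompression_apply, hentry]
  split_ifs with h
  · rw [h, unit]
    simp only [mul_assoc]
  · rw [star_u_mul_mul_u_eq_zero hp hA hc h, mul_zero, zero_mul, Matrix.single_zero]

variable {ξ}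

theorem mul_star_u_mul_mul_of_mem_Cv {v : V} {b : G.Calkin} (hb : b ∈ G.Cv Z ξ v) :
    G.u (ξ.ξ v) * star (G.u (ξ.ξ v)) * b * (G.u (ξ.ξ v) * star (G.u (ξ.ξ v))) = b := by
  obtain ⟨c, -, rfl⟩ := hb
  have hproj : IsIdempotentElem (G.u (ξ.ξ v) * star (G.u (ξ.ξ v))) := by
    rw [IsIdempotentElem, ← mul_assoc, isCuntzKriegerFamily_u.mul_star_mul_self]
  calc _ = (G.u (ξ.ξ v) * star (G.u (ξ.ξ v)) * (G.u (ξ.ξ v) * star (G.u (ξ.ξ v)))) * c *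
        (G.u (ξ.ξ v) * star (G.u (ξ.ξ v)) * (G.u (ξ.ξ v) * star (G.u (ξ.ξ v)))) := by
        simp only [mul_assoc]
    _ = _ := by rw [hproj.eq]

theorem mem_C_of_mem_Cv {v : V} {b : G.Calkin} (hb : b ∈ G.Cv Z ξ v) : b ∈ G.C Z p 0 := by
  obtain ⟨c, hc, rfl⟩ := hb
  exact mul_mem (mul_mem (u_mul_star_mem Z ξ v) hc) (u_mul_star_mem Z ξ v)

variable (ξ)

/-- The path `ξ_v` as an element of `Γ_0`. -/
def PathChoice.gam (v : V) : G.Gam p 0 := ⟨ξ.ξ v, by have := ξ.len_add_one v; lia⟩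

theorem tauFormula_mem_A (hp : 1 ≤ p) (hA : G.ConditionA Z p) {c : G.Calkin}
    (hc : c ∈ G.C Z p n) : G.tauFormula ξ n c ∈ G.A Z ξ n := by
  have hu := isCuntzKriegerFamily_u (G := G)
  intro γ₁ γ₂
  rw [tauFormula_eq_rowCompression ξ hp hA hc, rowCompression_apply, tauRow, tauRow, star_mul,
    star_star]
  refine ⟨fun h => ⟨_, transfer_mem_C hp hA hc (ξ.gam γ₁.1.src) (ξ.gam γ₁.1.src) γ₁ γ₂, ?_⟩,
    fun h => ?_⟩
  · change _ = _ * (G.u (ξ.ξ _) * _ * c * (_ * star (G.u (ξ.ξ _)))) * _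
    rw [← h]
    generalize hU : G.u (ξ.ξ γ₁.1.src) = U
    have hUU : U * star U * U = U := hU ▸ hu.mul_star_mul_self _
    have hUU' : star U * (U * star U) = star U := by
      rw [← star_inj, star_mul, star_mul, star_star, hUU]
    calc U * star (G.u γ₁.1) * c * (G.u γ₂.1 * star U) =
        (U * star U * U) * star (G.u γ₁.1) * c * (G.u γ₂.1 * (star U * (U * star U))) := by
          rw [hUU, hUU']
      _ = _ := by simp only [mul_assoc]
  · have hzero := star_u_mul_mul_u_eq_zero hp hA hc h
    calc _ = G.u (ξ.ξ γ₁.1.src) * (star (G.u γ₁.1) * c * G.u γ₂.1) *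
          star (G.u (ξ.ξ γ₂.1.src)) := by simp only [mul_assoc]
      _ = 0 := by rw [hzero, mul_zero, zero_mul]

variable {ξ}

theorem tauRow_mul_mul_star_mem_C (hp : 1 ≤ p) (hA : G.ConditionA Z p) (γ₁ γ₂ : G.Gam p n) {v : V}
    {b : G.Calkin} (hb : b ∈ G.Cv Z ξ v) :
    tauRow ξ n γ₁ * b * star (tauRow ξ n γ₂) ∈ G.C Z p n := by
  rw [tauRow, tauRow, star_mul, star_star]
  exact transfer_mem_C hp hA (mem_C_of_mem_Cv hb) γ₁ γ₂ (ξ.gam _) (ξ.gam _)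

theorem tauFormula_tauRow_mul_mul_star (hp : 1 ≤ p) (hA : G.ConditionA Z p) {γ₁ γ₂ : G.Gam p n}
    (h : γ₁.1.src = γ₂.1.src) {b : G.Calkin} (hb : b ∈ G.Cv Z ξ γ₁.1.src) :
    G.tauFormula ξ n (tauRow ξ n γ₁ * b * star (tauRow ξ n γ₂)) = G.unit γ₁ γ₂ b := by
  classical
  rw [tauFormula_eq_rowCompression ξ hp hA (tauRow_mul_mul_star_mem_C hp hA γ₁ γ₂ hb),
    rowCompression_mul_mul_star _ fun _ _ => star_tauRow_mul_of_ne ξ, star_tauRow_mul_self,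
    star_tauRow_mul_self, ← h, mul_star_u_mul_mul_of_mem_Cv hb]

variable (ξ)

/-- `τ_n` as a `⋆`-homomorphism. -/
def tauHom (hp : 1 ≤ p) (hA : G.ConditionA Z p) (n : ℕ) : G.C Z p n →⋆ₙₐ[ℂ] G.A Z ξ n :=
  NonUnitalStarAlgHom.codRestrict ((rowCompression (tauRow ξ n) (sum_tauRow ξ)).comp
    (NonUnitalStarSubalgebraClass.subtype (G.C Z p n))) (G.A Z ξ n) fun c =>
      tauFormula_eq_rowCompression ξ hp hA c.2 ▸ tauFormula_mem_A ξ hp hA c.2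

theorem coe_tauHom (hp : 1 ≤ p) (hA : G.ConditionA Z p) (c : G.C Z p n) :
    (tauHom ξ hp hA n c : Matrix _ _ _) = G.tauFormula ξ n c :=
  (tauFormula_eq_rowCompression ξ hp hA c.2).symm

theorem tauHom_injective (hp : 1 ≤ p) (hA : G.ConditionA Z p) :
    Function.Injective (tauHom ξ hp hA n) := fun _ _ h =>
  Subtype.ext (rowCompression_injective (sum_tauRow ξ) (congrArg Subtype.val h))

theorem tauHom_surjective (hp : 1 ≤ p) (hA : G.ConditionA Z p) :
    Function.Surjective (tauHom ξ hp hA n) := by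
  classical
  intro M
  have hsingle (γ₁ γ₂ : G.Gam p n) : ∃ c : G.C Z p n,
      (tauHom ξ hp hA n c : Matrix _ _ _) = Matrix.single γ₁ γ₂ (M.1 γ₁ γ₂) := by
    by_cases h : γ₁.1.src = γ₂.1.src
    · have hM := (M.2 γ₁ γ₂).1 h
      exact ⟨⟨_, tauRow_mul_mul_star_mem_C hp hA γ₁ γ₂ hM⟩,
        (coe_tauHom ..).trans (tauFormula_tauRow_mul_mul_star hp hA h hM)⟩
    · exact ⟨0, by rw [(M.2 γ₁ γ₂).2 h, Matrix.single_zero, map_zero]; rfl⟩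
  choose c hc using hsingle
  refine ⟨∑ γ₁, ∑ γ₂, c γ₁ γ₂, Subtype.ext ?_⟩
  simp only [map_sum, AddSubmonoidClass.coe_finsetSum, hc]
  exact (Matrix.matrix_eq_sum_single M.1).symm

/-- `τ_n` as a `⋆`-isomorphism. -/
def tauEquiv (hp : 1 ≤ p) (hA : G.ConditionA Z p) (n : ℕ) : G.C Z p n ≃⋆ₐ[ℂ] G.A Z ξ n :=
  StarAlgEquiv.ofBijective (tauHom ξ hp hA n) ⟨tauHom_injective ξ hp hA, tauHom_surjective ξ hp hA⟩

theorem coe_tauEquiv (hp : 1 ≤ p) (hA : G.ConditionA Z p) (c : G.C Z p n) :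
    (tauEquiv ξ hp hA n c : Matrix _ _ _) = G.tauFormula ξ n c :=
  coe_tauHom ξ hp hA c

theorem coe_tauEquiv_symm_unit (hp : 1 ≤ p) (hA : G.ConditionA Z p) {γ₁ γ₂ : G.Gam p n}
    (h : γ₁.1.src = γ₂.1.src) {b : G.Calkin} (hb : b ∈ G.Cv Z ξ γ₁.1.src) :
    ((tauEquiv ξ hp hA n).symm ⟨G.unit γ₁ γ₂ b, G.unit_mem Z ξ n γ₁ γ₂ h b hb⟩ : G.Calkin) =
      G.u γ₁.1 * star (G.u (ξ.ξ γ₁.1.src)) * b * G.u (ξ.ξ γ₁.1.src) * star (G.u γ₂.1) := by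
  have hmem := tauRow_mul_mul_star_mem_C hp hA γ₁ γ₂ hb
  have hsymm : (tauEquiv ξ hp hA n).symm ⟨G.unit γ₁ γ₂ b, G.unit_mem Z ξ n γ₁ γ₂ h b hb⟩ =
      ⟨_, hmem⟩ := by
    rw [StarAlgEquiv.symm_apply_eq]
    exact Subtype.ext ((coe_tauEquiv ξ hp hA ⟨_, hmem⟩).trans
      (tauFormula_tauRow_mul_mul_star hp hA h hb)).symm
  have hrow : tauRow ξ n γ₁ * b * star (tauRow ξ n γ₂) =
      G.u γ₁.1 * star (G.u (ξ.ξ γ₁.1.src)) * b * G.u (ξ.ξ γ₁.1.src) * star (G.u γ₂.1) := by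
    rw [tauRow, tauRow, star_mul, star_star, ← h, ← mul_assoc]
  exact (congrArg Subtype.val hsymm).trans hrow

end Tau

end DirGraph

/-! ### The gauge action -/

namespace DirGraph
open Ell2
variable {V E : Type*} [Fintype V] {G : DirGraph V E}

theorem gauge_mul_star (t : ℝ) : G.gauge t * star (G.gauge t) = 1 := by
  have hstar : (star (G.gauge t)).1 =
      diagOp (fun α : G.Path => star (Complex.exp (Complex.I * α.len * t)))
        ⟨1, fun α => by simp [Complex.norm_exp]⟩ :=
    star_diagOp _ ⟨1, fun α => by simp [Complex.norm_exp]⟩ _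
  refine Subtype.ext ?_
  ext x α
  change Complex.exp (Complex.I * α.len * t) * (star (G.gauge t)).1 x α = x α
  rw [hstar]
  change _ * (star (Complex.exp (Complex.I * α.len * t)) * x α) = x α
  rw [← mul_assoc, Complex.star_def, ← Complex.exp_conj, ← Complex.exp_add]
  simp

theorem Spath_mem_spectralSubspace (α : G.Path) :
    G.Spath α ∈ spectralSubspace G.gauge α.len := fun t => by
  rw [gauge_mul_Spath, smul_mul_assoc, mul_assoc (G.Spath α), gauge_mul_star, mul_one,
    Int.cast_natCast]

variable [Fintype E] {Z : G.WeightSeq} {p : ℕ}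

theorem weight_mem_spectralSubspace : G.weight Z ∈ spectralSubspace G.gauge 0 :=
  mem_spectralSubspace_zero.2 fun t => by
    rw [gauge_mul_weight, mul_assoc (G.weight Z), gauge_mul_star, mul_one]

theorem weight_mul_S_mem_toeplitz (e : E) : G.weight Z * G.S e ∈ G.toeplitz Z :=
  NonUnitalStarSubalgebra.le_topologicalClosure _ (NonUnitalStarAlgebra.subset_adjoin ℂ _ ⟨e, rfl⟩)

theorem isClosed_toeplitz : IsClosed (G.toeplitz Z : Set G.L) :=
  NonUnitalStarSubalgebra.isClosed_topologicalClosure _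

theorem isClosed_fixedAlg : IsClosed (G.fixedAlg Z : Set G.L) := by
  have hfixed : (G.fixedAlg Z : Set G.L) =
      (G.toeplitz Z : Set G.L) ∩ ⋂ t : ℝ, {T | G.gauge t * T * star (G.gauge t) = T} := by
    ext T
    simp only [Set.mem_inter_iff, Set.mem_iInter]
    rfl
  rw [hfixed]
  exact isClosed_toeplitz.inter
    (isClosed_iInter fun t => isClosed_eq (by fun_prop) continuous_id)

theorem isClosed_qD : IsClosed (G.qD Z : Set G.Calkin) :=
  isClosed_map_starAlgHom _ _ isClosed_fixedAlg

/-- The elements of degree `d` of the weighted Toeplitz algebra whose images under `q` are linear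
combinations of the elements `u_α b u_β*` with `|α| = |β| + d`. -/
def gaugePart (Z : G.WeightSeq) (p : ℕ) (d : ℤ) : Submodule ℂ G.L :=
  (G.toeplitz Z).toSubmodule ⊓ spectralSubspace G.gauge d ⊓
    (degreePart G.u p (G.z Z) d).comap (G.q : G.L →ₗ[ℂ] G.Calkin)

theorem mem_gaugePart {d : ℤ} {x : G.L} : x ∈ gaugePart Z p d ↔ x ∈ G.toeplitz Z ∧
    x ∈ spectralSubspace G.gauge d ∧ G.q x ∈ degreePart G.u p (G.z Z) d :=
  and_assoc

theorem mul_mem_gaugePart (hp : 1 ≤ p) (hA : G.ConditionA Z p) {d e : ℤ} {x y : G.L}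
    (hx : x ∈ gaugePart Z p d) (hy : y ∈ gaugePart Z p e) : x * y ∈ gaugePart Z p (d + e) := by
  rw [mem_gaugePart] at hx hy ⊢
  rw [map_mul]
  exact ⟨mul_mem hx.1 hy.1, mul_mem_spectralSubspace G.star_gauge_mul hx.2.1 hy.2.1,
    (isPeriodicWeight_z hA).mul_mem_degreePart isCuntzKriegerFamily_u hp hx.2.2 hy.2.2⟩

theorem star_mem_gaugePart {d : ℤ} {x : G.L} (hx : x ∈ gaugePart Z p d) :
    star x ∈ gaugePart Z p (-d) := by
  rw [mem_gaugePart] at hx ⊢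
  rw [map_star]
  exact ⟨star_mem hx.1, star_mem_spectralSubspace hx.2.1, star_mem_degreePart hx.2.2⟩

theorem weight_mul_S_mem_gaugePart (hp : 1 ≤ p) (hA : G.ConditionA Z p) (e : E) :
    G.weight Z * G.S e ∈ gaugePart Z p 1 := by
  refine mem_gaugePart.2 ⟨weight_mul_S_mem_toeplitz e, ?_, ?_⟩
  · have h := mul_mem_spectralSubspace G.star_gauge_mul (weight_mem_spectralSubspace (Z := Z))
      (Spath_mem_spectralSubspace (Path.edge G e))
    rwa [Spath_edge, zero_add, Path.edge_len, Nat.cast_one] at h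
  · have h := (isPeriodicWeight_z hA).mul_mem_degreePart_one isCuntzKriegerFamily_u hp
      (Path.edge_len e)
    rwa [u, z, Spath_edge, ← map_mul] at h

theorem toeplitz_subset_closure (hp : 1 ≤ p) (hA : G.ConditionA Z p) :
    (G.toeplitz Z : Set G.L) ⊆ closure (⨆ d, gaugePart Z p d : Submodule ℂ G.L) :=
  closure_mono <| adjoin_le_iSup_of_graded (mul_mem_gaugePart hp hA) star_mem_gaugePart <| by
    rintro _ ⟨e, rfl⟩
    exact weight_mul_S_mem_gaugePart hp hA e

open scoped CStarAlgebra in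
theorem map_mem_closure_gaugePart (hp : 1 ≤ p) (hA : G.ConditionA Z p) {T : G.L}
    (hT : T ∈ G.toeplitz Z) (h₀ : G.q T ∈ spectralSubspace (fun t => G.q (G.gauge t)) 0) :
    G.q T ∈ closure (G.q '' gaugePart Z p 0) := by
  refine mem_closure_of_mem_closure_iSup (g := fun t => G.q (G.gauge t))
    (M := fun d => (gaugePart Z p d).map (G.q : G.L →ₗ[ℂ] G.Calkin)) (fun t => ?_) (fun d => ?_)
    h₀ ?_
  · rw [← map_star, ← map_mul, gauge_mul_star, map_one]
  · rintro _ ⟨x, hx, rfl⟩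
    exact map_mem_spectralSubspace G.q (mem_gaugePart.1 hx).2.1
  · rw [← Submodule.map_iSup, Submodule.map_coe]
    exact image_closure_subset_closure_image (map_continuous G.q)
      ⟨T, toeplitz_subset_closure hp hA hT, rfl⟩

theorem qD_subset_closure (hp : 1 ≤ p) (hA : G.ConditionA Z p) :
    (G.qD Z : Set G.Calkin) ⊆ closure (⋃ n, (G.C Z p n : Set G.Calkin)) := by
  have hz := isPeriodicWeight_z hA
  rintro _ ⟨T, ⟨hT, hfixed⟩, rfl⟩
  refine closure_mono ?_ (map_mem_closure_gaugePart hp hA hT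
    (map_mem_spectralSubspace G.q (mem_spectralSubspace_zero.2 hfixed)))
  rintro _ ⟨x, hx, rfl⟩
  obtain ⟨n, hn⟩ := hz.exists_mem_pathSpan_of_mem_degreePart_zero isCuntzKriegerFamily_u hp hx.2
  refine Set.mem_iUnion.2 ⟨n, pathSpan_subset_C hp hA n ?_⟩
  have hle : n + (n * p + (p - 1) - n) = n * p + (p - 1) := by
    have := Nat.le_mul_of_pos_right n hp
    lia
  have h := hz.pathSpan_le_add isCuntzKriegerFamily_u hp _ _ (n * p + (p - 1) - n) hn
  rwa [hle] at h

theorem mem_qD (hp : 1 ≤ p) (hA : G.ConditionA Z p) {x : G.Calkin}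
    (hx : x ∈ (G.toeplitz Z).map G.q.toNonUnitalStarAlgHom)
    (h₀ : x ∈ spectralSubspace (fun t => G.q (G.gauge t)) 0) : x ∈ G.qD Z := by
  obtain ⟨T, hT, rfl⟩ := hx
  refine closure_minimal ?_ isClosed_qD (map_mem_closure_gaugePart hp hA hT h₀)
  rintro _ ⟨T', hT', rfl⟩
  exact ⟨T', ⟨(mem_gaugePart.1 hT').1,
    mem_spectralSubspace_zero.1 (mem_gaugePart.1 hT').2.1⟩, rfl⟩

theorem exists_algebraMap_le_z [PartialOrder G.Calkin] [StarOrderedRing G.Calkin]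
    (Z : G.WeightSeq) : ∃ ε : ℝ, 0 < ε ∧ algebraMap ℝ G.Calkin ε ≤ G.z Z := by
  obtain ⟨ε, hε, hpos⟩ := exists_isPositive_weight_sub Z
  refine ⟨ε, hε, ?_⟩
  obtain ⟨r, hr, hrT⟩ := exists_mem_star_mul_self_eq G.L
    ((ContinuousLinearMap.nonneg_iff_isPositive _).2 hpos) (G.weight Z - (ε : ℂ) • 1).2
  let R : G.L := ⟨r, hr⟩
  have hR : star R * R = G.weight Z - (ε : ℂ) • 1 := Subtype.ext hrT
  have h := star_mul_self_nonneg (G.q R)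
  rw [← map_star, ← map_mul, hR, map_sub, map_smul, map_one] at h
  exact sub_nonneg.1 h

theorem generators_mem_map_toeplitz (no_sinks : ∀ v, ∃ e, G.s e = v) (hp : 1 ≤ p)
    (hA : G.ConditionA Z p) :
    (∀ α, G.u α ∈ (G.toeplitz Z).map G.q.toNonUnitalStarAlgHom) ∧
      1 ∈ (G.toeplitz Z).map G.q.toNonUnitalStarAlgHom ∧
      G.z Z ∈ (G.toeplitz Z).map G.q.toNonUnitalStarAlgHom := by
  let : PartialOrder G.Calkin := CStarAlgebra.spectralOrder G.Calkin
  have : StarOrderedRing G.Calkin := CStarAlgebra.spectralOrderedRing G.Calkin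
  have : IsClosed ((G.toeplitz Z).map G.q.toNonUnitalStarAlgHom : Set G.Calkin) :=
    isClosed_map_starAlgHom _ _ isClosed_toeplitz
  have hu := isCuntzKriegerFamily_u (G := G)
  have hz := isPeriodicWeight_z hA
  obtain ⟨ε, hε, hle⟩ := exists_algebraMap_le_z Z
  have hS (e : E) : G.z Z * G.u (Path.edge G e) ∈ (G.toeplitz Z).map G.q.toNonUnitalStarAlgHom :=
    ⟨_, weight_mul_S_mem_toeplitz e, by rw [u, Spath_edge]; exact map_mul G.q _ _⟩
  exact ⟨hz.u_mem hu hp no_sinks hS hε hle, hz.one_mem_and_mem hu hp no_sinks hS hε hle⟩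

theorem mul_z_pow_mul_star_mem_spectralSubspace {α β : G.Path} (l : ℕ) (h : α.len = β.len) :
    G.u α * G.z Z ^ l * star (G.u β) ∈ spectralSubspace (fun t => G.q (G.gauge t)) 0 := by
  have hpow : G.weight Z ^ l ∈ spectralSubspace G.gauge 0 := by
    induction l with
    | zero => exact mem_spectralSubspace_zero.2 fun t => by rw [pow_zero, mul_one, gauge_mul_star]
    | succ l ih =>
      have hmul := mul_mem_spectralSubspace G.star_gauge_mul ih
        (weight_mem_spectralSubspace (Z := Z))
      rwa [← pow_succ, add_zero] at hmul
  have hmem : G.Spath α * G.weight Z ^ l * star (G.Spath β) ∈ spectralSubspace G.gauge 0 := by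
    have hmul := mul_mem_spectralSubspace G.star_gauge_mul
      (mul_mem_spectralSubspace G.star_gauge_mul (Spath_mem_spectralSubspace α) hpow)
      (star_mem_spectralSubspace (Spath_mem_spectralSubspace β))
    rwa [h, add_zero, add_neg_cancel] at hmul
  have hq : G.u α * G.z Z ^ l * star (G.u β) =
      G.q (G.Spath α * G.weight Z ^ l * star (G.Spath β)) := by
    rw [map_mul, map_mul, map_pow, map_star]
    rfl
  rw [hq]
  exact map_mem_spectralSubspace G.q hmem

theorem C_le_qD (no_sinks : ∀ v, ∃ e, G.s e = v) (hp : 1 ≤ p) (hA : G.ConditionA Z p) (n : ℕ) :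
    G.C Z p n ≤ G.qD Z := by
  obtain ⟨hu, h1, hz⟩ := generators_mem_map_toeplitz no_sinks hp hA
  refine NonUnitalStarSubalgebra.topologicalClosure_minimal _ (NonUnitalStarAlgebra.adjoin_le ?_)
    isClosed_qD
  rintro _ ⟨α, β, l, -, hlen, -, -, rfl⟩
  refine mem_qD hp hA (mul_mem (mul_mem (hu α) ?_) (star_mem (hu β)))
    (mul_z_pow_mul_star_mem_spectralSubspace l hlen)
  induction l with
  | zero => rwa [pow_zero]
  | succ l ih => rw [pow_succ]; exact mul_mem ih hz

end DirGraph

end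

theorem mainTheorem6 {V E : Type*} [Fintype V] [Fintype E]
    (G : DirGraph V E) (no_sinks : ∀ v, ∃ e, G.s e = v)
    (Z : G.WeightSeq) (p : ℕ) (hp : 1 ≤ p) (hA : G.ConditionA Z p)
    (ξ : DirGraph.PathChoice G p) :
    ∃ (hle : ∀ n, G.C Z p n ≤ G.C Z p (n + 1)) (hD : ∀ n, G.C Z p n ≤ G.qD Z)
      (τ : ∀ n, G.C Z p n ≃⋆ₐ[ℂ] G.A Z ξ n),
      (∀ n (c : G.C Z p n), (τ n c : Matrix (G.Gam p n) (G.Gam p n) G.Calkin) =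
        G.tauFormula ξ n c) ∧
      (∀ n (γ₁ γ₂ : G.Gam p n) (hs : γ₁.1.src = γ₂.1.src) (b : G.Calkin)
        (hb : b ∈ G.Cv Z ξ γ₁.1.src),
        ((τ n).symm ⟨G.unit γ₁ γ₂ b, G.unit_mem Z ξ n γ₁ γ₂ hs b hb⟩ : G.Calkin) =
          G.u γ₁.1 * star (G.u (ξ.ξ γ₁.1.src)) * b * G.u (ξ.ξ γ₁.1.src) * star (G.u γ₂.1)) ∧
      IsClosed (G.qD Z : Set G.Calkin) ∧
      IsCStarDirectLimit.{w}
        (fun n => (τ (n + 1) : G.C Z p (n + 1) →⋆ₙₐ[ℂ] G.A Z ξ (n + 1)).comp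
          ((NonUnitalStarSubalgebra.inclusion (hle n)).comp
            ((τ n).symm : G.A Z ξ n →⋆ₙₐ[ℂ] G.C Z p n)))
        (fun n => (NonUnitalStarSubalgebra.inclusion (hD n)).comp
          ((τ n).symm : G.A Z ξ n →⋆ₙₐ[ℂ] G.C Z p n)) := by
  refine ⟨DirGraph.C_le_C_succ hp hA, DirGraph.C_le_qD no_sinks hp hA, DirGraph.tauEquiv ξ hp hA,
    fun n c => DirGraph.coe_tauEquiv ξ hp hA c,
    fun n γ₁ γ₂ hs b hb => DirGraph.coe_tauEquiv_symm_unit ξ hp hA hs hb, DirGraph.isClosed_qD, ?_⟩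
  exact IsCStarDirectLimit.of_dense (G.C Z p) (G.qD Z) DirGraph.isClosed_C DirGraph.isClosed_qD
    _ _ (DirGraph.qD_subset_closure hp hA) _
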